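/- Let $M$ be a smooth manifold. A quaternionic vector bundle $E$ over $M$ is a smooth real vector bundle with structural group $\mathrm{Sp}(1)\cdot\mathrm{GL}(k,\mathbb{H})$; equivalently, it is endowed with a rank three subbundle $Q\subseteq\mathrm{End}(E)$ locally generated by smooth sections $I,J,K$ with $I^2=J^2=-1$ and $K=IJ=-JI$. The bundle $Q$ is oriented and Riemannian, such frames $(I,J,K)$ being positive and orthonormal, and its sphere bundle $\pi:Z\to M$, $Z=\{J\in Q\,|\,J^2=-1\}$, is the bundle of admissible linear complex structures of $E$. Let $(E,V)$ be an almost $f$-quaternionic structure on $M$: $E$ is a quaternionic vector bundle over $M$ and $V,TM\subseteq E$ are vector subbundles such that $E=V\oplus TM$ and $JV\subseteq TM$ for every $J\in Z$. Let $\rho:E\to TM$ be the corresponding projection; then $(E,\rho)$ is an almost co-CR quaternionic structure, that is, $\rho$ is a surjective morphism of vector bundles whose kernel contains no nonzero subspace preserved by some $J\in Z$. Let $D$ be a torsion-free connection on $M$, compatible with $(E,V)$, and let $\nabla$ be the connection induced by $D$ on $E$: $\nabla$ is a (smooth) connection on $E$ which preserves $Q$, $V$ and $TM$, and whose restriction to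 $TM$ is $D$ (thus $\nabla=D^V\oplus D$, with $D^V$ the connection induced on $V$). For $J\in Z$ let $E^J=\ker(J+\mathrm{i})\subseteq E^{\mathbb{C}}_{\pi(J)}$, and let $\mathcal{B}_J\subseteq T^{\mathbb{C}}_JZ$ be the horizontal lift of $\rho(E^J)$ with respect to the connection induced by $\nabla$ on $Z$. Let $\mathcal{C}=(\ker\mathrm{d}\pi)^{0,1}\oplus\mathcal{B}$, a complex distribution on $Z$, where the complex structure on the tangent space at $J$ of a fibre of $Z$, identified with $\{A\in Q_{\pi(J)}\,|\,AJ+JA=0\}$, is $A\mapsto JA$. If $\operatorname{rank}E=4\operatorname{rank}V\geq12$ then $(E,\rho,\nabla)$ is integrable; that is, the space of (local) sections of $\mathcal{C}$ is closed under the Lie bracket. -/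

import Mathlib

open Bundle Filter Module VectorField
open scoped Manifold ContDiff Topology TensorProduct

noncomputable section

namespace CoCR

section Bundles

variable {EM : Type*} [NormedAddCommGroup EM] [NormedSpace ℝ EM]
  {M : Type*} [TopologicalSpace M] [ChartedSpace EM M]
  (F : Type*) [NormedAddCommGroup F] [NormedSpace ℝ F]
  (E : M → Type*) [TopologicalSpace (TotalSpace F E)]
  [∀ x, AddCommGroup (E x)] [∀ x, Module ℝ (E x)] [∀ x, TopologicalSpace (E x)]
  [∀ x, IsTopologicalAddGroup (E x)] [∀ x, ContinuousSMul ℝ (E x)]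
  [FiberBundle F E] [VectorBundle ℝ F E]

/-- The total space of the vector bundle `End(E)`. -/
abbrev EndTotal : Type _ := TotalSpace (F →L[ℝ] F) (fun x : M ↦ E x →L[ℝ] E x)

/-- The model with corners of the total space of `End(E)`. -/
abbrev endModel (EM : Type*) [NormedAddCommGroup EM] [NormedSpace ℝ EM]
    (F : Type*) [NormedAddCommGroup F] [NormedSpace ℝ F] :
    ModelWithCorners ℝ (EM × (F →L[ℝ] F)) (ModelProd EM (F →L[ℝ] F)) :=
  𝓘(ℝ, EM).prod 𝓘(ℝ, F →L[ℝ] F)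

/-- A section of `End(E)`, as a map into the total space. -/
abbrev endSection (A : ∀ x : M, E x →L[ℝ] E x) : M → EndTotal F E := fun x ↦ ⟨x, A x⟩

/-- A section of `E`, as a map into the total space. -/
abbrev bundleSection (σ : ∀ x : M, E x) : M → TotalSpace F E := fun x ↦ ⟨x, σ x⟩

/-- A quaternionic vector bundle structure on `E`, that is, a reduction of the structural group
of `E` to `Sp(1)·GL(k, ℍ)`.  Since this group is the normaliser of `Im ℍ` (acting on `ℍ^k` by
left multiplications) in the real general linear group of `ℍ^k`, such a reduction is given by a
rank three subbundle `Q` of `End(E)` which is locally generated by smooth sections `I, J, K`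
satisfying the quaternionic relations.  The oriented Riemannian structure on `Q` is the one for
which all these `(I, J, K)` are positive orthonormal frames. -/
structure QuaternionicStructure where
  /-- The bundle of imaginary quaternions. -/
  Q : ∀ x : M, Submodule ℝ (E x →L[ℝ] E x)
  exists_local_frame : ∀ x₀ : M, ∃ U : Set M, IsOpen U ∧ x₀ ∈ U ∧
    ∃ I J K : ∀ x : M, E x →L[ℝ] E x,
      ContMDiffOn 𝓘(ℝ, EM) (endModel EM F) ∞ (endSection F E I) U ∧
      ContMDiffOn 𝓘(ℝ, EM) (endModel EM F) ∞ (endSection F E J) U ∧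
      ContMDiffOn 𝓘(ℝ, EM) (endModel EM F) ∞ (endSection F E K) U ∧
      ∀ x ∈ U, I x ∘L I x = -ContinuousLinearMap.id ℝ (E x) ∧
        J x ∘L J x = -ContinuousLinearMap.id ℝ (E x) ∧
        I x ∘L J x = K x ∧ J x ∘L I x = -K x ∧
        Q x = Submodule.span ℝ {I x, J x, K x}

variable {F E}

namespace QuaternionicStructure

variable (𝒬 : QuaternionicStructure (EM := EM) F E)

/-- `J` is an admissible linear complex structure on `E x`: an element of the unit sphere of
`Q x`, equivalently, an element of `Q x` whose square is `-1`. -/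
def IsAdmissible {x : M} (J : E x →L[ℝ] E x) : Prop :=
  J ∈ 𝒬.Q x ∧ J ∘L J = -ContinuousLinearMap.id ℝ (E x)

/-- The bundle `Z` of admissible linear complex structures, as an (embedded) submanifold of the
total space of `End(E)`. -/
def Z : Set (EndTotal F E) := {p | 𝒬.IsAdmissible p.2}

/-- A connection on `E` is compatible with the structural group `Sp(1)·GL(k, ℍ)` if the connection
induced on `End(E)`, `(∇_v A) σ = ∇_v (A σ) - A (∇_v σ)`, preserves `Q`. -/
def IsCompatible (nabla : CovariantDerivative 𝓘(ℝ, EM) F E) : Prop :=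
  ∀ (x : M) (A : ∀ y : M, E y →L[ℝ] E y),
    MDifferentiableAt 𝓘(ℝ, EM) (endModel EM F) (endSection F E A) x →
    (∀ᶠ y in 𝓝 x, A y ∈ 𝒬.Q y) →
    ∀ v : TangentSpace 𝓘(ℝ, EM) x, ∃ B ∈ 𝒬.Q x, ∀ σ : ∀ y : M, E y,
      MDifferentiableAt 𝓘(ℝ, EM) (𝓘(ℝ, EM).prod 𝓘(ℝ, F)) (bundleSection F E σ) x →
      nabla (fun y ↦ A y (σ y)) x v - A x (nabla σ x v) = B (σ x)

end QuaternionicStructure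

/-- The section `A` of `End(E)` satisfies `(∇_v A)(x) = 0`, with respect to the connection induced
on `End(E)` by `nabla`. -/
def IsParallelAt (nabla : CovariantDerivative 𝓘(ℝ, EM) F E) (A : ∀ y : M, E y →L[ℝ] E y)
    (x : M) (v : TangentSpace 𝓘(ℝ, EM) x) : Prop :=
  ∀ σ : ∀ y : M, E y,
    MDifferentiableAt 𝓘(ℝ, EM) (𝓘(ℝ, EM).prod 𝓘(ℝ, F)) (bundleSection F E σ) x →
    nabla (fun y ↦ A y (σ y)) x v = A x (nabla σ x v)

/-- The horizontal subspace at `p` of the connection induced on `End(E)` by `nabla`: it is formed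
of the vectors `dA(v)`, with `A` a section through `p` such that `∇_v A = 0`.  (These vectors
already form a linear space.)  If `nabla` is compatible with a quaternionic structure and `p ∈ Z`,
this is the horizontal subspace at `p` of the connection induced on `Z`. -/
def horizontal (nabla : CovariantDerivative 𝓘(ℝ, EM) F E) (p : EndTotal F E) :
    Submodule ℝ (TangentSpace (endModel EM F) p) :=
  Submodule.span ℝ {ξ | ∃ (A : ∀ y : M, E y →L[ℝ] E y) (v : TangentSpace 𝓘(ℝ, EM) p.1),
    A p.1 = p.2 ∧
    MDifferentiableAt 𝓘(ℝ, EM) (endModel EM F) (endSection F E A) p.1 ∧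
    IsParallelAt nabla A p.1 v ∧
    ξ = mfderiv 𝓘(ℝ, EM) (endModel EM F) (endSection F E A) p.1 v}

/-- The vertical vector at `p` determined by `A ∈ End(E)`: the velocity at `0` of the curve
`t ↦ p + t A` in the fibre. -/
def verticalLift (p : EndTotal F E) (A : E p.1 →L[ℝ] E p.1) :
    TangentSpace (endModel EM F) p :=
  mfderiv 𝓘(ℝ, ℝ) (endModel EM F) (fun t : ℝ ↦ (⟨p.1, p.2 + t • A⟩ : EndTotal F E)) 0 (1 : ℝ)

/-- The element `a + i b` of the complexification of a real vector space. -/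
def cpx {W : Type*} [AddCommGroup W] [Module ℝ W] (a b : W) : ℂ ⊗[ℝ] W :=
  (1 : ℂ) ⊗ₜ[ℝ] a + Complex.I ⊗ₜ[ℝ] b

/-- `E^J = ker(J + i)`, a complex subspace of the complexification of the fibre. -/
def EJ {x : M} (J : E x →L[ℝ] E x) : Submodule ℂ (ℂ ⊗[ℝ] E x) :=
  LinearMap.ker ((J : E x →ₗ[ℝ] E x).baseChange ℂ + Complex.I • LinearMap.id)

/-- `ρ(E^J)`, a complex subspace of the complexified tangent space of `M`. -/
def rhoEJ {x : M} (ρ : E x →L[ℝ] TangentSpace 𝓘(ℝ, EM) x) (J : E x →L[ℝ] E x) :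
    Submodule ℂ (ℂ ⊗[ℝ] TangentSpace 𝓘(ℝ, EM) x) :=
  (EJ J).map ((ρ : E x →ₗ[ℝ] TangentSpace 𝓘(ℝ, EM) x).baseChange ℂ)

/-- The differential of the projection `End(E) → M`. -/
def dproj (p : EndTotal F E) :
    TangentSpace (endModel EM F) p →ₗ[ℝ] TangentSpace 𝓘(ℝ, EM) p.1 :=
  (mfderiv (endModel EM F) 𝓘(ℝ, EM) (TotalSpace.proj : EndTotal F E → M) p).toLinearMap

/-- The horizontal lift at `p = J` of `ρ(E^J)`, with respect to `nabla`. -/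
def distB (ρ : ∀ x : M, E x →L[ℝ] TangentSpace 𝓘(ℝ, EM) x)
    (nabla : CovariantDerivative 𝓘(ℝ, EM) F E) (p : EndTotal F E) :
    Submodule ℂ (ℂ ⊗[ℝ] TangentSpace (endModel EM F) p) :=
  (horizontal nabla p).baseChange ℂ ⊓ (rhoEJ (ρ p.1) p.2).comap ((dproj p).baseChange ℂ)

namespace QuaternionicStructure

variable (𝒬 : QuaternionicStructure (EM := EM) F E)

/-- The space `(ker dπ)^{0,1}` at `p = J ∈ Z`, where `π : Z → M`.  The tangent space at `J` of the
sphere `Z_x` is the orthogonal complement of `J` in `Q x`, that is, the space of all `A ∈ Q x`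
which anticommute with `J`; its complex structure is `A ↦ J A = J × A`, so that its
`(0,1)`-vectors are `A + i J A`. -/
def vertical01 (p : EndTotal F E) : Submodule ℂ (ℂ ⊗[ℝ] TangentSpace (endModel EM F) p) :=
  Submodule.span ℂ {ζ | ∃ A ∈ 𝒬.Q p.1, p.2 ∘L A + A ∘L p.2 = 0 ∧
    ζ = cpx (verticalLift (EM := EM) p A) (verticalLift (EM := EM) p (p.2 ∘L A))}

/-- The complex distribution `𝒞 = (ker dπ)^{0,1} ⊕ ℬ` on `Z`. -/
def distC (ρ : ∀ x : M, E x →L[ℝ] TangentSpace 𝓘(ℝ, EM) x)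
    (nabla : CovariantDerivative 𝓘(ℝ, EM) F E) (p : EndTotal F E) :
    Submodule ℂ (ℂ ⊗[ℝ] TangentSpace (endModel EM F) p) :=
  𝒬.vertical01 p ⊔ distB ρ nabla p

end QuaternionicStructure

/-- A vector field on the total space of `End(E)`, as a map into the tangent bundle. -/
abbrev fieldSection (X : ∀ p : EndTotal F E, TangentSpace (endModel EM F) p) :
    EndTotal F E → TangentBundle (endModel EM F) (EndTotal F E) := fun p ↦ ⟨p, X p⟩

variable (EM F E) in
/-- An almost co-CR quaternionic structure `(E, ρ)` on `M`: a quaternionic vector bundle `E` and a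
surjective morphism of vector bundles `ρ : E → TM` whose kernel contains no nonzero subspace
preserved by some admissible linear complex structure. -/
structure AlmostCoCRQuaternionicStructure [IsManifold 𝓘(ℝ, EM) ∞ M] extends
    QuaternionicStructure (EM := EM) F E where
  /-- The morphism `E → TM`. -/
  ρ : ∀ x : M, E x →L[ℝ] TangentSpace 𝓘(ℝ, EM) x
  contMDiff_ρ : ContMDiff 𝓘(ℝ, EM) (𝓘(ℝ, EM).prod 𝓘(ℝ, F →L[ℝ] EM)) ∞
    (fun x ↦ (⟨x, ρ x⟩ :
      TotalSpace (F →L[ℝ] EM) (fun x : M ↦ E x →L[ℝ] TangentSpace 𝓘(ℝ, EM) x)))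
  surjective_ρ : ∀ x, Function.Surjective (ρ x)
  eq_bot_of_invariant : ∀ (x : M) (J : E x →L[ℝ] E x),
    toQuaternionicStructure.IsAdmissible J → ∀ W : Submodule ℝ (E x),
    (∀ w ∈ W, ρ x w = 0) → (∀ w ∈ W, J w ∈ W) → W = ⊥

/-- Integrability of `(E, ρ, ∇)`: the complex distribution `𝒞` on `Z` is involutive.
Complex vector fields on open subsets of the submanifold `Z` are represented by their local
extensions `X = X₁ + i X₂` to open subsets `O` of the total space of `End(E)`; those extending
sections of `𝒞` are tangent to `Z` along `Z`, so that, along `Z`, their brackets are the brackets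
on `Z`. -/
def AlmostCoCRQuaternionicStructure.IsIntegrable [IsManifold 𝓘(ℝ, EM) ∞ M]
    [ContMDiffVectorBundle ∞ F E 𝓘(ℝ, EM)]
    (S : AlmostCoCRQuaternionicStructure EM F E)
    (nabla : CovariantDerivative 𝓘(ℝ, EM) F E) : Prop :=
  ∀ (O : Set (EndTotal F E)), IsOpen O →
  ∀ X₁ X₂ Y₁ Y₂ : ∀ p : EndTotal F E, TangentSpace (endModel EM F) p,
    ContMDiffOn (endModel EM F) (endModel EM F).tangent ∞ (fieldSection X₁) O →
    ContMDiffOn (endModel EM F) (endModel EM F).tangent ∞ (fieldSection X₂) O →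
    ContMDiffOn (endModel EM F) (endModel EM F).tangent ∞ (fieldSection Y₁) O →
    ContMDiffOn (endModel EM F) (endModel EM F).tangent ∞ (fieldSection Y₂) O →
    (∀ p ∈ O ∩ S.Z, cpx (X₁ p) (X₂ p) ∈ S.distC S.ρ nabla p) →
    (∀ p ∈ O ∩ S.Z, cpx (Y₁ p) (Y₂ p) ∈ S.distC S.ρ nabla p) →
    ∀ p ∈ O ∩ S.Z,
      cpx (mlieBracket (endModel EM F) X₁ Y₁ p - mlieBracket (endModel EM F) X₂ Y₂ p)
        (mlieBracket (endModel EM F) X₁ Y₂ p + mlieBracket (endModel EM F) X₂ Y₁ p)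
        ∈ S.distC S.ρ nabla p

variable (EM F E) in
/-- An almost `f`-quaternionic structure `(E, V)` on `M`: a quaternionic vector bundle
`E = V ⊕ TM` such that `J V ⊆ TM` for every admissible linear complex structure `J`.
The decomposition is given by the inclusion `ι : TM → E` and the projection `ρ : E → TM`, with
`V = ker ρ`. -/
structure AlmostFQuaternionicStructure [IsManifold 𝓘(ℝ, EM) ∞ M] extends
    QuaternionicStructure (EM := EM) F E where
  /-- The inclusion `TM → E`. -/
  ι : ∀ x : M, TangentSpace 𝓘(ℝ, EM) x →L[ℝ] E x
  /-- The projection `E → TM`. -/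
  ρ : ∀ x : M, E x →L[ℝ] TangentSpace 𝓘(ℝ, EM) x
  contMDiff_ι : ContMDiff 𝓘(ℝ, EM) (𝓘(ℝ, EM).prod 𝓘(ℝ, EM →L[ℝ] F)) ∞
    (fun x ↦ (⟨x, ι x⟩ :
      TotalSpace (EM →L[ℝ] F) (fun x : M ↦ TangentSpace 𝓘(ℝ, EM) x →L[ℝ] E x)))
  contMDiff_ρ : ContMDiff 𝓘(ℝ, EM) (𝓘(ℝ, EM).prod 𝓘(ℝ, F →L[ℝ] EM)) ∞
    (fun x ↦ (⟨x, ρ x⟩ :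
      TotalSpace (F →L[ℝ] EM) (fun x : M ↦ E x →L[ℝ] TangentSpace 𝓘(ℝ, EM) x)))
  ρ_ι : ∀ (x : M) (v : TangentSpace 𝓘(ℝ, EM) x), ρ x (ι x v) = v
  map_V_le : ∀ (x : M) (J : E x →L[ℝ] E x), toQuaternionicStructure.IsAdmissible J →
    ∀ u : E x, ρ x u = 0 → ∃ v : TangentSpace 𝓘(ℝ, EM) x, J u = ι x v

namespace AlmostFQuaternionicStructure

variable [IsManifold 𝓘(ℝ, EM) ∞ M] (S : AlmostFQuaternionicStructure EM F E)

/-- The subbundle `V` of `E`. -/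
def V (x : M) : Submodule ℝ (E x) := LinearMap.ker (S.ρ x).toLinearMap

/-- The underlying almost co-CR quaternionic structure `(E, ρ)`. -/
def toAlmostCoCR : AlmostCoCRQuaternionicStructure EM F E where
  toQuaternionicStructure := S.toQuaternionicStructure
  ρ := S.ρ
  contMDiff_ρ := S.contMDiff_ρ
  surjective_ρ x v := ⟨S.ι x v, S.ρ_ι x v⟩
  eq_bot_of_invariant x J hJ W hW hJW := by
    refine (Submodule.eq_bot_iff W).2 fun w hw ↦ ?_
    obtain ⟨v, hv⟩ := S.map_V_le x J hJ w (hW w hw)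
    have h0 : J w = 0 := by
      have h1 := hW _ (hJW w hw)
      rw [hv, S.ρ_ι] at h1
      rw [hv, h1, map_zero]
    have h2 : J (J w) = -w := by simpa using DFunLike.congr_fun hJ.2 w
    rw [h0, map_zero] at h2
    exact neg_eq_zero.1 h2.symm

/-- A connection on `E` is compatible with the group of `f`-quaternionic linear isomorphisms, that
is, the group of quaternionic linear isomorphisms preserving both `V` and `TM`. -/
structure IsCompatible (nabla : CovariantDerivative 𝓘(ℝ, EM) F E) : Prop where
  quaternionic : S.toQuaternionicStructure.IsCompatible nabla
  preserves_V : ∀ (x : M) (σ : ∀ y : M, E y),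
    MDifferentiableAt 𝓘(ℝ, EM) (𝓘(ℝ, EM).prod 𝓘(ℝ, F)) (bundleSection F E σ) x →
    (∀ᶠ y in 𝓝 x, σ y ∈ S.V y) →
    ∀ v : TangentSpace 𝓘(ℝ, EM) x, nabla σ x v ∈ S.V x
  preserves_TM : ∀ (x : M) (σ : ∀ y : M, E y),
    MDifferentiableAt 𝓘(ℝ, EM) (𝓘(ℝ, EM).prod 𝓘(ℝ, F)) (bundleSection F E σ) x →
    (∀ᶠ y in 𝓝 x, σ y ∈ LinearMap.range (S.ι y).toLinearMap) →
    ∀ v : TangentSpace 𝓘(ℝ, EM) x, nabla σ x v ∈ LinearMap.range (S.ι x).toLinearMap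

/-- `D` is a connection on `M`, compatible with `(E, V)`, and `nabla = D^V ⊕ D` is the connection
induced by it on `E`: that is, `nabla` is compatible with `(E, V)` and its restriction to `TM`
is `D`. -/
structure IsInducedBy (nabla : CovariantDerivative 𝓘(ℝ, EM) F E)
    (D : CovariantDerivative 𝓘(ℝ, EM) EM (TangentSpace 𝓘(ℝ, EM) : M → Type _)) : Prop where
  compatible : S.IsCompatible nabla
  restrict_eq : ∀ (x : M) (Y : ∀ y : M, TangentSpace 𝓘(ℝ, EM) y),
    MDifferentiableAt 𝓘(ℝ, EM) 𝓘(ℝ, EM).tangent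
      (fun y ↦ (⟨y, Y y⟩ : TangentBundle 𝓘(ℝ, EM) M)) x →
    ∀ v : TangentSpace 𝓘(ℝ, EM) x, nabla (fun y ↦ S.ι y (Y y)) x v = S.ι x (D Y x v)

end AlmostFQuaternionicStructure

end Bundles

end CoCR

end

/-! Write a section of $\mathcal{C}$ as $X=X_1+\mathrm{i}X_2$, split tangent vectors of $Z$ at $A$
into base and vertical parts by means of $\nabla$, and put $P=\iota\rho$. Then $X$ lies over
$\rho(e+\mathrm{i}Ae)$ for a section $e$ of $E$, and its vertical part is $C+\mathrm{i}AC$ with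
$C\in Q$ anticommuting with $A$. Let $f$ play the role of $e$ for $Y$.

Base part of $[X,Y]$: since $D$ is torsion-free, $\iota[X,Y]=\nabla_X(\iota Y)-\nabla_Y(\iota X)$.
Since $\nabla P=0$, this is $P$ applied to $\nabla_X(f+\mathrm{i}Af)-\nabla_Y(e+\mathrm{i}Ae)$,
which is again of the form $g+\mathrm{i}Ag$, because the vertical part of $X$, which is the
derivative of the tautological $A$, is of type $(0,1)$.

Vertical part: it is $\nabla_X(\mathrm{vert}\,Y)-\nabla_Y(\mathrm{vert}\,X)-[R(X,Y),A]$. The first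
two terms together have the right type, so the only obstruction is the curvature. With
$a+\mathrm{i}b=R(\rho(e+\mathrm{i}Ae),\rho(f+\mathrm{i}Af))$ one needs $[b,A]=A[a,A]$, that is,
`typeDefect` must vanish.

This is pointwise algebra (`IsFQuaternionFrame.typeDefect_eq_zero`). Completing $A$ to a frame
$(A,B,AB)$, the operators $a$ and $b$ commute with $P$ and act on $Q$ as infinitesimal rotations.
`nullPart` is a $V$-valued combination whose cyclic sum vanishes by the first Bianchi identity. It
multiplies $v\in V$ by one coefficient of the defect, multiplies $Av$ into $v$ by the other, and
kills $Bv$. For $e\in\{v,Bv\}$ and $f\in\{w,Bw\}$, the cyclic identity with third argument $u$ or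
$Au$ says that a defect coefficient times $u$ lies in the span of $v,w$. As $\dim V\ge3$, $u$ can be
chosen outside that span, so both coefficients vanish. The equality $\dim E=4\dim V$ gives
$E=V\oplus AV\oplus BV\oplus ABV$, and the behaviour of the defect under $A$ extends the vanishing
to all $e,f$.

The analysis is done in a chart (`LocalFQuaternionic`), where `isTypeC_lieBracket` is the result;
`IsCoordExpr.cpx_mem_distC_iff` translates between `distC` and its coordinate form. -/

noncomputable section

namespace CoCR

/-! ### Algebra of imaginary quaternions. -/

section Quaternionic

variable {R : Type*} [Ring R] [Algebra ℝ R]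

/-- The relations satisfied by a positive orthonormal frame of imaginary quaternions. -/
structure IsQuaternionFrame (I J K : R) : Prop where
  II : I * I = -1
  JJ : J * J = -1
  IJ : I * J = K
  JI : J * I = -K

namespace IsQuaternionFrame

variable {I J K : R} (h : IsQuaternionFrame I J K)
include h

omit [Algebra ℝ R] in
theorem IK : I * K = -J := by rw [← h.IJ, ← mul_assoc, h.II, neg_one_mul]

omit [Algebra ℝ R] in
theorem KJ : K * J = -I := by rw [← h.IJ, mul_assoc, h.JJ, mul_neg_one]

omit [Algebra ℝ R] in
theorem KI : K * I = J := by
  rw [← h.IJ, mul_assoc, h.JI, mul_neg, h.IK, neg_neg]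

omit [Algebra ℝ R] in
theorem JK : J * K = I := by
  rw [← neg_eq_iff_eq_neg.2 h.JI, mul_neg, ← mul_assoc, h.JJ, neg_one_mul, neg_neg]

omit [Algebra ℝ R] in
theorem KK : K * K = -1 := by
  nth_rw 1 [← h.IJ]
  rw [mul_assoc, h.JK, h.II]

theorem comb_mul_comb (a b c x y z : ℝ) :
    (a • I + b • J + c • K) * (x • I + y • J + z • K) =
      (-(a * x + b * y + c * z)) • (1 : R) + (b * z - c * y) • I + (c * x - a * z) • J +
        (a * y - b * x) • K := by
  simp only [add_mul, mul_add, smul_mul_smul_comm, h.II, h.JJ, h.KK, h.IJ, h.JI, h.IK, h.KI, h.JK,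
    h.KJ]
  module

/-- The anticommutator recovers the inner product of $Q$, so orthogonality, norms and coefficients
can all be read off from products. -/
theorem comb_anticomm (a b c x y z : ℝ) :
    (a • I + b • J + c • K) * (x • I + y • J + z • K) +
      (x • I + y • J + z • K) * (a • I + b • J + c • K) =
      (-2 * (a * x + b * y + c * z)) • (1 : R) := by
  rw [h.comb_mul_comb, h.comb_mul_comb]
  module

theorem comb_mul_self (a b c : ℝ) :
    (a • I + b • J + c • K) * (a • I + b • J + c • K) =
      (-(a * a + b * b + c * c)) • (1 : R) := by
  rw [h.comb_mul_comb]
  module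

omit h in
theorem mem_span_triple {A : R} :
    A ∈ Submodule.span ℝ {I, J, K} ↔ ∃ a b c : ℝ, A = a • I + b • J + c • K := by
  rw [Submodule.mem_span_triple]
  exact ⟨fun ⟨a, b, c, h⟩ ↦ ⟨a, b, c, h.symm⟩, fun ⟨a, b, c, h⟩ ↦ ⟨a, b, c, h.symm⟩⟩

/-- Every imaginary unit quaternion is the first element of a frame. -/
theorem exists_frame [Nontrivial R] {A : R} (hA : A ∈ Submodule.span ℝ {I, J, K})
    (hAA : A * A = -1) :
    ∃ B, IsQuaternionFrame A B (A * B) ∧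
      Submodule.span ℝ {A, B, A * B} = Submodule.span ℝ {I, J, K} := by
  obtain ⟨a, b, c, rfl⟩ := mem_span_triple.1 hA
  have hn : a * a + b * b + c * c = 1 := by
    rw [h.comb_mul_self, ← sub_eq_zero] at hAA
    have : (1 - (a * a + b * b + c * c)) • (1 : R) = 0 := by
      rw [← hAA]; module
    rcases smul_eq_zero.1 this with h0 | h0
    · linarith
    · exact absurd h0 one_ne_zero
  -- $B$ must be a unit vector orthogonal to $(a,b,c)$: take $I$ when $A=\pm K$, and the normalised
  -- $(-b,a,0)$ otherwise.
  by_cases hab : a * a + b * b = 0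
  · have ha : a = 0 := by nlinarith [mul_self_nonneg a, mul_self_nonneg b]
    have hb : b = 0 := by nlinarith [mul_self_nonneg a, mul_self_nonneg b]
    subst ha hb
    have hc : c * c = 1 := by linarith
    refine ⟨I, ⟨hAA, h.II, rfl, ?_⟩, ?_⟩
    · simp [h.IK, h.KI]
    · apply le_antisymm <;> rw [Submodule.span_le] <;> rintro x (rfl | rfl | rfl)
      · exact mem_span_triple.2 ⟨0, 0, c, rfl⟩
      · exact mem_span_triple.2 ⟨1, 0, 0, by simp⟩
      · exact mem_span_triple.2 ⟨0, c, 0, by simp [h.KI]⟩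
      · exact mem_span_triple.2 ⟨0, 1, 0, by simp⟩
      · exact mem_span_triple.2 ⟨0, 0, c, by simp [h.KI, smul_smul, hc]⟩
      · exact mem_span_triple.2 ⟨c, 0, 0, by simp [smul_smul, hc]⟩
  · have hpos : 0 < a * a + b * b :=
      lt_of_le_of_ne (by nlinarith [mul_self_nonneg a, mul_self_nonneg b]) (Ne.symm hab)
    set r := Real.sqrt (a * a + b * b) with hr
    have hr0 : r ≠ 0 := (Real.sqrt_pos.2 hpos).ne'
    have hrr : r * r = a * a + b * b := Real.mul_self_sqrt hpos.le
    have hprod : (a • I + b • J + c • K) * ((-b / r) • I + (a / r) • J + (0 : ℝ) • K) =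
        (-(a * c) / r) • I + (-(b * c) / r) • J + r • K := by
      rw [h.comb_mul_comb]
      match_scalars
      · field_simp; ring
      · ring
      · ring
      · field_simp; linear_combination -hrr
    refine ⟨(-b / r) • I + (a / r) • J + (0 : ℝ) • K, ⟨hAA, ?_, rfl, ?_⟩, ?_⟩
    · rw [h.comb_mul_self]
      have : -b / r * (-b / r) + a / r * (a / r) + 0 * 0 = 1 := by
        field_simp; linear_combination -hrr
      rw [this]; module
    · rw [eq_neg_iff_add_eq_zero, h.comb_anticomm]
      have : -b / r * a + a / r * b + 0 * c = 0 := by ring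
      rw [this]; simp
    · rw [hprod]
      apply le_antisymm <;> rw [Submodule.span_le] <;> rintro x (rfl | rfl | rfl)
      · exact mem_span_triple.2 ⟨_, _, _, rfl⟩
      · exact mem_span_triple.2 ⟨_, _, _, rfl⟩
      · exact mem_span_triple.2 ⟨_, _, _, rfl⟩
      -- The matrix from $(I,J,K)$ to $(A,B,AB)$ is orthogonal, so the coefficients here and in the
      -- next two cases are the columns of that matrix.
      · refine mem_span_triple.2 ⟨a, -b / r, -(a * c) / r, ?_⟩
        match_scalars
        · field_simp; linear_combination (1 - a * a) * hrr - a * a * hn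
        · field_simp; linear_combination -(a * b) * hrr - (a * b) * hn
        · field_simp; ring1
      · refine mem_span_triple.2 ⟨b, a / r, -(b * c) / r, ?_⟩
        match_scalars
        · field_simp; linear_combination (1 - b * b) * hrr - b * b * hn
        · field_simp; linear_combination -(a * b) * hrr - (a * b) * hn
        · field_simp; ring1
      · refine mem_span_triple.2 ⟨c, 0, r, ?_⟩
        match_scalars
        · linear_combination - hrr - hn
        · field_simp; ring1
        · field_simp; ring1

/-- The imaginary quaternions anticommuting with the first element of a frame. -/
theorem eq_of_anticomm [Nontrivial R] {C : R} (hC : C ∈ Submodule.span ℝ {I, J, K})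
    (hIC : I * C + C * I = 0) : ∃ y z : ℝ, C = y • J + z • K := by
  obtain ⟨x, y, z, rfl⟩ := mem_span_triple.1 hC
  have h1 := h.comb_anticomm 1 0 0 x y z
  simp only [one_smul, zero_smul, add_zero] at h1
  rw [hIC] at h1
  rcases smul_eq_zero.1 h1.symm with h0 | h0
  · have : x = 0 := by linarith
    exact ⟨y, z, by simp [this]⟩
  · exact absurd h0 one_ne_zero

/-- A derivation of the algebra preserving the imaginary quaternions acts on them as an
infinitesimal rotation. -/
theorem exists_comm_eq [Nontrivial R] {a : R}
    (hI : a * I - I * a ∈ Submodule.span ℝ {I, J, K})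
    (hJ : a * J - J * a ∈ Submodule.span ℝ {I, J, K}) :
    ∃ x y z : ℝ, a * I = I * a + x • J + y • K ∧ a * J = J * a - x • I + z • K := by
  -- Applying the derivation $[a,\cdot]$ to $I^2=-1$ shows that $[a,I]$ anticommutes with $I$; the
  -- relations $J^2=-1$ and $IJ+JI=0$ then fix two of the coefficients of $[a,J]$.
  obtain ⟨x, y, hxy⟩ := h.eq_of_anticomm hI (by
    have : I * (a * I - I * a) + (a * I - I * a) * I = a * (I * I) - (I * I) * a := by
      noncomm_ring
    rw [this, h.II]; noncomm_ring)
  obtain ⟨p, q, r, hpq⟩ := mem_span_triple.1 hJ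
  have hq : (p • I + q • J + r • K) * J + J * (p • I + q • J + r • K) = 0 := by
    rw [← hpq]
    have : (a * J - J * a) * J + J * (a * J - J * a) = a * (J * J) - (J * J) * a := by
      noncomm_ring
    rw [this, h.JJ]; noncomm_ring
  have hp : (x • J + y • K) * J + J * (x • J + y • K) +
      (I * (p • I + q • J + r • K) + (p • I + q • J + r • K) * I) = 0 := by
    rw [← hpq, ← hxy]
    have : (a * I - I * a) * J + J * (a * I - I * a) +
      (I * (a * J - J * a) + (a * J - J * a) * I) = a * (I * J + J * I) - (I * J + J * I) * a := by
      noncomm_ring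
    rw [this, h.IJ, h.JI]; simp
  have h1 := h.comb_anticomm p q r 0 1 0
  simp only [zero_smul, one_smul, zero_add, add_zero, hq] at h1
  have h2 := h.comb_anticomm 0 x y 0 1 0
  have h3 := h.comb_anticomm 1 0 0 p q r
  simp only [zero_smul, one_smul, zero_add, add_zero] at h2 h3
  rw [h2, h3, ← add_smul] at hp
  have hq0 : q = 0 := by
    rcases smul_eq_zero.1 h1.symm with h0 | h0
    · linarith
    · exact absurd h0 one_ne_zero
  have hp0 : p = -x := by
    rcases smul_eq_zero.1 hp with h0 | h0
    · linarith
    · exact absurd h0 one_ne_zero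
  refine ⟨x, y, r, ?_, ?_⟩
  · rw [sub_eq_iff_eq_add] at hxy
    rw [hxy]; abel
  · rw [sub_eq_iff_eq_add] at hpq
    rw [hpq, hq0, hp0]; module

end IsQuaternionFrame

end Quaternionic

/-! ### Pointwise algebra of the curvature: Bianchi identity and type. -/

section Curvature

variable {F : Type*} [NormedAddCommGroup F] [NormedSpace ℝ F]

/-- An `f`-quaternionic vector space: `P` is the projection onto a complement of the space
`V = ker P`, which is mapped into the range of `P` by the imaginary quaternions. -/
structure IsFQuaternionFrame (I J K P : F →L[ℝ] F) : Prop extends IsQuaternionFrame I J K where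
  PP : P * P = P
  apply_mem : ∀ q ∈ Submodule.span ℝ {I, J, K}, ∀ v, P v = 0 → P (q v) = q v

/-- The bracket identities `[a, A] = x B + y AB` and `[a, B] = -x A + z AB`, together with
`[a, P] = 0`. -/
structure IsInfRotation (A B P a : F →L[ℝ] F) (x y z : ℝ) : Prop where
  comm_A : ∀ v, a (A v) = A (a v) + x • B v + y • A (B v)
  comm_B : ∀ v, a (B v) = B (a v) - x • A v + z • A (B v)
  comm_P : ∀ v, a (P v) = P (a v)

/-- A combination of the real and imaginary parts of `a + i b`, applied to the projection of
`g + i A g`, which only involves the bracket of `a + i b` with `B + i AB`. -/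
def nullPart (A B P a b : F →L[ℝ] F) (g : F) : F :=
  (1 - P) (B (a (P g) - b (P (A g)))) - (1 - P) (A (B (a (P (A g)) + b (P g))))

namespace IsFQuaternionFrame

variable {A B P : F →L[ℝ] F} (h : IsFQuaternionFrame A B (A * B) P)
include h

theorem AA (v : F) : A (A v) = -v := by simpa using DFunLike.congr_fun h.II v

theorem BB (v : F) : B (B v) = -v := by simpa using DFunLike.congr_fun h.JJ v

theorem BA (v : F) : B (A v) = -A (B v) := by simpa using DFunLike.congr_fun h.JI v

theorem P_A {v : F} (hv : P v = 0) : P (A v) = A v :=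
  h.apply_mem _ (Submodule.subset_span (by simp)) v hv

theorem P_B {v : F} (hv : P v = 0) : P (B v) = B v :=
  h.apply_mem _ (Submodule.subset_span (by simp)) v hv

theorem P_AB {v : F} (hv : P v = 0) : P (A (B v)) = A (B v) :=
  h.apply_mem (A * B) (Submodule.subset_span (by simp)) v hv

variable {a b : F →L[ℝ] F} {x₁ x₂ x₃ y₁ y₂ y₃ : ℝ}

/-- Since $a$ and $b$ commute with $P$, they preserve $V$. Moving them past $A$ leaves images of $V$
under $A$, $B$, $AB$, which lie in the range of $P$ and are killed by $1-P$. Only the bracket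
coefficients survive; $x_2+y_1$ is the $B$-coefficient of $[b,A]-A[a,A]$. -/
theorem nullPart_of_mem (ha : IsInfRotation A B P a x₁ x₂ x₃)
    (hb : IsInfRotation A B P b y₁ y₂ y₃) {v : F} (hv : P v = 0) :
    nullPart A B P a b v = (x₂ + y₁) • v := by
  have hav : P (a v) = 0 := by rw [← ha.comm_P, hv, map_zero]
  have hbv : P (b v) = 0 := by rw [← hb.comm_P, hv, map_zero]
  simp only [nullPart, hv, map_zero, h.P_A hv, ha.comm_A, hb.comm_A, map_add, map_sub, map_smul,
    h.AA, h.BB, h.BA, h.P_B hav, h.P_AB hbv, sub_apply, one_apply_eq_self, map_neg]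
  module

/-- The same mechanism isolates $y_2-x_1$, the $AB$-coefficient of $[b,A]-A[a,A]$. -/
theorem nullPart_apply_of_mem (ha : IsInfRotation A B P a x₁ x₂ x₃)
    (hb : IsInfRotation A B P b y₁ y₂ y₃) {v : F} (hv : P v = 0) :
    nullPart A B P a b (A v) = (y₂ - x₁) • v := by
  have hav : P (a v) = 0 := by rw [← ha.comm_P, hv, map_zero]
  have hbv : P (b v) = 0 := by rw [← hb.comm_P, hv, map_zero]
  simp only [nullPart, hv, map_zero, h.P_A hv, ha.comm_A, hb.comm_A, map_add, map_sub, map_smul,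
    h.AA, h.BB, h.BA, h.P_AB hav, h.P_B hbv, sub_apply, one_apply_eq_self, map_neg]
  module

/-- Here the contributions of the bracket coefficients cancel, so vectors of $BV$ do not contribute
to the cyclic identity. -/
theorem nullPart_eq_zero (ha : IsInfRotation A B P a x₁ x₂ x₃)
    (hb : IsInfRotation A B P b y₁ y₂ y₃) {v : F} (hv : P v = 0) :
    nullPart A B P a b (B v) = 0 := by
  have hav : P (a v) = 0 := by rw [← ha.comm_P, hv, map_zero]
  have hbv : P (b v) = 0 := by rw [← hb.comm_P, hv, map_zero]
  simp only [nullPart, hv, h.P_A hv, ha.comm_A, hb.comm_A, map_add, map_sub, map_smul, h.AA, h.BB,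
    h.BA, ha.comm_B, hb.comm_B, h.P_A hbv, h.P_B hv, h.P_AB hv, sub_apply, one_apply_eq_self,
    map_neg, hav]
  module

/-- `E = V ⊕ A V ⊕ B V ⊕ AB V`. -/
theorem exists_decomposition [FiniteDimensional ℝ F]
    (hdim : finrank ℝ F = 4 * finrank ℝ (LinearMap.ker P.toLinearMap)) (e : F) :
    ∃ v₀ v₁ v₂ v₃ : F, P v₀ = 0 ∧ P v₁ = 0 ∧ P v₂ = 0 ∧ P v₃ = 0 ∧
      e = (v₀ + B v₂) + A (v₁ + B v₃) := by
  set V := LinearMap.ker P.toLinearMap with hV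
  let s : V →ₗ[ℝ] F := V.subtype
  let T : (V × V) × (V × V) →ₗ[ℝ] F :=
    (s.coprod (A.toLinearMap ∘ₗ s)).coprod
      ((B.toLinearMap ∘ₗ s).coprod (A.toLinearMap ∘ₗ B.toLinearMap ∘ₗ s))
  have hT (v : (V × V) × (V × V)) :
      T v = v.1.1 + A v.1.2 + (B v.2.1 + A (B v.2.2)) := by simp [T, s]
  have hinj : Function.Injective T := by
    rw [← LinearMap.ker_eq_bot, LinearMap.ker_eq_bot']
    rintro ⟨⟨⟨v₀, h₀⟩, ⟨v₁, h₁⟩⟩, ⟨⟨v₂, h₂⟩, ⟨v₃, h₃⟩⟩⟩ h0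
    rw [hT] at h0
    dsimp only at h0
    replace h₀ : P v₀ = 0 := h₀
    replace h₁ : P v₁ = 0 := h₁
    replace h₂ : P v₂ = 0 := h₂
    replace h₃ : P v₃ = 0 := h₃
    -- Multiplying the relation by $1,A,B,AB$ brings each $v_i$ in turn back into $V$, up to sign,
    -- and the other three terms into the range of $P$; then $1-P$ isolates it.
    have key (q : F →L[ℝ] F) : (1 - P) (q (v₀ + A v₁ + (B v₂ + A (B v₃)))) = 0 := by
      rw [h0, map_zero, map_zero]
    have k0 := key 1
    have k1 := key A
    have k2 := key B
    have k3 : (1 - P) (A (B (v₀ + A v₁ + (B v₂ + A (B v₃))))) = 0 := key (A * B)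
    simp only [map_add, map_neg, h.AA, h.BA, h.BB, sub_apply, h.P_A, h.P_B, h.P_AB, h₀, h₁, h₂, h₃,
      one_apply_eq_self] at k0 k1 k2 k3
    have e0 : v₀ = 0 := by simpa using k0
    have e1 : v₁ = 0 := by simpa using k1
    have e2 : v₂ = 0 := by simpa using k2
    have e3 : v₃ = 0 := by simpa using k3
    simp [e0, e1, e2, e3]
  have hsurj : Function.Surjective T := by
    refine (LinearMap.injective_iff_surjective_of_finrank_eq_finrank ?_).1 hinj
    rw [Module.finrank_prod, Module.finrank_prod, hdim]
    ring
  obtain ⟨⟨⟨⟨v₀, h₀⟩, ⟨v₁, h₁⟩⟩, ⟨⟨v₂, h₂⟩, ⟨v₃, h₃⟩⟩⟩, rfl⟩ := hsurj e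
  refine ⟨v₀, v₁, v₂, v₃, h₀, h₁, h₂, h₃, ?_⟩
  rw [hT]
  simp only [map_add]
  abel

end IsFQuaternionFrame

theorem exists_not_mem_span_pair {W : Type*} [AddCommGroup W] [Module ℝ W] [FiniteDimensional ℝ W]
    (V : Submodule ℝ W) (h3 : 3 ≤ finrank ℝ V) (v w : W) :
    ∃ u ∈ V, ∀ c c' : ℝ, u ≠ c • v + c' • w := by
  classical
  by_contra! hc
  have hle : V ≤ Submodule.span ℝ (({v, w} : Finset W) : Set W) := by
    intro u hu
    obtain ⟨c, c', rfl⟩ := hc u hu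
    simpa using Submodule.mem_span_pair.2 ⟨c, c', rfl⟩
  have h1 := Submodule.finrank_mono hle
  have h2 : finrank ℝ (Submodule.span ℝ (({v, w} : Finset W) : Set W)) ≤ _ :=
    finrank_span_finset_le_card (R := ℝ) ({v, w} : Finset W)
  have h4 : ({v, w} : Finset W).card ≤ 2 := Finset.card_le_two
  omega

theorem eq_zero_of_smul_eq_comb {W : Type*} [AddCommGroup W] [Module ℝ W] {u v w : W}
    (hu : ∀ c c' : ℝ, u ≠ c • v + c' • w) {r c c' : ℝ} (h : r • u + c • v + c' • w = 0) :
    r = 0 := by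
  by_contra hr
  refine hu (-r⁻¹ * c) (-r⁻¹ * c') ?_
  have : u = r⁻¹ • (r • u) := by rw [smul_smul, inv_mul_cancel₀ hr, one_smul]
  rw [this, show r • u = -(c • v + c' • w) by rw [eq_neg_iff_add_eq_zero, ← h]; abel]
  module

/-- The defect of the bracket of the `(0,2)`-part of `R` with `A` from being of type `(0,1)`. -/
def typeDefect (R : F →ₗ[ℝ] F →ₗ[ℝ] (F →L[ℝ] F)) (A : F →L[ℝ] F) (e f : F) : F →L[ℝ] F :=
  ((R e (A f) + R (A e) f) * A - A * (R e (A f) + R (A e) f)) -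
    A * ((R e f - R (A e) (A f)) * A - A * (R e f - R (A e) (A f)))

section TypeDefect

variable {R : F →ₗ[ℝ] F →ₗ[ℝ] (F →L[ℝ] F)} {A : F →L[ℝ] F}

theorem typeDefect_add_left (e e' f : F) :
    typeDefect R A (e + e') f = typeDefect R A e f + typeDefect R A e' f := by
  simp only [typeDefect, map_add, LinearMap.add_apply]
  noncomm_ring

theorem typeDefect_add_right (e f f' : F) :
    typeDefect R A e (f + f') = typeDefect R A e f + typeDefect R A e f' := by
  simp only [typeDefect, map_add]
  noncomm_ring

/-- Replacing $e$ by $Ae$ multiplies $e+\mathrm{i}Ae$ by $-\mathrm{i}$, so $(a,b)$ becomes $(b,-a)$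
and the defect is multiplied on the left by $-A$. -/
theorem typeDefect_apply_left (hA : A * A = -1) (e f : F) :
    typeDefect R A (A e) f = -(A * typeDefect R A e f) := by
  have hA' : A (A e) = -e := by simpa using DFunLike.congr_fun hA e
  simp only [typeDefect, hA', map_neg, LinearMap.neg_apply]
  simp only [mul_sub, sub_mul, mul_add, add_mul, ← mul_assoc, hA, neg_mul, mul_neg, one_mul]
  abel

theorem typeDefect_apply_right (hA : A * A = -1) (e f : F) :
    typeDefect R A e (A f) = -(A * typeDefect R A e f) := by
  have hA' : A (A f) = -f := by simpa using DFunLike.congr_fun hA f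
  simp only [typeDefect, hA', map_neg]
  simp only [mul_sub, sub_mul, mul_add, add_mul, ← mul_assoc, hA, neg_mul, mul_neg, one_mul]
  abel

end TypeDefect

/-- The first Bianchi identity forces the bracket of the `(0,2)`-part of the curvature with `A` to
be of type `(0,1)`, as soon as `V` has dimension at least three. -/
theorem IsFQuaternionFrame.typeDefect_eq_zero [FiniteDimensional ℝ F] {A B P : F →L[ℝ] F}
    (h : IsFQuaternionFrame A B (A * B) P)
    (hdim : finrank ℝ F = 4 * finrank ℝ (LinearMap.ker P.toLinearMap))
    (h3 : 3 ≤ finrank ℝ (LinearMap.ker P.toLinearMap))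
    (R : F →ₗ[ℝ] F →ₗ[ℝ] (F →L[ℝ] F)) (hRP : ∀ e f, R e f * P = P * R e f)
    (hRQ : ∀ e f, ∀ q ∈ Submodule.span ℝ {A, B, A * B},
      R e f * q - q * R e f ∈ Submodule.span ℝ {A, B, A * B})
    (bianchi : ∀ e f g, R e f (P g) + R f g (P e) + R g e (P f) = 0) (e f : F) :
    typeDefect R A e f = 0 := by
  have hnt : Nontrivial (F →L[ℝ] F) := by
    have : Nontrivial F := Module.nontrivial_of_finrank_pos (R := ℝ) (by omega)
    infer_instance
  let a (e f : F) := R e f - R (A e) (A f)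
  let b (e f : F) := R e (A f) + R (A e) f
  have rot {r : F →L[ℝ] F} (hP : r * P = P * r)
      (hQ : ∀ q ∈ Submodule.span ℝ {A, B, A * B},
        r * q - q * r ∈ Submodule.span ℝ {A, B, A * B}) :
      ∃ x y z, IsInfRotation A B P r x y z := by
    obtain ⟨x, y, z, h1, h2⟩ := h.exists_comm_eq (hQ A (Submodule.subset_span (by simp)))
      (hQ B (Submodule.subset_span (by simp)))
    exact ⟨x, y, z, fun v ↦ by simpa using DFunLike.congr_fun h1 v,
      fun v ↦ by simpa using DFunLike.congr_fun h2 v,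
      fun v ↦ by simpa using DFunLike.congr_fun hP v⟩
  have rota (e f) : ∃ x y z, IsInfRotation A B P (a e f) x y z := by
    refine rot ?_ fun q hq ↦ ?_
    · simp only [a, sub_mul, mul_sub, hRP]
    · convert! Submodule.sub_mem _ (hRQ e f q hq) (hRQ (A e) (A f) q hq) using 1
      simp only [a, sub_mul, mul_sub]
      abel
  have rotb (e f) : ∃ x y z, IsInfRotation A B P (b e f) x y z := by
    refine rot ?_ fun q hq ↦ ?_
    · simp only [b, add_mul, mul_add, hRP]
    · convert! Submodule.add_mem _ (hRQ e (A f) q hq) (hRQ (A e) f q hq) using 1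
      simp only [b, add_mul, mul_add]
      abel
  have cyc (e f g : F) : nullPart A B P (a e f) (b e f) g + nullPart A B P (a f g) (b f g) e +
      nullPart A B P (a g e) (b g e) f = 0 := by
    -- `hr` and `hi` are the real and imaginary parts of the complexified Bianchi identity at
    -- $e+\mathrm{i}Ae$, $f+\mathrm{i}Af$, $g+\mathrm{i}Ag$.
    have hr : a e f (P g) - b e f (P (A g)) + (a f g (P e) - b f g (P (A e))) +
        (a g e (P f) - b g e (P (A f))) = 0 := by
      have := congr($(bianchi e f g) - $(bianchi (A e) (A f) g) - $(bianchi e (A f) (A g)) -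
        $(bianchi (A e) f (A g)))
      simp only [sub_zero] at this
      rw [← this]
      simp only [a, b, sub_apply, add_apply]
      abel
    have hi : a e f (P (A g)) + b e f (P g) + (a f g (P (A e)) + b f g (P e)) +
        (a g e (P (A f)) + b g e (P f)) = 0 := by
      have := congr($(bianchi e f (A g)) + $(bianchi e (A f) g) + $(bianchi (A e) f g) -
        $(bianchi (A e) (A f) (A g)))
      simp only [sub_zero, add_zero] at this
      rw [← this]
      simp only [a, b, sub_apply, add_apply]
      abel
    have := congr((1 - P) (B $hr) - (1 - P) (A (B $hi)))
    simp only [map_zero, sub_zero] at this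
    rw [← this]
    simp only [nullPart, map_add]
    abel
  have main (v w : F) (e f : F) (hv : P v = 0) (hw : P w = 0) (he : e = v ∨ e = B v)
      (hf : f = w ∨ f = B w) : typeDefect R A e f = 0 := by
    have multiple {r s x₁ x₂ x₃ y₁ y₂ y₃ v} (hr : IsInfRotation A B P r x₁ x₂ x₃)
        (hs : IsInfRotation A B P s y₁ y₂ y₃) {e} (hv : P v = 0) (he : e = v ∨ e = B v) :
        ∃ c : ℝ, nullPart A B P r s e = c • v := by
      rcases he with rfl | rfl
      · exact ⟨_, h.nullPart_of_mem hr hs hv⟩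
      · exact ⟨0, by rw [h.nullPart_eq_zero hr hs hv, zero_smul]⟩
    -- The only use of $\dim V\ge3$: the terms of the cyclic identity at $e$ and $f$ lie on the
    -- lines of $v$ and $w$, so they cannot cancel a nonzero multiple of $u$.
    obtain ⟨u, hu, huvw⟩ := exists_not_mem_span_pair _ h3 v w
    replace hu : P u = 0 := hu
    obtain ⟨x₁, x₂, x₃, hx⟩ := rota e f
    obtain ⟨y₁, y₂, y₃, hy⟩ := rotb e f
    have h12 (g : F) : ∃ c c' : ℝ,
        nullPart A B P (a e f) (b e f) g + c • v + c' • w = 0 := by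
      obtain ⟨_, _, _, hp⟩ := rota f g
      obtain ⟨_, _, _, hq⟩ := rotb f g
      obtain ⟨_, _, _, hp'⟩ := rota g e
      obtain ⟨_, _, _, hq'⟩ := rotb g e
      obtain ⟨c, hc⟩ := multiple hp hq hv he
      obtain ⟨c', hc'⟩ := multiple hp' hq' hw hf
      exact ⟨c, c', by rw [← hc, ← hc', cyc]⟩
    obtain ⟨c, c', hc⟩ := h12 u
    obtain ⟨d, d', hd⟩ := h12 (A u)
    rw [h.nullPart_of_mem hx hy hu] at hc
    rw [h.nullPart_apply_of_mem hx hy hu] at hd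
    have h1 := eq_zero_of_smul_eq_comb huvw hc
    have h2 := eq_zero_of_smul_eq_comb huvw hd
    -- These two equalities say exactly that $[b,A]=A[a,A]$.
    have hy₁ : y₁ = -x₂ := by linarith
    have hy₂ : y₂ = x₁ := by linarith
    ext g
    change b e f (A g) - A (b e f g) - A (a e f (A g) - A (a e f g)) = 0
    rw [hy.comm_A, hx.comm_A, hy₁, hy₂]
    simp only [map_add, map_sub, map_smul, h.AA]
    module
  -- Grouping $E$ as $(V\oplus BV)\oplus A(V\oplus BV)$ allows the outer $A$ to be pulled out of
  -- either argument, leaving only the cases of `main`.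
  obtain ⟨v₀, v₁, v₂, v₃, h₀, h₁, h₂, h₃, rfl⟩ := h.exists_decomposition hdim e
  obtain ⟨w₀, w₁, w₂, w₃, k₀, k₁, k₂, k₃, rfl⟩ := h.exists_decomposition hdim f
  have half {v v' w w' : F} (hv : P v = 0) (hv' : P v' = 0) (hw : P w = 0) (hw' : P w' = 0) :
      typeDefect R A (v + B v') (w + B w') = 0 := by
    simp only [typeDefect_add_left, typeDefect_add_right,
      main v w _ _ hv hw (.inl rfl) (.inl rfl), main v w' _ _ hv hw' (.inl rfl) (.inr rfl),
      main v' w _ _ hv' hw (.inr rfl) (.inl rfl), main v' w' _ _ hv' hw' (.inr rfl) (.inr rfl),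
      add_zero]
  rw [typeDefect_add_left, typeDefect_add_right _ (w₀ + B w₂), typeDefect_apply_left h.II,
    typeDefect_add_right _ (w₀ + B w₂), typeDefect_apply_right h.II,
    typeDefect_apply_right h.II, half h₀ h₂ k₀ k₂, half h₀ h₂ k₁ k₃, half h₁ h₃ k₀ k₂,
    half h₁ h₃ k₁ k₃]
  simp

end Curvature

/-! ### Local model: tangent vectors to $Z$ and differentiation along $Z$. -/

/-- The coordinate expression, over an open set `U`, of an almost `f`-quaternionic structure
endowed with a compatible connection (with connection form `Γ`) whose restriction to the tangent
bundle is torsion free. -/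
structure LocalFQuaternionic (EM F : Type*) [NormedAddCommGroup EM] [NormedSpace ℝ EM]
    [NormedAddCommGroup F] [NormedSpace ℝ F] where
  U : Set EM
  I : EM → F →L[ℝ] F
  J : EM → F →L[ℝ] F
  K : EM → F →L[ℝ] F
  P : EM → F →L[ℝ] F
  ι : EM → EM →L[ℝ] F
  ρ : EM → F →L[ℝ] EM
  Γ : EM → EM →L[ℝ] F →L[ℝ] F
  isOpen_U : IsOpen U
  contDiffOn_I : ContDiffOn ℝ 2 I U
  contDiffOn_J : ContDiffOn ℝ 2 J U
  contDiffOn_K : ContDiffOn ℝ 2 K U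
  contDiffOn_P : ContDiffOn ℝ 2 P U
  contDiffOn_ι : ContDiffOn ℝ 2 ι U
  contDiffOn_Γ : ContDiffOn ℝ 2 Γ U
  frame : ∀ m ∈ U, IsFQuaternionFrame (I m) (J m) (K m) (P m)
  ρ_ι : ∀ m ∈ U, ∀ u, ρ m (ι m u) = u
  ι_ρ : ∀ m ∈ U, ∀ e, ι m (ρ m e) = P m e
  torsion : ∀ m ∈ U, ∀ u v, fderiv ℝ ι m u v + Γ m u (ι m v) = fderiv ℝ ι m v u + Γ m v (ι m u)
  parallel_P : ∀ m ∈ U, ∀ u, fderiv ℝ P m u + (Γ m u * P m - P m * Γ m u) = 0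
  parallel_I : ∀ m ∈ U, ∀ u,
    fderiv ℝ I m u + (Γ m u * I m - I m * Γ m u) ∈ Submodule.span ℝ {I m, J m, K m}
  parallel_J : ∀ m ∈ U, ∀ u,
    fderiv ℝ J m u + (Γ m u * J m - J m * Γ m u) ∈ Submodule.span ℝ {I m, J m, K m}
  parallel_K : ∀ m ∈ U, ∀ u,
    fderiv ℝ K m u + (Γ m u * K m - K m * Γ m u) ∈ Submodule.span ℝ {I m, J m, K m}
  finrank_eq : ∀ m ∈ U, finrank ℝ F = 4 * finrank ℝ (LinearMap.ker (P m).toLinearMap)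
  le_finrank : ∀ m ∈ U, 3 ≤ finrank ℝ (LinearMap.ker (P m).toLinearMap)

namespace LocalFQuaternionic

variable {EM F : Type*} [NormedAddCommGroup EM] [NormedSpace ℝ EM]
  [NormedAddCommGroup F] [NormedSpace ℝ F] (𝒟 : LocalFQuaternionic EM F)

/-- The imaginary quaternions. -/
def Q (m : EM) : Submodule ℝ (F →L[ℝ] F) := Submodule.span ℝ {𝒟.I m, 𝒟.J m, 𝒟.K m}

/-- The bundle of admissible complex structures. -/
def Z : Set (EM × (F →L[ℝ] F)) := {p | p.1 ∈ 𝒟.U ∧ p.2 ∈ 𝒟.Q p.1 ∧ p.2 * p.2 = -1}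

/-- The vertical part of a tangent vector to `End(E)`. -/
def vert (p ξ : EM × (F →L[ℝ] F)) : F →L[ℝ] F :=
  ξ.2 + (𝒟.Γ p.1 ξ.1 * p.2 - p.2 * 𝒟.Γ p.1 ξ.1)

/-- The tangent vectors to `Z`. -/
structure IsTangent (p ξ : EM × (F →L[ℝ] F)) : Prop where
  mem : 𝒟.vert p ξ ∈ 𝒟.Q p.1
  anticomm : p.2 * 𝒟.vert p ξ + 𝒟.vert p ξ * p.2 = 0

variable {𝒟} {m : EM} {p ξ η : EM × (F →L[ℝ] F)}

section Differentiability

variable (hm : m ∈ 𝒟.U)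
include hm

theorem differentiableAt_I : DifferentiableAt ℝ 𝒟.I m :=
  (𝒟.contDiffOn_I.differentiableOn two_ne_zero).differentiableAt (𝒟.isOpen_U.mem_nhds hm)

theorem differentiableAt_J : DifferentiableAt ℝ 𝒟.J m :=
  (𝒟.contDiffOn_J.differentiableOn two_ne_zero).differentiableAt (𝒟.isOpen_U.mem_nhds hm)

theorem differentiableAt_K : DifferentiableAt ℝ 𝒟.K m :=
  (𝒟.contDiffOn_K.differentiableOn two_ne_zero).differentiableAt (𝒟.isOpen_U.mem_nhds hm)

theorem differentiableAt_P : DifferentiableAt ℝ 𝒟.P m :=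
  (𝒟.contDiffOn_P.differentiableOn two_ne_zero).differentiableAt (𝒟.isOpen_U.mem_nhds hm)

theorem differentiableAt_ι : DifferentiableAt ℝ 𝒟.ι m :=
  (𝒟.contDiffOn_ι.differentiableOn two_ne_zero).differentiableAt (𝒟.isOpen_U.mem_nhds hm)

theorem differentiableAt_Γ : DifferentiableAt ℝ 𝒟.Γ m :=
  (𝒟.contDiffOn_Γ.differentiableOn two_ne_zero).differentiableAt (𝒟.isOpen_U.mem_nhds hm)

theorem nontrivial [FiniteDimensional ℝ F] : Nontrivial F := by
  have h1 := 𝒟.finrank_eq m hm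
  have h2 := 𝒟.le_finrank m hm
  exact Module.nontrivial_of_finrank_pos (R := ℝ) (by omega)

end Differentiability

/-- The velocity of a combination of the frame. -/
theorem fderiv_comb_mem (hm : m ∈ 𝒟.U) (a b c : ℝ) (u : EM) :
    (a • fderiv ℝ 𝒟.I m u + b • fderiv ℝ 𝒟.J m u + c • fderiv ℝ 𝒟.K m u) +
      (𝒟.Γ m u * (a • 𝒟.I m + b • 𝒟.J m + c • 𝒟.K m) -
        (a • 𝒟.I m + b • 𝒟.J m + c • 𝒟.K m) * 𝒟.Γ m u) ∈ 𝒟.Q m := by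
  convert! (𝒟.Q m).add_mem ((𝒟.Q m).add_mem ((𝒟.Q m).smul_mem a (𝒟.parallel_I m hm u))
    ((𝒟.Q m).smul_mem b (𝒟.parallel_J m hm u))) ((𝒟.Q m).smul_mem c (𝒟.parallel_K m hm u)) using 1
  simp only [mul_add, add_mul, mul_smul_comm, smul_mul_assoc]
  module

theorem comb_mem (a b c : ℝ) : a • 𝒟.I m + b • 𝒟.J m + c • 𝒟.K m ∈ 𝒟.Q m :=
  IsQuaternionFrame.mem_span_triple.2 ⟨a, b, c, rfl⟩

theorem hasDerivAt_inv_sqrt (s : ℝ) :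
    HasDerivAt (fun t : ℝ ↦ (Real.sqrt (1 + t * t * s))⁻¹) 0 0 := by
  have h1 : HasDerivAt (fun t : ℝ ↦ 1 + t * t * s) 0 0 := by
    have := ((((hasDerivAt_id (0 : ℝ)).mul (hasDerivAt_id (0 : ℝ))).mul_const s).const_add 1)
    simpa using this
  convert! (h1.sqrt (by simp)).inv (by simp) using 1
  simp

theorem hasDerivAt_normalized (s a x : ℝ) :
    HasDerivAt (fun t : ℝ ↦ (Real.sqrt (1 + t * t * s))⁻¹ * (a + t * x)) x 0 := by
  have h1 : HasDerivAt (fun t : ℝ ↦ a + t * x) x 0 := by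
    simpa using ((hasDerivAt_id (0 : ℝ)).mul_const x).const_add a
  convert! (hasDerivAt_inv_sqrt s).mul h1 using 1
  simp

/-- This justifies the algebraic definition of tangency without a manifold structure on $Z$: a
tangent derivative of a function depends only on its restriction to $Z$. The curve moves linearly in
the base and in the frame coefficients, the latter rescaled to unit length. -/
theorem IsTangent.exists_curve [FiniteDimensional ℝ F] (hp : p ∈ 𝒟.Z) (hξ : 𝒟.IsTangent p ξ) :
    ∃ γ : ℝ → EM × (F →L[ℝ] F), γ 0 = p ∧ HasDerivAt γ ξ 0 ∧ ∀ᶠ t in 𝓝 0, γ t ∈ 𝒟.Z := by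
  obtain ⟨m, A⟩ := p
  obtain ⟨u, D⟩ := ξ
  obtain ⟨hm, hAQ, hAA⟩ := hp
  obtain ⟨hV, hAV⟩ := hξ
  dsimp only at hm hAQ hAA hV hAV
  have := nontrivial hm
  have hfr := (𝒟.frame m hm).toIsQuaternionFrame
  obtain ⟨a, b, c, rfl⟩ := IsQuaternionFrame.mem_span_triple.1 hAQ
  have scalar {r : ℝ} (h : r • (1 : F →L[ℝ] F) = 0) : r = 0 :=
    (smul_eq_zero.1 h).resolve_right one_ne_zero
  have hn : a * a + b * b + c * c = 1 := by
    rw [hfr.comb_mul_self] at hAA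
    have : (1 - (a * a + b * b + c * c)) • (1 : F →L[ℝ] F) = 0 := by
      rw [sub_smul, one_smul, sub_eq_add_neg, ← neg_smul, hAA]; simp
    linarith [scalar this]
  have hI := (differentiableAt_I hm).hasFDerivAt
  have hJ := (differentiableAt_J hm).hasFDerivAt
  have hK := (differentiableAt_K hm).hasFDerivAt
  -- $W$ is the fibre velocity of the combination with constant coefficients, so $D-W$ is tangent to
  -- the fibre of $Z$ and is realised by varying the coefficients.
  set W := a • fderiv ℝ 𝒟.I m u + b • fderiv ℝ 𝒟.J m u + c • fderiv ℝ 𝒟.K m u with hW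
  set A := a • 𝒟.I m + b • 𝒟.J m + c • 𝒟.K m with hA
  clear_value A W
  have hmt : HasDerivAt (fun t : ℝ ↦ m + t • u) u 0 := by
    simpa using ((hasDerivAt_id (0 : ℝ)).smul_const u).const_add m
  have hU : ∀ᶠ t : ℝ in 𝓝 0, m + t • u ∈ 𝒟.U :=
    hmt.continuousAt.eventually_mem (by simpa using 𝒟.isOpen_U.mem_nhds hm)
  have hcomp {f : EM → F →L[ℝ] F} {f'} (hf : HasFDerivAt f f' m) :
      HasDerivAt (fun t : ℝ ↦ f (m + t • u)) (f' u) 0 :=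
    HasFDerivAt.comp_hasDerivAt (f := fun t : ℝ ↦ m + t • u) (0 : ℝ) (by simpa using hf) hmt
  -- The combination with constant coefficients has square $-1$ throughout $U$; differentiate.
  have hWA : A * W + W * A = 0 := by
    have h1 : HasDerivAt (fun t : ℝ ↦
        a • 𝒟.I (m + t • u) + b • 𝒟.J (m + t • u) + c • 𝒟.K (m + t • u)) W 0 := by
      rw [hW]
      exact (((hcomp hI).const_smul a).add ((hcomp hJ).const_smul b)).add
        ((hcomp hK).const_smul c)
    have h3 : HasDerivAt (fun t : ℝ ↦
        (a • 𝒟.I (m + t • u) + b • 𝒟.J (m + t • u) + c • 𝒟.K (m + t • u)) *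
        (a • 𝒟.I (m + t • u) + b • 𝒟.J (m + t • u) + c • 𝒟.K (m + t • u))) 0 0 := by
      refine (hasDerivAt_const (0 : ℝ) (-1 : F →L[ℝ] F)).congr_of_eventuallyEq ?_
      filter_upwards [hU] with t ht
      rw [(𝒟.frame _ ht).comb_mul_self, hn, neg_smul, one_smul]
    have h2 := (h1.mul h1).unique h3
    simp only [zero_smul, add_zero, ← hA] at h2
    rw [add_comm, h2]
  have hWQ : W + (𝒟.Γ m u * A - A * 𝒟.Γ m u) ∈ 𝒟.Q m := by
    rw [hW, hA]
    exact fderiv_comb_mem hm a b c u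
  have hDW : D - W ∈ 𝒟.Q m := by
    convert! (𝒟.Q m).sub_mem hV hWQ using 1
    simp only [vert]; abel
  have hADW : A * (D - W) + (D - W) * A = 0 := by
    have h1 : A * (𝒟.Γ m u * A - A * 𝒟.Γ m u) + (𝒟.Γ m u * A - A * 𝒟.Γ m u) * A =
      𝒟.Γ m u * (A * A) - A * A * 𝒟.Γ m u := by noncomm_ring
    have h2 : A * D + D * A = 0 := by
      simp only [vert] at hAV
      rw [mul_add, add_mul, add_add_add_comm, h1, hAA] at hAV
      simpa using hAV
    have h3 : A * (D - W) + (D - W) * A = (A * D + D * A) - (A * W + W * A) := by noncomm_ring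
    rw [h3, h2, hWA, sub_zero]
  obtain ⟨x, y, z, hxyz⟩ := IsQuaternionFrame.mem_span_triple.1 hDW
  have horth : a * x + b * y + c * z = 0 := by
    rw [hxyz, hA, hfr.comb_anticomm] at hADW
    linarith [scalar hADW]
  set s := x * x + y * y + z * z with hs
  have hs0 : 0 ≤ s :=
    add_nonneg (add_nonneg (mul_self_nonneg x) (mul_self_nonneg y)) (mul_self_nonneg z)
  -- By `horth`, the coefficients $(a,b,c)+t(x,y,z)$ have squared norm $1+t^2s$. The normalising
  -- factor has derivative $0$ at $t=0$ and does not alter the velocity.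
  let n (t : ℝ) : ℝ := (Real.sqrt (1 + t * t * s))⁻¹
  refine ⟨fun t ↦ (m + t • u, (n t * (a + t * x)) • 𝒟.I (m + t • u) +
    (n t * (b + t * y)) • 𝒟.J (m + t • u) + (n t * (c + t * z)) • 𝒟.K (m + t • u)), ?_, ?_, ?_⟩
  · simp [n, hA]
  · refine hmt.prodMk ?_
    convert! (((hasDerivAt_normalized s a x).smul (hcomp hI)).add
      ((hasDerivAt_normalized s b y).smul (hcomp hJ))).add
      ((hasDerivAt_normalized s c z).smul (hcomp hK)) using 1
    have : D = W + (D - W) := by abel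
    rw [this, hxyz, hW]
    simp
    module
  · filter_upwards [hU] with t ht
    refine ⟨ht, comb_mem _ _ _, ?_⟩
    have hfr' := (𝒟.frame _ ht).toIsQuaternionFrame
    dsimp only
    rw [hfr'.comb_mul_self]
    have hnn : n t * n t * (1 + t * t * s) = 1 := by
      have h1 : 0 < 1 + t * t * s := by nlinarith [mul_nonneg (mul_self_nonneg t) hs0]
      have h2 := Real.mul_self_sqrt h1.le
      have h3 := (Real.sqrt_pos.2 h1).ne'
      simp only [n]
      nth_rw 3 [← h2]
      field_simp
    have : n t * (a + t * x) * (n t * (a + t * x)) + n t * (b + t * y) * (n t * (b + t * y)) +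
        n t * (c + t * z) * (n t * (c + t * z)) = 1 := by
      rw [← hnn]
      linear_combination (n t * n t) * hn + 2 * t * n t * n t * horth
    rw [this, neg_smul, one_smul]

/-- The derivative, in a direction tangent to `Z`, of a function vanishing along `Z`. -/
theorem IsTangent.fderiv_eq_zero [FiniteDimensional ℝ F] {W : Type*} [NormedAddCommGroup W]
    [NormedSpace ℝ W] (hp : p ∈ 𝒟.Z) (hξ : 𝒟.IsTangent p ξ) {g : EM × (F →L[ℝ] F) → W}
    (hg : DifferentiableAt ℝ g p) (h0 : ∀ᶠ q in 𝓝[𝒟.Z] p, g q = 0) : fderiv ℝ g p ξ = 0 := by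
  obtain ⟨γ, rfl, hγ, hZ⟩ := hξ.exists_curve hp
  have h1 : HasDerivAt (g ∘ γ) (fderiv ℝ g (γ 0) ξ) 0 := hg.hasFDerivAt.comp_hasDerivAt 0 hγ
  have h2 : HasDerivAt (g ∘ γ) 0 0 := by
    refine (hasDerivAt_const (0 : ℝ) (0 : W)).congr_of_eventuallyEq ?_
    exact (tendsto_nhdsWithin_iff.2 ⟨hγ.continuousAt, hZ⟩).eventually h0
  exact h1.unique h2

theorem IsTangent.fderiv_congr [FiniteDimensional ℝ F] {W : Type*} [NormedAddCommGroup W]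
    [NormedSpace ℝ W] (hp : p ∈ 𝒟.Z) (hξ : 𝒟.IsTangent p ξ) {g g' : EM × (F →L[ℝ] F) → W}
    (hg : DifferentiableAt ℝ g p) (hg' : DifferentiableAt ℝ g' p)
    (h : ∀ᶠ q in 𝓝[𝒟.Z] p, g q = g' q) : fderiv ℝ g p ξ = fderiv ℝ g' p ξ := by
  have := hξ.fderiv_eq_zero hp (hg.sub hg') (by filter_upwards [h] with q hq; simp [hq])
  rw [fderiv_sub hg hg', sub_apply, sub_eq_zero] at this
  exact this

/-- The covariant derivative of a section of `E`. -/
def covF (𝒟 : LocalFQuaternionic EM F) (p ξ : EM × (F →L[ℝ] F)) (s : EM × (F →L[ℝ] F) → F) : F :=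
  fderiv ℝ s p ξ + 𝒟.Γ p.1 ξ.1 (s p)

/-- The covariant derivative of a section of `End(E)`. -/
def covEnd (𝒟 : LocalFQuaternionic EM F) (p ξ : EM × (F →L[ℝ] F))
    (s : EM × (F →L[ℝ] F) → F →L[ℝ] F) : F →L[ℝ] F :=
  fderiv ℝ s p ξ + (𝒟.Γ p.1 ξ.1 * s p - s p * 𝒟.Γ p.1 ξ.1)

theorem fderiv_comp_fst {W : Type*} [NormedAddCommGroup W] [NormedSpace ℝ W] {f : EM → W}
    (hf : DifferentiableAt ℝ f p.1) :
    fderiv ℝ (fun q : EM × (F →L[ℝ] F) ↦ f q.1) p ξ = fderiv ℝ f p.1 ξ.1 := by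
  have := (hf.hasFDerivAt.comp p (hasFDerivAt_fst (p := p))).fderiv
  exact DFunLike.congr_fun this ξ

/-- Expand the section in the moving frame: derivatives of the coefficients give elements of $Q$,
and derivatives of the frame do so because $\nabla$ preserves $Q$. The section is required to lie in
$Q$ only along $Z$, which is why the direction must be tangent. -/
theorem covEnd_mem [FiniteDimensional ℝ F] (hp : p ∈ 𝒟.Z) (hξ : 𝒟.IsTangent p ξ)
    {s : EM × (F →L[ℝ] F) → F →L[ℝ] F} (hs : DifferentiableAt ℝ s p)
    (hsQ : ∀ᶠ q in 𝓝[𝒟.Z] p, s q ∈ 𝒟.Q q.1) : 𝒟.covEnd p ξ s ∈ 𝒟.Q p.1 := by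
  have hm := hp.1
  have := nontrivial hm
  obtain ⟨x₀, hx₀⟩ := exists_ne (0 : F)
  obtain ⟨φ, hφ⟩ := SeparatingDual.exists_eq_one (R := ℝ) hx₀
  have hI : DifferentiableAt ℝ (fun q : EM × (F →L[ℝ] F) ↦ 𝒟.I q.1) p :=
    (differentiableAt_I hm).comp p differentiableAt_fst
  have hJ : DifferentiableAt ℝ (fun q : EM × (F →L[ℝ] F) ↦ 𝒟.J q.1) p :=
    (differentiableAt_J hm).comp p differentiableAt_fst
  have hK : DifferentiableAt ℝ (fun q : EM × (F →L[ℝ] F) ↦ 𝒟.K q.1) p :=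
    (differentiableAt_K hm).comp p differentiableAt_fst
  -- For $s\in Q$ and $T$ in the frame, $Ts+sT$ is $-2\langle T,s\rangle$ times the identity.
  -- Evaluating at $x_0$ and applying $\varphi$ with $\varphi(x_0)=1$ gives a coefficient that is
  -- differentiable even off $Z$.
  let coeff (T : EM → F →L[ℝ] F) (q : EM × (F →L[ℝ] F)) : ℝ :=
    -(1 / 2) * φ ((T q.1 * s q + s q * T q.1) x₀)
  have hcoeff {T : EM → F →L[ℝ] F}
      (hT : DifferentiableAt ℝ (fun q : EM × (F →L[ℝ] F) ↦ T q.1) p) :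
      DifferentiableAt ℝ (coeff T) p :=
    ((φ.differentiableAt).comp p
      (((hT.mul hs).add (hs.mul hT)).clm_apply (differentiableAt_const x₀))).const_mul _
  let g (q : EM × (F →L[ℝ] F)) : F →L[ℝ] F :=
    coeff 𝒟.I q • 𝒟.I q.1 + coeff 𝒟.J q • 𝒟.J q.1 + coeff 𝒟.K q • 𝒟.K q.1
  have hdg := (((hcoeff hI).hasFDerivAt.smul hI.hasFDerivAt).add
    ((hcoeff hJ).hasFDerivAt.smul hJ.hasFDerivAt)).add ((hcoeff hK).hasFDerivAt.smul hK.hasFDerivAt)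
  have hsg : ∀ᶠ q in 𝓝[𝒟.Z] p, s q = g q := by
    filter_upwards [hsQ, self_mem_nhdsWithin] with q hq hqZ
    have hfr := (𝒟.frame _ hqZ.1).toIsQuaternionFrame
    obtain ⟨a, b, c, habc⟩ := IsQuaternionFrame.mem_span_triple.1 hq
    have h1 := hfr.comb_anticomm 1 0 0 a b c
    have h2 := hfr.comb_anticomm 0 1 0 a b c
    have h3 := hfr.comb_anticomm 0 0 1 a b c
    simp only [one_smul, zero_smul, add_zero, zero_add, ← habc] at h1 h2 h3
    simp only [g, coeff, h1, h2, h3]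
    rw [habc]
    simp [hφ]
  have heq := hξ.fderiv_congr hp hs hdg.differentiableAt hsg
  rw [hdg.fderiv] at heq
  rw [covEnd, heq, hsg.self_of_nhdsWithin hp]
  convert! (𝒟.Q p.1).add_mem (fderiv_comb_mem hm (coeff 𝒟.I p) (coeff 𝒟.J p) (coeff 𝒟.K p) ξ.1)
    (comb_mem (fderiv ℝ (coeff 𝒟.I) p ξ) (fderiv ℝ (coeff 𝒟.J) p ξ)
      (fderiv ℝ (coeff 𝒟.K) p ξ)) using 1
  simp only [add_apply, smul_apply, ContinuousLinearMap.smulRight_apply,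
    fderiv_comp_fst (differentiableAt_I hm), fderiv_comp_fst (differentiableAt_J hm),
    fderiv_comp_fst (differentiableAt_K hm), g]
  abel

end LocalFQuaternionic

/-! ### Curvature of the local model: Ricci and Bianchi identities. -/

namespace LocalFQuaternionic

variable {EM F : Type*} [NormedAddCommGroup EM] [NormedSpace ℝ EM]
  [NormedAddCommGroup F] [NormedSpace ℝ F] (𝒟 : LocalFQuaternionic EM F)
  {m : EM} {p ξ η : EM × (F →L[ℝ] F)}

/-- The curvature form of the connection. -/
def curv (m u v : EM) : F →L[ℝ] F :=
  fderiv ℝ 𝒟.Γ m u v - fderiv ℝ 𝒟.Γ m v u + (𝒟.Γ m u * 𝒟.Γ m v - 𝒟.Γ m v * 𝒟.Γ m u)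

set_option synthInstance.maxHeartbeats 200000 in
theorem curv_add_left (m u u' v : EM) : 𝒟.curv m (u + u') v = 𝒟.curv m u v + 𝒟.curv m u' v := by
  simp only [curv, map_add, add_apply, add_mul, mul_add]
  abel

set_option synthInstance.maxHeartbeats 200000 in
theorem curv_smul_left (m : EM) (c : ℝ) (u v : EM) :
    𝒟.curv m (c • u) v = c • 𝒟.curv m u v := by
  simp only [curv, map_smul, smul_apply, smul_mul_assoc, mul_smul_comm]
  module

theorem curv_swap (m u v : EM) : 𝒟.curv m u v = -𝒟.curv m v u := by
  simp only [curv]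
  abel

theorem curv_add_right (m u v v' : EM) : 𝒟.curv m u (v + v') = 𝒟.curv m u v + 𝒟.curv m u v' := by
  rw [curv_swap, curv_add_left, 𝒟.curv_swap m v u, 𝒟.curv_swap m v' u]
  abel

theorem curv_smul_right (m : EM) (c : ℝ) (u v : EM) :
    𝒟.curv m u (c • v) = c • 𝒟.curv m u v := by
  rw [curv_swap, curv_smul_left, 𝒟.curv_swap m v u, smul_neg, neg_neg]

variable {𝒟}

theorem fderiv_fderiv_comm {W : Type*} [NormedAddCommGroup W] [NormedSpace ℝ W] {f : EM → W}
    {s : Set EM} (hs : IsOpen s) (hf : ContDiffOn ℝ 2 f s) (hm : m ∈ s) (u v : EM) :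
    fderiv ℝ (fderiv ℝ f) m u v = fderiv ℝ (fderiv ℝ f) m v u :=
  ((hf.contDiffAt (hs.mem_nhds hm)).isSymmSndFDerivAt (by simp)) u v

theorem differentiableAt_fderiv {W : Type*} [NormedAddCommGroup W] [NormedSpace ℝ W] {f : EM → W}
    {s : Set EM} (hs : IsOpen s) (hf : ContDiffOn ℝ 2 f s) (hm : m ∈ s) :
    DifferentiableAt ℝ (fderiv ℝ f) m :=
  (((hf.contDiffAt (hs.mem_nhds hm)).fderiv_right (m := 1) (by norm_num)).differentiableAt
    one_ne_zero)

/-- The covariant derivative of a section of `End(E)` over the base. -/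
def nablaEnd (𝒟 : LocalFQuaternionic EM F) (f : EM → F →L[ℝ] F) (u m : EM) : F →L[ℝ] F :=
  fderiv ℝ f m u + (𝒟.Γ m u * f m - f m * 𝒟.Γ m u)

set_option synthInstance.maxHeartbeats 200000 in
theorem hasFDerivAt_nablaEnd {f : EM → F →L[ℝ] F} (hf : ContDiffOn ℝ 2 f 𝒟.U) (hm : m ∈ 𝒟.U)
    (u v : EM) : DifferentiableAt ℝ (𝒟.nablaEnd f u) m ∧
      fderiv ℝ (𝒟.nablaEnd f u) m v = fderiv ℝ (fderiv ℝ f) m v u +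
        (fderiv ℝ 𝒟.Γ m v u * f m + 𝒟.Γ m u * fderiv ℝ f m v -
          (fderiv ℝ f m v * 𝒟.Γ m u + f m * fderiv ℝ 𝒟.Γ m v u)) := by
  have h1 := (differentiableAt_fderiv 𝒟.isOpen_U hf hm).hasFDerivAt.clm_apply
    (hasFDerivAt_const u m)
  have h2 := (differentiableAt_Γ hm).hasFDerivAt.clm_apply (hasFDerivAt_const u m)
  have h3 := ((hf.differentiableOn two_ne_zero).differentiableAt
    (𝒟.isOpen_U.mem_nhds hm)).hasFDerivAt
  have h4 := h1.add ((h2.mul' h3).sub (h3.mul' h2))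
  refine ⟨h4.differentiableAt, ?_⟩
  change fderiv ℝ (fun m ↦ _) m v = _
  rw [HasFDerivAt.fderiv (f := fun m ↦ 𝒟.nablaEnd f u m) h4]
  simp
  abel

/-- The Ricci identity for sections of `End(E)`. -/
theorem curv_comm {f : EM → F →L[ℝ] F} (hf : ContDiffOn ℝ 2 f 𝒟.U) (hm : m ∈ 𝒟.U) (u v : EM) :
    𝒟.curv m v u * f m - f m * 𝒟.curv m v u =
      𝒟.nablaEnd (𝒟.nablaEnd f u) v m - 𝒟.nablaEnd (𝒟.nablaEnd f v) u m := by
  change _ = fderiv ℝ (𝒟.nablaEnd f u) m v + _ - (fderiv ℝ (𝒟.nablaEnd f v) m u + _)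
  rw [(hasFDerivAt_nablaEnd hf hm u v).2, (hasFDerivAt_nablaEnd hf hm v u).2,
    fderiv_fderiv_comm 𝒟.isOpen_U hf hm v u]
  simp only [nablaEnd, curv]
  noncomm_ring

/-- By the Ricci identity, the bracket of the curvature with a parallel section of $\mathrm{End}(E)$
vanishes. -/
theorem curv_comm_P (hm : m ∈ 𝒟.U) (u v : EM) : 𝒟.curv m u v * 𝒟.P m = 𝒟.P m * 𝒟.curv m u v := by
  have key (u v : EM) : 𝒟.nablaEnd (𝒟.nablaEnd 𝒟.P u) v m = 0 := by
    have h0 : 𝒟.nablaEnd 𝒟.P u =ᶠ[𝓝 m] fun _ ↦ 0 := by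
      filter_upwards [𝒟.isOpen_U.mem_nhds hm] with m' hm'
      exact 𝒟.parallel_P m' hm' u
    rw [nablaEnd, h0.fderiv_eq, h0.self_of_nhds]
    simp
  have := curv_comm 𝒟.contDiffOn_P hm v u
  rwa [key, key, sub_zero, sub_eq_zero] at this

/-- In the Ricci identity both second covariant derivatives stay in $Q$, since $\nabla$ maps
sections of $Q$ to sections of $Q$. -/
theorem curv_comm_mem_of_nablaEnd_mem [FiniteDimensional ℝ F] {f : EM → F →L[ℝ] F}
    (hf : ContDiffOn ℝ 2 f 𝒟.U) (hQ : ∀ m ∈ 𝒟.U, ∀ u, 𝒟.nablaEnd f u m ∈ 𝒟.Q m)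
    (hm : m ∈ 𝒟.U) (u v : EM) : 𝒟.curv m u v * f m - f m * 𝒟.curv m u v ∈ 𝒟.Q m := by
  have key (u v : EM) : 𝒟.nablaEnd (𝒟.nablaEnd f u) v m ∈ 𝒟.Q m := by
    have hZ : (m, 𝒟.I m) ∈ 𝒟.Z := ⟨hm, Submodule.subset_span (by simp), (𝒟.frame m hm).II⟩
    have hd := (hasFDerivAt_nablaEnd hf hm u v).1
    -- `covEnd_mem` is stated on $Z$, so the base section is pulled back and differentiated at
    -- $(m,I)$ along the horizontal lift of $v$.
    let ξ : EM × (F →L[ℝ] F) := (v, -(𝒟.Γ m v * 𝒟.I m - 𝒟.I m * 𝒟.Γ m v))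
    have hvert : 𝒟.vert (m, 𝒟.I m) ξ = 0 := by simp [vert, ξ]
    have hξ : 𝒟.IsTangent (m, 𝒟.I m) ξ :=
      ⟨by rw [hvert]; exact zero_mem _, by rw [hvert]; simp⟩
    have h1 := covEnd_mem hZ hξ (s := fun q ↦ 𝒟.nablaEnd f u q.1)
      (DifferentiableAt.comp (g := 𝒟.nablaEnd f u) (f := Prod.fst) (m, 𝒟.I m) hd
        differentiableAt_fst)
      (by filter_upwards [self_mem_nhdsWithin] with q hq using hQ _ hq.1 u)
    rwa [covEnd, fderiv_comp_fst hd] at h1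
  rw [curv_comm hf hm]
  exact (𝒟.Q m).sub_mem (key v u) (key u v)

theorem curv_comm_mem [FiniteDimensional ℝ F] (hm : m ∈ 𝒟.U) (u v : EM) {q : F →L[ℝ] F}
    (hq : q ∈ 𝒟.Q m) : 𝒟.curv m u v * q - q * 𝒟.curv m u v ∈ 𝒟.Q m := by
  obtain ⟨a, b, c, rfl⟩ := IsQuaternionFrame.mem_span_triple.1 hq
  convert! (𝒟.Q m).add_mem ((𝒟.Q m).add_mem
    ((𝒟.Q m).smul_mem a (curv_comm_mem_of_nablaEnd_mem 𝒟.contDiffOn_I 𝒟.parallel_I hm u v))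
    ((𝒟.Q m).smul_mem b (curv_comm_mem_of_nablaEnd_mem 𝒟.contDiffOn_J 𝒟.parallel_J hm u v)))
    ((𝒟.Q m).smul_mem c (curv_comm_mem_of_nablaEnd_mem 𝒟.contDiffOn_K 𝒟.parallel_K hm u v)) using 1
  simp only [mul_add, add_mul, mul_smul_comm, smul_mul_assoc]
  module

/-- The exterior covariant derivative of the soldering form `ι`, before antisymmetrisation. -/
def solder (𝒟 : LocalFQuaternionic EM F) (u v m : EM) : F :=
  fderiv ℝ 𝒟.ι m u v + 𝒟.Γ m u (𝒟.ι m v)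

set_option synthInstance.maxHeartbeats 200000 in
theorem fderiv_solder (hm : m ∈ 𝒟.U) (u v w : EM) :
    fderiv ℝ (𝒟.solder u v) m w = fderiv ℝ (fderiv ℝ 𝒟.ι) m w u v +
      (fderiv ℝ 𝒟.Γ m w u (𝒟.ι m v) + 𝒟.Γ m u (fderiv ℝ 𝒟.ι m w v)) := by
  have h1 := ((differentiableAt_fderiv 𝒟.isOpen_U 𝒟.contDiffOn_ι hm).hasFDerivAt.clm_apply
    (hasFDerivAt_const u m)).clm_apply (hasFDerivAt_const v m)
  have h2 := (differentiableAt_Γ hm).hasFDerivAt.clm_apply (hasFDerivAt_const u m)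
  have h3 := (differentiableAt_ι hm).hasFDerivAt.clm_apply (hasFDerivAt_const v m)
  have h4 := h1.add (h2.clm_apply h3)
  rw [HasFDerivAt.fderiv (f := 𝒟.solder u v) h4]
  simp
  abel

/-- For constant vector fields, curvature is the commutator of covariant derivatives, here applied
to $\iota v$; the second derivatives of $\iota$ cancel by symmetry. The Bianchi identity follows by
cyclic summation once torsion-freeness makes `solder` symmetric. -/
theorem curv_ι (hm : m ∈ 𝒟.U) (u v w : EM) :
    𝒟.curv m w u (𝒟.ι m v) =
      (fderiv ℝ (𝒟.solder u v) m w + 𝒟.Γ m w (𝒟.solder u v m)) -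
        (fderiv ℝ (𝒟.solder w v) m u + 𝒟.Γ m u (𝒟.solder w v m)) := by
  rw [fderiv_solder hm, fderiv_solder hm, fderiv_fderiv_comm 𝒟.isOpen_U 𝒟.contDiffOn_ι hm w u]
  simp only [solder, curv, map_add, add_apply, sub_apply]
  abel

/-- The first Bianchi identity. -/
theorem bianchi (hm : m ∈ 𝒟.U) (u v w : EM) :
    𝒟.curv m u v (𝒟.ι m w) + 𝒟.curv m v w (𝒟.ι m u) + 𝒟.curv m w u (𝒟.ι m v) = 0 := by
  have key (u v : EM) : 𝒟.solder u v =ᶠ[𝓝 m] 𝒟.solder v u := by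
    filter_upwards [𝒟.isOpen_U.mem_nhds hm] with m' hm'
    exact 𝒟.torsion m' hm' u v
  rw [curv_ι hm, curv_ι hm, curv_ι hm, (key v w).fderiv_eq, (key v w).self_of_nhds,
    (key u w).fderiv_eq, (key u w).self_of_nhds, (key u v).fderiv_eq, (key u v).self_of_nhds]
  abel

/-- Pulling the curvature back by $\rho$ gives a bilinear form on $F$ with the symmetries required
by the pointwise result: as $\iota\rho=P$, the first Bianchi identity takes the form needed there.
-/
theorem typeDefect_curv_eq_zero [FiniteDimensional ℝ F] {p : EM × (F →L[ℝ] F)} (hp : p ∈ 𝒟.Z)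
    (e f : F) (u₁ u₂ v₁ v₂ : EM) (hu₁ : u₁ = 𝒟.ρ p.1 e) (hu₂ : u₂ = 𝒟.ρ p.1 (p.2 e))
    (hv₁ : v₁ = 𝒟.ρ p.1 f) (hv₂ : v₂ = 𝒟.ρ p.1 (p.2 f)) :
    (𝒟.curv p.1 u₁ v₂ + 𝒟.curv p.1 u₂ v₁) * p.2 - p.2 * (𝒟.curv p.1 u₁ v₂ + 𝒟.curv p.1 u₂ v₁) =
      p.2 * ((𝒟.curv p.1 u₁ v₁ - 𝒟.curv p.1 u₂ v₂) * p.2 -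
        p.2 * (𝒟.curv p.1 u₁ v₁ - 𝒟.curv p.1 u₂ v₂)) := by
  obtain ⟨m, A⟩ := p
  obtain ⟨hm, hAQ, hAA⟩ := hp
  dsimp only at hm hAQ hAA hu₁ hu₂ hv₁ hv₂ ⊢
  subst hu₁ hu₂ hv₁ hv₂
  have := nontrivial hm
  obtain ⟨B, hfr, hspan⟩ := (𝒟.frame m hm).exists_frame hAQ hAA
  have h : IsFQuaternionFrame A B (A * B) (𝒟.P m) :=
    ⟨hfr, (𝒟.frame m hm).PP, by rw [hspan]; exact (𝒟.frame m hm).apply_mem⟩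
  let R : F →ₗ[ℝ] F →ₗ[ℝ] (F →L[ℝ] F) := LinearMap.mk₂ ℝ
    (fun e f ↦ 𝒟.curv m (𝒟.ρ m e) (𝒟.ρ m f))
    (fun _ _ _ ↦ by rw [map_add, curv_add_left]) (fun _ _ _ ↦ by rw [map_smul, curv_smul_left])
    (fun _ _ _ ↦ by rw [map_add, curv_add_right]) (fun _ _ _ ↦ by rw [map_smul, curv_smul_right])
  have := h.typeDefect_eq_zero (𝒟.finrank_eq m hm) (𝒟.le_finrank m hm) R
    (fun e f ↦ curv_comm_P hm _ _)
    (fun e f q hq ↦ by rw [hspan] at hq ⊢; exact curv_comm_mem hm _ _ hq)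
    (fun e f g ↦ by
      have := bianchi hm (𝒟.ρ m e) (𝒟.ρ m f) (𝒟.ρ m g)
      simpa only [𝒟.ι_ρ m hm] using! this) e f
  exact sub_eq_zero.1 this

end LocalFQuaternionic

/-! ### Involutivity of $\mathcal{C}$ in coordinates. -/

namespace LocalFQuaternionic

variable {EM F : Type*} [NormedAddCommGroup EM] [NormedSpace ℝ EM]
  [NormedAddCommGroup F] [NormedSpace ℝ F] (𝒟 : LocalFQuaternionic EM F)
  {m : EM} {p ξ η ξ₁ ξ₂ : EM × (F →L[ℝ] F)}

/-- The pairs `(ξ₁, ξ₂)` such that `ξ₁ + i ξ₂` belongs to the distribution `𝒞`. -/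
structure IsTypeC (p ξ₁ ξ₂ : EM × (F →L[ℝ] F)) : Prop where
  tangent : 𝒟.IsTangent p ξ₁
  vert_eq : 𝒟.vert p ξ₂ = p.2 * 𝒟.vert p ξ₁
  exists_base : ∃ e, ξ₁.1 = 𝒟.ρ p.1 e ∧ ξ₂.1 = 𝒟.ρ p.1 (p.2 e)

variable {𝒟}

theorem vert_add : 𝒟.vert p (ξ + η) = 𝒟.vert p ξ + 𝒟.vert p η := by
  simp only [vert, Prod.fst_add, Prod.snd_add, map_add, add_mul, mul_add]
  abel

theorem vert_sub : 𝒟.vert p (ξ - η) = 𝒟.vert p ξ - 𝒟.vert p η := by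
  simp only [vert, Prod.fst_sub, Prod.snd_sub, map_sub, sub_mul, mul_sub]
  abel

theorem IsTangent.sub (hξ : 𝒟.IsTangent p ξ) (hη : 𝒟.IsTangent p η) : 𝒟.IsTangent p (ξ - η) := by
  refine ⟨?_, ?_⟩
  · rw [vert_sub]
    exact (𝒟.Q p.1).sub_mem hξ.mem hη.mem
  · rw [vert_sub, mul_sub, sub_mul, sub_add_sub_comm, hξ.anticomm, hη.anticomm, sub_zero]

/-- In a frame $(A,B,AB)$ the vertical part of $\xi_1$ lies in the plane of $B$ and $AB$, which left
multiplication by $A$ preserves. -/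
theorem IsTypeC.tangent_right [FiniteDimensional ℝ F] (hp : p ∈ 𝒟.Z) (h : 𝒟.IsTypeC p ξ₁ ξ₂) :
    𝒟.IsTangent p ξ₂ := by
  obtain ⟨hm, hAQ, hAA⟩ := hp
  have := nontrivial hm
  obtain ⟨B, hfr, hspan⟩ := (𝒟.frame _ hm).exists_frame hAQ hAA
  have hQ : 𝒟.Q p.1 = Submodule.span ℝ {p.2, B, p.2 * B} := hspan.symm
  have hmem := h.tangent.mem
  have hanti := h.tangent.anticomm
  rw [hQ] at hmem
  obtain ⟨y, z, hyz⟩ := hfr.eq_of_anticomm hmem hanti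
  refine ⟨?_, ?_⟩
  · rw [h.vert_eq, hyz, hQ, mul_add, mul_smul_comm, mul_smul_comm, hfr.IK]
    exact IsQuaternionFrame.mem_span_triple.2 ⟨0, -z, y, by module⟩
  · rw [h.vert_eq, mul_assoc, ← mul_add, hanti, mul_zero]

section Calculus

/-- The relations defining $\mathcal{C}$ are known only along $Z$; this and `covEnd_congr` allow
them to be differentiated in directions tangent to $Z$. -/
theorem covF_congr [FiniteDimensional ℝ F] (hp : p ∈ 𝒟.Z) (hξ : 𝒟.IsTangent p ξ)
    {s s' : EM × (F →L[ℝ] F) → F} (hs : DifferentiableAt ℝ s p) (hs' : DifferentiableAt ℝ s' p)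
    (h : ∀ᶠ q in 𝓝[𝒟.Z] p, s q = s' q) : 𝒟.covF p ξ s = 𝒟.covF p ξ s' := by
  rw [covF, covF, hξ.fderiv_congr hp hs hs' h, h.self_of_nhdsWithin hp]

theorem covEnd_congr [FiniteDimensional ℝ F] (hp : p ∈ 𝒟.Z) (hξ : 𝒟.IsTangent p ξ)
    {s s' : EM × (F →L[ℝ] F) → F →L[ℝ] F} (hs : DifferentiableAt ℝ s p)
    (hs' : DifferentiableAt ℝ s' p) (h : ∀ᶠ q in 𝓝[𝒟.Z] p, s q = s' q) :
    𝒟.covEnd p ξ s = 𝒟.covEnd p ξ s' := by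
  rw [covEnd, covEnd, hξ.fderiv_congr hp hs hs' h, h.self_of_nhdsWithin hp]

theorem covF_apply {T : EM × (F →L[ℝ] F) → F →L[ℝ] F} {s : EM × (F →L[ℝ] F) → F}
    (hT : DifferentiableAt ℝ T p) (hs : DifferentiableAt ℝ s p) :
    𝒟.covF p ξ (fun q ↦ T q (s q)) = T p (𝒟.covF p ξ s) + 𝒟.covEnd p ξ T (s p) := by
  rw [covF, covF, covEnd, (hT.hasFDerivAt.clm_apply hs.hasFDerivAt).fderiv]
  simp only [add_apply, sub_apply, ContinuousLinearMap.comp_apply, ContinuousLinearMap.flip_apply,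
    map_add]
  rw [show (𝒟.Γ p.1 ξ.1 * T p) (s p) = 𝒟.Γ p.1 ξ.1 (T p (s p)) from rfl,
    show (T p * 𝒟.Γ p.1 ξ.1) (s p) = T p (𝒟.Γ p.1 ξ.1 (s p)) from rfl]
  abel

theorem covEnd_mul {T S : EM × (F →L[ℝ] F) → F →L[ℝ] F}
    (hT : DifferentiableAt ℝ T p) (hS : DifferentiableAt ℝ S p) :
    𝒟.covEnd p ξ (T * S) = T p * 𝒟.covEnd p ξ S + 𝒟.covEnd p ξ T * S p := by
  rw [covEnd, covEnd, covEnd, (hT.hasFDerivAt.mul' hS.hasFDerivAt).fderiv]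
  simp only [add_apply, smul_apply, smul_eq_mul, op_smul_eq_mul, Pi.mul_apply]
  noncomm_ring

theorem covEnd_add {T S : EM × (F →L[ℝ] F) → F →L[ℝ] F}
    (hT : DifferentiableAt ℝ T p) (hS : DifferentiableAt ℝ S p) :
    𝒟.covEnd p ξ (T + S) = 𝒟.covEnd p ξ T + 𝒟.covEnd p ξ S := by
  rw [covEnd, covEnd, covEnd, (hT.hasFDerivAt.add hS.hasFDerivAt).fderiv]
  simp only [add_apply, Pi.add_apply]
  noncomm_ring

theorem covEnd_snd : 𝒟.covEnd p ξ Prod.snd = 𝒟.vert p ξ := by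
  rw [covEnd, vert, fderiv_snd]
  rfl

theorem covEnd_P (hm : p.1 ∈ 𝒟.U) : 𝒟.covEnd p ξ (fun q ↦ 𝒟.P q.1) = 0 := by
  rw [covEnd, fderiv_comp_fst (differentiableAt_P hm)]
  exact 𝒟.parallel_P _ hm _

variable {X Y : EM × (F →L[ℝ] F) → EM × (F →L[ℝ] F)}

theorem differentiableAt_comp_fst {W : Type*} [NormedAddCommGroup W] [NormedSpace ℝ W]
    {f : EM → W} (hf : DifferentiableAt ℝ f p.1) :
    DifferentiableAt ℝ (fun q : EM × (F →L[ℝ] F) ↦ f q.1) p :=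
  DifferentiableAt.comp (g := f) (f := Prod.fst) p hf differentiableAt_fst

theorem differentiableAt_form_apply {W : Type*} [NormedAddCommGroup W] [NormedSpace ℝ W]
    {f : EM → EM →L[ℝ] W} (hf : DifferentiableAt ℝ f p.1) (hX : DifferentiableAt ℝ X p) :
    DifferentiableAt ℝ (fun q ↦ f q.1 (X q).1) p :=
  (differentiableAt_comp_fst hf).clm_apply hX.fst

theorem fderiv_form_apply {W : Type*} [NormedAddCommGroup W] [NormedSpace ℝ W]
    {f : EM → EM →L[ℝ] W} (hf : DifferentiableAt ℝ f p.1) (hX : DifferentiableAt ℝ X p) :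
    fderiv ℝ (fun q ↦ f q.1 (X q).1) p ξ =
      f p.1 (fderiv ℝ X p ξ).1 + fderiv ℝ f p.1 ξ.1 (X p).1 := by
  rw [((differentiableAt_comp_fst hf).hasFDerivAt.clm_apply hX.hasFDerivAt.fst).fderiv]
  simp only [add_apply, ContinuousLinearMap.comp_apply, ContinuousLinearMap.flip_apply,
    fderiv_comp_fst hf, ContinuousLinearMap.coe_fst']

theorem differentiableAt_vert (hm : p.1 ∈ 𝒟.U) (hX : DifferentiableAt ℝ X p) :
    DifferentiableAt ℝ (fun q ↦ 𝒟.vert q (X q)) p := by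
  have h1 := differentiableAt_form_apply (differentiableAt_Γ hm) hX
  exact hX.snd.add ((h1.mul differentiableAt_snd).sub (differentiableAt_snd.mul h1))

theorem covF_ι (hm : p.1 ∈ 𝒟.U) (hX : DifferentiableAt ℝ X p) :
    𝒟.covF p ξ (fun q ↦ 𝒟.ι q.1 (X q).1) =
      𝒟.ι p.1 (fderiv ℝ X p ξ).1 + 𝒟.solder ξ.1 (X p).1 p.1 := by
  rw [covF, fderiv_form_apply (differentiableAt_ι hm) hX, solder]
  abel

/-- This is the vanishing of the torsion, pulled back to $\mathrm{End}(E)$: the `solder` terms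
cancel by symmetry. -/
theorem ι_lieBracket (hm : p.1 ∈ 𝒟.U) (hX : DifferentiableAt ℝ X p)
    (hY : DifferentiableAt ℝ Y p) :
    𝒟.ι p.1 (lieBracket ℝ X Y p).1 = 𝒟.covF p (X p) (fun q ↦ 𝒟.ι q.1 (Y q).1) -
      𝒟.covF p (Y p) (fun q ↦ 𝒟.ι q.1 (X q).1) := by
  rw [covF_ι hm hX, covF_ι hm hY, solder, solder, 𝒟.torsion _ hm, lieBracket, Prod.fst_sub, map_sub]
  abel

set_option synthInstance.maxHeartbeats 200000 in
theorem covEnd_vert (hm : p.1 ∈ 𝒟.U) (hX : DifferentiableAt ℝ X p) :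
    𝒟.covEnd p ξ (fun q ↦ 𝒟.vert q (X q)) = 𝒟.vert p (fderiv ℝ X p ξ) +
      (fderiv ℝ 𝒟.Γ p.1 ξ.1 (X p).1 * p.2 - p.2 * fderiv ℝ 𝒟.Γ p.1 ξ.1 (X p).1) +
      (𝒟.Γ p.1 (X p).1 * ξ.2 - ξ.2 * 𝒟.Γ p.1 (X p).1) +
      (𝒟.Γ p.1 ξ.1 * 𝒟.vert p (X p) - 𝒟.vert p (X p) * 𝒟.Γ p.1 ξ.1) := by
  have h3 := (differentiableAt_form_apply (differentiableAt_Γ hm) hX).hasFDerivAt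
  have h4 : HasFDerivAt (𝕜 := ℝ) (Prod.snd : EM × (F →L[ℝ] F) → F →L[ℝ] F) _ p :=
    hasFDerivAt_snd
  have h5 := hX.hasFDerivAt.snd.add ((h3.mul' h4).sub (h4.mul' h3))
  rw [covEnd, HasFDerivAt.fderiv (f := fun q ↦ 𝒟.vert q (X q)) h5]
  simp only [add_apply, sub_apply, ContinuousLinearMap.comp_apply,
    fderiv_form_apply (differentiableAt_Γ hm) hX,
    ContinuousLinearMap.coe_snd', smul_apply, smul_eq_mul, op_smul_eq_mul, vert]
  noncomm_ring

/-- Structure equation for the vertical projection, which is the covariant derivative of the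
tautological section: its exterior covariant derivative is the bracket of the curvature with that
section. -/
theorem vert_lieBracket (hm : p.1 ∈ 𝒟.U) (hX : DifferentiableAt ℝ X p)
    (hY : DifferentiableAt ℝ Y p) :
    𝒟.vert p (lieBracket ℝ X Y p) = 𝒟.covEnd p (X p) (fun q ↦ 𝒟.vert q (Y q)) -
      𝒟.covEnd p (Y p) (fun q ↦ 𝒟.vert q (X q)) -
        (𝒟.curv p.1 (X p).1 (Y p).1 * p.2 - p.2 * 𝒟.curv p.1 (X p).1 (Y p).1) := by
  rw [covEnd_vert hm hX, covEnd_vert hm hY, lieBracket, vert_sub, curv]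
  simp only [vert]
  noncomm_ring

/-- The bracket of vector fields tangent to `Z` along `Z` is tangent to `Z`. -/
theorem isTangent_lieBracket [FiniteDimensional ℝ F] (hp : p ∈ 𝒟.Z)
    (hX : DifferentiableAt ℝ X p) (hY : DifferentiableAt ℝ Y p)
    (hXt : ∀ᶠ q in 𝓝[𝒟.Z] p, 𝒟.IsTangent q (X q))
    (hYt : ∀ᶠ q in 𝓝[𝒟.Z] p, 𝒟.IsTangent q (Y q)) :
    𝒟.IsTangent p (lieBracket ℝ X Y p) := by
  have hm := hp.1
  have hmem {X Y : EM × (F →L[ℝ] F) → EM × (F →L[ℝ] F)} (hY : DifferentiableAt ℝ Y p)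
      (hXt : ∀ᶠ q in 𝓝[𝒟.Z] p, 𝒟.IsTangent q (X q))
      (hYt : ∀ᶠ q in 𝓝[𝒟.Z] p, 𝒟.IsTangent q (Y q)) :
      𝒟.covEnd p (X p) (fun q ↦ 𝒟.vert q (Y q)) ∈ 𝒟.Q p.1 :=
    covEnd_mem hp (hXt.self_of_nhdsWithin hp) (differentiableAt_vert hm hY)
      (by filter_upwards [hYt] with q hq using hq.mem)
  -- Differentiate $A\,\mathrm{vert}\,Y+\mathrm{vert}\,Y\,A=0$ along $X$, using
  -- $\nabla_XA=\mathrm{vert}\,X$. The right-hand side is symmetric in $X$ and $Y$, so it drops out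
  -- of the bracket.
  have hanti {X Y : EM × (F →L[ℝ] F) → EM × (F →L[ℝ] F)} (hY : DifferentiableAt ℝ Y p)
      (hXt : ∀ᶠ q in 𝓝[𝒟.Z] p, 𝒟.IsTangent q (X q))
      (hYt : ∀ᶠ q in 𝓝[𝒟.Z] p, 𝒟.IsTangent q (Y q)) :
      p.2 * 𝒟.covEnd p (X p) (fun q ↦ 𝒟.vert q (Y q)) +
        𝒟.covEnd p (X p) (fun q ↦ 𝒟.vert q (Y q)) * p.2 =
        -(𝒟.vert p (X p) * 𝒟.vert p (Y p) + 𝒟.vert p (Y p) * 𝒟.vert p (X p)) := by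
    have hd := differentiableAt_vert hm hY
    have hs : DifferentiableAt ℝ (Prod.snd : EM × (F →L[ℝ] F) → F →L[ℝ] F) p :=
      differentiableAt_snd
    have h0 := covEnd_congr hp (hXt.self_of_nhdsWithin hp) ((hs.mul hd).add (hd.mul hs))
      (differentiableAt_const 0) (by filter_upwards [hYt] with q hq using hq.anticomm)
    have h1 := covEnd_add (𝒟 := 𝒟) (ξ := X p) (hs.mul hd) (hd.mul hs)
    have h2 := covEnd_mul (𝒟 := 𝒟) (ξ := X p) hs hd
    have h3 := covEnd_mul (𝒟 := 𝒟) (ξ := X p) hd hs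
    rw [covEnd_snd] at h2 h3
    have h4 : 𝒟.covEnd p (X p) (fun _ ↦ 0) = 0 := by simp [covEnd]
    have h5 := (h1.symm.trans h0).trans h4
    rw [h2, h3] at h5
    rw [eq_neg_iff_add_eq_zero, ← h5]
    abel
  have hA := hp.2.2
  refine ⟨?_, ?_⟩
  · rw [vert_lieBracket hm hX hY]
    exact (𝒟.Q p.1).sub_mem ((𝒟.Q p.1).sub_mem (hmem hY hXt hYt) (hmem hX hYt hXt))
      (curv_comm_mem hm _ _ hp.2.1)
  · rw [vert_lieBracket hm hX hY]
    have h1 := hanti hY hXt hYt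
    have h2 := hanti hX hYt hXt
    set R := 𝒟.curv p.1 (X p).1 (Y p).1
    have h3 : p.2 * (R * p.2 - p.2 * R) + (R * p.2 - p.2 * R) * p.2 = 0 := by
      have : p.2 * (R * p.2 - p.2 * R) + (R * p.2 - p.2 * R) * p.2 =
        R * (p.2 * p.2) - p.2 * p.2 * R := by noncomm_ring
      rw [this, hA]
      simp
    rw [mul_sub, sub_mul, sub_add_sub_comm, h3, mul_sub, sub_mul, sub_add_sub_comm, h1, h2]
    abel

/-- The section `e` of `E` such that `X₁ + i X₂` is over `ρ (e + i A e)`. -/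
def baseSection (𝒟 : LocalFQuaternionic EM F) (X₁ X₂ : EM × (F →L[ℝ] F) → EM × (F →L[ℝ] F))
    (q : EM × (F →L[ℝ] F)) : F :=
  𝒟.ι q.1 (X₁ q).1 - (1 - 𝒟.P q.1) (q.2 (𝒟.ι q.1 (X₂ q).1))

variable {X₁ X₂ Y₁ Y₂ : EM × (F →L[ℝ] F) → EM × (F →L[ℝ] F)}

/-- The vector $e$ provided by `exists_base` is unique and given by an explicit formula, hence
depends differentiably on the fields; this makes it possible to differentiate $e$. -/
theorem IsTypeC.ι_eq (hp : p ∈ 𝒟.Z) (h : 𝒟.IsTypeC p (X₁ p) (X₂ p)) :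
    𝒟.ι p.1 (X₁ p).1 = 𝒟.P p.1 (𝒟.baseSection X₁ X₂ p) ∧
      𝒟.ι p.1 (X₂ p).1 = 𝒟.P p.1 (p.2 (𝒟.baseSection X₁ X₂ p)) ∧
      (X₁ p).1 = 𝒟.ρ p.1 (𝒟.baseSection X₁ X₂ p) ∧
      (X₂ p).1 = 𝒟.ρ p.1 (p.2 (𝒟.baseSection X₁ X₂ p)) := by
  obtain ⟨hm, hAQ, hAA⟩ := hp
  obtain ⟨e, h1, h2⟩ := h.exists_base
  have hfr := 𝒟.frame _ hm
  have hA (v : F) : p.2 (p.2 v) = -v := by simpa using DFunLike.congr_fun hAA v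
  have hPP (v : F) : 𝒟.P p.1 (𝒟.P p.1 v) = 𝒟.P p.1 v := DFunLike.congr_fun hfr.PP v
  have he : 𝒟.baseSection X₁ X₂ p = e := by
    -- $(1-P)Ae\in V$ is mapped by $A$ into the range of $P$, whence $(1-P)e=-(1-P)APAe$.
    have h3 := hfr.apply_mem _ hAQ (p.2 e - 𝒟.P p.1 (p.2 e)) (by rw [map_sub, hPP, sub_self])
    simp only [map_sub, hA, map_neg] at h3
    rw [baseSection, h1, h2, 𝒟.ι_ρ _ hm, 𝒟.ι_ρ _ hm, sub_apply, one_apply_eq_self]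
    rw [← sub_eq_zero] at h3 ⊢
    rw [← neg_eq_zero, ← h3]
    abel
  rw [he, h1, h2, 𝒟.ι_ρ _ hm, 𝒟.ι_ρ _ hm]
  exact ⟨rfl, rfl, rfl, rfl⟩

theorem differentiableAt_baseSection (hm : p.1 ∈ 𝒟.U) (hX₁ : DifferentiableAt ℝ X₁ p)
    (hX₂ : DifferentiableAt ℝ X₂ p) : DifferentiableAt ℝ (𝒟.baseSection X₁ X₂) p := by
  have h1 := differentiableAt_form_apply (differentiableAt_ι hm) hX₁
  have h2 := differentiableAt_form_apply (differentiableAt_ι hm) hX₂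
  have h3 := differentiableAt_comp_fst (p := p) (differentiableAt_P hm)
  exact h1.sub (((differentiableAt_const _).sub h3).clm_apply (differentiableAt_snd.clm_apply h2))

/-- Differentiate $\iota X_1=Pe$, $\iota X_2=PAe$ and $\mathrm{vert}\,X_2=A\,\mathrm{vert}\,X_1$
along $Z$, with $\nabla P=0$ and $\nabla_\xi A=\mathrm{vert}\,\xi$. -/
theorem IsTypeC.cov_eq [FiniteDimensional ℝ F] (hp : p ∈ 𝒟.Z) (hξ : 𝒟.IsTangent p ξ)
    (hX₁ : DifferentiableAt ℝ X₁ p) (hX₂ : DifferentiableAt ℝ X₂ p)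
    (hX : ∀ᶠ q in 𝓝[𝒟.Z] p, 𝒟.IsTypeC q (X₁ q) (X₂ q)) :
    𝒟.covF p ξ (fun q ↦ 𝒟.ι q.1 (X₁ q).1) = 𝒟.P p.1 (𝒟.covF p ξ (𝒟.baseSection X₁ X₂)) ∧
    𝒟.covF p ξ (fun q ↦ 𝒟.ι q.1 (X₂ q).1) =
      𝒟.P p.1 (p.2 (𝒟.covF p ξ (𝒟.baseSection X₁ X₂)) +
        𝒟.vert p ξ (𝒟.baseSection X₁ X₂ p)) ∧
    𝒟.covEnd p ξ (fun q ↦ 𝒟.vert q (X₂ q)) =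
      p.2 * 𝒟.covEnd p ξ (fun q ↦ 𝒟.vert q (X₁ q)) + 𝒟.vert p ξ * 𝒟.vert p (X₁ p) := by
  have hm := hp.1
  have hP := differentiableAt_comp_fst (p := p) (differentiableAt_P hm)
  have he := differentiableAt_baseSection hm hX₁ hX₂
  have hs : DifferentiableAt ℝ (Prod.snd : EM × (F →L[ℝ] F) → F →L[ℝ] F) p :=
    differentiableAt_snd
  have hse := hs.clm_apply he
  refine ⟨?_, ?_, ?_⟩
  · rw [covF_congr hp hξ (differentiableAt_form_apply (differentiableAt_ι hm) hX₁)
      (hP.clm_apply he)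
      (by filter_upwards [hX, self_mem_nhdsWithin] with q hq hqZ using (hq.ι_eq hqZ).1),
      covF_apply hP he, covEnd_P hm, zero_apply, add_zero]
  · rw [covF_congr hp hξ (differentiableAt_form_apply (differentiableAt_ι hm) hX₂)
      (hP.clm_apply hse)
      (by filter_upwards [hX, self_mem_nhdsWithin] with q hq hqZ using (hq.ι_eq hqZ).2.1),
      covF_apply hP hse, covEnd_P hm, zero_apply, add_zero, covF_apply hs he, covEnd_snd]
  · rw [← covEnd_snd, ← covEnd_mul hs (differentiableAt_vert hm hX₁)]
    exact covEnd_congr hp hξ (differentiableAt_vert hm hX₂)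
      (hs.mul (differentiableAt_vert hm hX₁)) (by filter_upwards [hX] with q hq using hq.vert_eq)

/-- Involutivity of the distribution `𝒞`, in coordinates. -/
theorem isTypeC_lieBracket [FiniteDimensional ℝ F] (hp : p ∈ 𝒟.Z)
    (hX₁ : DifferentiableAt ℝ X₁ p) (hX₂ : DifferentiableAt ℝ X₂ p)
    (hY₁ : DifferentiableAt ℝ Y₁ p) (hY₂ : DifferentiableAt ℝ Y₂ p)
    (hX : ∀ᶠ q in 𝓝[𝒟.Z] p, 𝒟.IsTypeC q (X₁ q) (X₂ q))
    (hY : ∀ᶠ q in 𝓝[𝒟.Z] p, 𝒟.IsTypeC q (Y₁ q) (Y₂ q)) :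
    𝒟.IsTypeC p (lieBracket ℝ X₁ Y₁ p - lieBracket ℝ X₂ Y₂ p)
      (lieBracket ℝ X₁ Y₂ p + lieBracket ℝ X₂ Y₁ p) := by
  have hm := hp.1
  have hA := hp.2.2
  have hX1t : ∀ᶠ q in 𝓝[𝒟.Z] p, 𝒟.IsTangent q (X₁ q) := hX.mono fun q hq ↦ hq.tangent
  have hY1t : ∀ᶠ q in 𝓝[𝒟.Z] p, 𝒟.IsTangent q (Y₁ q) := hY.mono fun q hq ↦ hq.tangent
  have hX2t : ∀ᶠ q in 𝓝[𝒟.Z] p, 𝒟.IsTangent q (X₂ q) := by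
    filter_upwards [hX, self_mem_nhdsWithin] with q hq hqZ using hq.tangent_right hqZ
  have hY2t : ∀ᶠ q in 𝓝[𝒟.Z] p, 𝒟.IsTangent q (Y₂ q) := by
    filter_upwards [hY, self_mem_nhdsWithin] with q hq hqZ using hq.tangent_right hqZ
  have hXp := hX.self_of_nhdsWithin hp
  have hYp := hY.self_of_nhdsWithin hp
  obtain ⟨-, -, hx₁, hx₂⟩ := hXp.ι_eq hp
  obtain ⟨-, -, hy₁, hy₂⟩ := hYp.ι_eq hp
  obtain ⟨c11, c12, v12⟩ := IsTypeC.cov_eq hp (hX1t.self_of_nhdsWithin hp) hY₁ hY₂ hY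
  obtain ⟨c21, c22, v22⟩ := IsTypeC.cov_eq hp (hX2t.self_of_nhdsWithin hp) hY₁ hY₂ hY
  obtain ⟨d11, d12, w12⟩ := IsTypeC.cov_eq hp (hY1t.self_of_nhdsWithin hp) hX₁ hX₂ hX
  obtain ⟨d21, d22, w22⟩ := IsTypeC.cov_eq hp (hY2t.self_of_nhdsWithin hp) hX₁ hX₂ hX
  have hA' (v : F) : p.2 (p.2 v) = -v := by simpa using DFunLike.congr_fun hA v
  have hR := typeDefect_curv_eq_zero hp (𝒟.baseSection X₁ X₂ p) (𝒟.baseSection Y₁ Y₂ p)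
    _ _ _ _ hx₁ hx₂ hy₁ hy₂
  have hmul (S T : F →L[ℝ] F) (v : F) : (S * T) v = S (T v) := rfl
  have hρP (v : F) : 𝒟.ρ p.1 (𝒟.P p.1 v) = 𝒟.ρ p.1 v := by rw [← 𝒟.ι_ρ _ hm, 𝒟.ρ_ι _ hm]
  refine ⟨?_, ?_, ?_⟩
  · exact (isTangent_lieBracket hp hX₁ hY₁ hX1t hY1t).sub
      (isTangent_lieBracket hp hX₂ hY₂ hX2t hY2t)
  · rw [vert_add, vert_sub, vert_lieBracket hm hX₁ hY₁, vert_lieBracket hm hX₂ hY₂,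
      vert_lieBracket hm hX₁ hY₂, vert_lieBracket hm hX₂ hY₁, v12, v22, w12, w22, hXp.vert_eq,
      hYp.vert_eq]
    set R₁₁ := 𝒟.curv p.1 (X₁ p).1 (Y₁ p).1
    set R₁₂ := 𝒟.curv p.1 (X₁ p).1 (Y₂ p).1
    set R₂₁ := 𝒟.curv p.1 (X₂ p).1 (Y₁ p).1
    set R₂₂ := 𝒟.curv p.1 (X₂ p).1 (Y₂ p).1
    set A := p.2
    clear_value R₁₁ R₁₂ R₂₁ R₂₂ A
    -- Up to sign, the difference of the two sides is the curvature defect: all terms in covariant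
    -- derivatives and vertical parts cancel by $A^2=-1$.
    rw [← sub_eq_zero] at hR ⊢
    rw [← neg_eq_zero, ← hR]
    have hAx (x : F →L[ℝ] F) : A * (A * x) = -x := by rw [← mul_assoc, hA, neg_one_mul]
    simp only [mul_sub, mul_add, sub_mul, add_mul, mul_assoc, hAx]
    abel
  -- With $e$ and $f$ the base sections of $X$ and $Y$, the witness is the real part of
  -- $\nabla_X(f+\mathrm{i}Af)-\nabla_Y(e+\mathrm{i}Ae)$.
  · refine ⟨𝒟.covF p (X₁ p) (𝒟.baseSection Y₁ Y₂) - p.2 (𝒟.covF p (X₂ p) (𝒟.baseSection Y₁ Y₂)) -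
      𝒟.vert p (X₂ p) (𝒟.baseSection Y₁ Y₂ p) -
      (𝒟.covF p (Y₁ p) (𝒟.baseSection X₁ X₂) - p.2 (𝒟.covF p (Y₂ p) (𝒟.baseSection X₁ X₂)) -
        𝒟.vert p (Y₂ p) (𝒟.baseSection X₁ X₂ p)), ?_, ?_⟩
    · rw [← 𝒟.ρ_ι _ hm (lieBracket ℝ X₁ Y₁ p - lieBracket ℝ X₂ Y₂ p).1, Prod.fst_sub, map_sub,
        ι_lieBracket hm hX₁ hY₁, ι_lieBracket hm hX₂ hY₂, c11, d11, c22, d22]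
      simp only [map_sub, map_add, hρP]
      abel
    · rw [← 𝒟.ρ_ι _ hm (lieBracket ℝ X₁ Y₂ p + lieBracket ℝ X₂ Y₁ p).1, Prod.fst_add, map_add,
        ι_lieBracket hm hX₁ hY₂, ι_lieBracket hm hX₂ hY₁, c12, d21, c21, d12, hXp.vert_eq,
        hYp.vert_eq]
      simp only [map_sub, map_add, hρP, hA', map_neg, hmul]
      abel

end Calculus

end LocalFQuaternionic

/-- Anticommuting imaginary quaternions are orthogonal, so the real part of their product vanishes.
-/
theorem IsQuaternionFrame.mul_mem_of_anticomm {R : Type*} [Ring R] [Algebra ℝ R] {I J K A C : R}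
    (h : IsQuaternionFrame I J K) (hA : A ∈ Submodule.span ℝ {I, J, K})
    (hC : C ∈ Submodule.span ℝ {I, J, K}) (hAC : A * C + C * A = 0) :
    A * C ∈ Submodule.span ℝ {I, J, K} := by
  obtain ⟨a, b, c, rfl⟩ := mem_span_triple.1 hA
  obtain ⟨x, y, z, rfl⟩ := mem_span_triple.1 hC
  have h1 : (-(a * x + b * y + c * z)) • (1 : R) = 0 := by
    rw [h.comb_anticomm] at hAC
    have h2 := congrArg (fun r : R ↦ (1 / 2 : ℝ) • r) hAC
    simp only [smul_smul, smul_zero] at h2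
    rw [← h2]
    congr 1
    ring
  rw [h.comb_mul_comb, h1, zero_add]
  exact mem_span_triple.2 ⟨_, _, _, rfl⟩

/-! ### Real and imaginary parts in a complexification. -/

section Complexification

variable {W W' : Type*} [AddCommGroup W] [Module ℝ W] [AddCommGroup W'] [Module ℝ W']

/-- The real part of an element of the complexification. -/
def cpxRe (W : Type*) [AddCommGroup W] [Module ℝ W] : ℂ ⊗[ℝ] W →ₗ[ℝ] W :=
  (TensorProduct.lid ℝ W).toLinearMap ∘ₗ LinearMap.rTensor W Complex.reLm

/-- The imaginary part of an element of the complexification. -/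
def cpxIm (W : Type*) [AddCommGroup W] [Module ℝ W] : ℂ ⊗[ℝ] W →ₗ[ℝ] W :=
  (TensorProduct.lid ℝ W).toLinearMap ∘ₗ LinearMap.rTensor W Complex.imLm

@[simp] theorem cpxRe_tmul (z : ℂ) (w : W) : cpxRe W (z ⊗ₜ w) = z.re • w := by simp [cpxRe]

@[simp] theorem cpxIm_tmul (z : ℂ) (w : W) : cpxIm W (z ⊗ₜ w) = z.im • w := by simp [cpxIm]

@[simp] theorem cpxRe_cpx (a b : W) : cpxRe W (cpx a b) = a := by simp [cpx]

@[simp] theorem cpxIm_cpx (a b : W) : cpxIm W (cpx a b) = b := by simp [cpx]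

theorem cpx_inj {a b a' b' : W} : cpx a b = cpx a' b' ↔ a = a' ∧ b = b' := by
  refine ⟨fun h ↦ ⟨?_, ?_⟩, by rintro ⟨rfl, rfl⟩; rfl⟩
  · simpa using congrArg (cpxRe W) h
  · simpa using congrArg (cpxIm W) h

theorem cpx_add (a b a' b' : W) : cpx a b + cpx a' b' = cpx (a + a') (b + b') := by
  simp only [cpx, TensorProduct.tmul_add]
  abel

theorem tmul_eq_cpx (z : ℂ) (w : W) : z ⊗ₜ[ℝ] w = cpx (z.re • w) (z.im • w) := by
  rw [cpx, ← TensorProduct.smul_tmul, ← TensorProduct.smul_tmul, ← TensorProduct.add_tmul]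
  congr 1
  simp

theorem cpx_cpxRe_cpxIm (ζ : ℂ ⊗[ℝ] W) : cpx (cpxRe W ζ) (cpxIm W ζ) = ζ := by
  induction ζ with
  | zero => simp [cpx]
  | tmul z w => simp [tmul_eq_cpx]
  | add x y hx hy => rw [map_add, map_add, ← cpx_add, hx, hy]

theorem smul_cpx (z : ℂ) (a b : W) :
    z • cpx a b = cpx (z.re • a - z.im • b) (z.im • a + z.re • b) := by
  have h1 : z • cpx a b = z ⊗ₜ[ℝ] a + (z * Complex.I) ⊗ₜ[ℝ] b := by
    simp [cpx, smul_add, TensorProduct.smul_tmul']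
  rw [h1, tmul_eq_cpx, tmul_eq_cpx, cpx_add]
  simp [sub_eq_add_neg]

theorem baseChange_cpx (f : W →ₗ[ℝ] W') (a b : W) :
    f.baseChange ℂ (cpx a b) = cpx (f a) (f b) := by
  simp [cpx]

theorem cpx_mem_baseChange {S : Submodule ℝ W} {a b : W} :
    cpx a b ∈ S.baseChange ℂ ↔ a ∈ S ∧ b ∈ S := by
  refine ⟨fun h ↦ ?_, fun h ↦ add_mem (Submodule.tmul_mem_baseChange_of_mem _ h.1)
    (Submodule.tmul_mem_baseChange_of_mem _ h.2)⟩
  suffices H : ∀ ζ ∈ S.baseChange ℂ, cpxRe W ζ ∈ S ∧ cpxIm W ζ ∈ S by simpa using H _ h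
  intro ζ hζ
  rw [Submodule.baseChange_eq_span] at hζ
  induction hζ using Submodule.span_induction with
  | mem x hx =>
    obtain ⟨w, hw, rfl⟩ := hx
    simpa using hw
  | zero => simp
  | add x y _ _ hx hy => simpa using ⟨S.add_mem hx.1 hy.1, S.add_mem hx.2 hy.2⟩
  | smul z x _ hx =>
    rw [← cpx_cpxRe_cpxIm x, smul_cpx, cpxRe_cpx, cpxIm_cpx]
    exact ⟨S.sub_mem (S.smul_mem _ hx.1) (S.smul_mem _ hx.2),
      S.add_mem (S.smul_mem _ hx.1) (S.smul_mem _ hx.2)⟩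

/-- The elements of type `(0,1)` determined by a linear complex structure. -/
theorem cpx_mem_span_iff {R : Type*} [Ring R] [Algebra ℝ R] {p : R} (hp : p * p = -1)
    {Q : Submodule ℝ R} (hQ : ∀ A ∈ Q, p * A + A * p = 0 → p * A ∈ Q) (vl : R →ₗ[ℝ] W) {a b : W} :
    cpx a b ∈ Submodule.span ℂ {ζ : ℂ ⊗[ℝ] W | ∃ A ∈ Q, p * A + A * p = 0 ∧
      ζ = cpx (vl A) (vl (p * A))} ↔
    ∃ A ∈ Q, p * A + A * p = 0 ∧ a = vl A ∧ b = vl (p * A) := by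
  refine ⟨fun h ↦ ?_, fun ⟨A, hA, hA', h1, h2⟩ ↦
    Submodule.subset_span ⟨A, hA, hA', by rw [h1, h2]⟩⟩
  suffices H : ∀ ζ ∈ Submodule.span ℂ {ζ : ℂ ⊗[ℝ] W | ∃ A ∈ Q, p * A + A * p = 0 ∧
      ζ = cpx (vl A) (vl (p * A))}, ∃ A ∈ Q, p * A + A * p = 0 ∧ ζ = cpx (vl A) (vl (p * A)) by
    obtain ⟨A, hA, hA', h1⟩ := H _ h
    exact ⟨A, hA, hA', cpx_inj.1 h1⟩
  intro ζ hζ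
  have hpp (A : R) : p * (p * A) = -A := by rw [← mul_assoc, hp, neg_one_mul]
  induction hζ using Submodule.span_induction with
  | mem x hx => exact hx
  | zero => exact ⟨0, Q.zero_mem, by simp, by simp [cpx]⟩
  | add x y _ _ hx hy =>
    obtain ⟨A, hA, hA', rfl⟩ := hx
    obtain ⟨B, hB, hB', rfl⟩ := hy
    refine ⟨A + B, Q.add_mem hA hB, ?_, ?_⟩
    · rw [mul_add, add_mul, add_add_add_comm, hA', hB', add_zero]
    · rw [cpx_add, mul_add, map_add, map_add]
  | smul z x _ hx =>
    obtain ⟨A, hA, hA', rfl⟩ := hx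
    -- Multiplying $A+\mathrm{i}\,pA$ by $z$ gives the vector of the same form attached to
    -- $\mathrm{Re}(z)A-\mathrm{Im}(z)\,pA$, so the generators already form a complex subspace.
    refine ⟨z.re • A - z.im • (p * A), Q.sub_mem (Q.smul_mem _ hA) (Q.smul_mem _ (hQ A hA hA')),
      ?_, ?_⟩
    · have h1 : p * (p * A) + p * A * p = 0 := by rw [mul_assoc, ← mul_add, hA', mul_zero]
      have h2 : p * (z.re • A - z.im • (p * A)) + (z.re • A - z.im • (p * A)) * p =
          z.re • (p * A + A * p) - z.im • (p * (p * A) + p * A * p) := by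
        simp only [mul_sub, sub_mul, mul_smul_comm, smul_mul_assoc, smul_add]
        abel
      rw [h2, hA', h1, smul_zero, smul_zero, sub_zero]
    · rw [smul_cpx, mul_sub, mul_smul_comm, mul_smul_comm, hpp]
      simp only [map_sub, map_smul, map_neg, smul_neg]
      rw [sub_neg_eq_add, add_comm (z.im • vl A)]

end Complexification

/-! ### The fibres of $\mathcal{C}$ in terms of real and imaginary parts. -/

section Distribution

variable {EM : Type*} [NormedAddCommGroup EM] [NormedSpace ℝ EM]
  {M : Type*} [TopologicalSpace M] [ChartedSpace EM M]
  {F : Type*} [NormedAddCommGroup F] [NormedSpace ℝ F]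
  {E : M → Type*} [TopologicalSpace (TotalSpace F E)]
  [∀ x, AddCommGroup (E x)] [∀ x, Module ℝ (E x)] [∀ x, TopologicalSpace (E x)]
  [∀ x, IsTopologicalAddGroup (E x)] [∀ x, ContinuousSMul ℝ (E x)]
  [FiberBundle F E] [VectorBundle ℝ F E]

-- $(J+\mathrm{i})(a+\mathrm{i}b)=(Ja-b)+\mathrm{i}(Jb+a)$; as $J^2=-1$, vanishing of the real part
-- forces that of the imaginary part.
omit [∀ x, IsTopologicalAddGroup (E x)] [∀ x, ContinuousSMul ℝ (E x)] [ChartedSpace EM M]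
  [FiberBundle F E] [TopologicalSpace (TotalSpace F E)] [VectorBundle ℝ F E] in
theorem cpx_mem_EJ {x : M} {J : E x →L[ℝ] E x} (hJ : ∀ v, J (J v) = -v) {a b : E x} :
    cpx a b ∈ EJ J ↔ b = J a := by
  have h1 : ((J : E x →ₗ[ℝ] E x).baseChange ℂ + Complex.I • LinearMap.id :
      ℂ ⊗[ℝ] E x →ₗ[ℂ] ℂ ⊗[ℝ] E x) (cpx a b) =
      cpx (J a - b) (J b + a) := by
    rw [LinearMap.add_apply, baseChange_cpx, LinearMap.smul_apply, LinearMap.id_apply, smul_cpx,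
      cpx_add]
    simp [sub_eq_add_neg]
  have h2 : (0 : ℂ ⊗[ℝ] E x) = cpx 0 0 := by simp [cpx]
  rw [EJ, LinearMap.mem_ker, h1, h2, cpx_inj]
  refine ⟨fun h ↦ (sub_eq_zero.1 h.1).symm, ?_⟩
  rintro rfl
  simp [hJ]

omit [∀ x, IsTopologicalAddGroup (E x)] [∀ x, ContinuousSMul ℝ (E x)]
  [FiberBundle F E] [TopologicalSpace (TotalSpace F E)] [VectorBundle ℝ F E] in
theorem cpx_mem_rhoEJ {x : M} {ρ : E x →L[ℝ] TangentSpace 𝓘(ℝ, EM) x} {J : E x →L[ℝ] E x}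
    (hJ : ∀ v, J (J v) = -v) {a b : TangentSpace 𝓘(ℝ, EM) x} :
    cpx a b ∈ rhoEJ ρ J ↔ ∃ e, a = ρ e ∧ b = ρ (J e) := by
  rw [rhoEJ, Submodule.mem_map]
  constructor
  · rintro ⟨ζ, hζ, h⟩
    rw [← cpx_cpxRe_cpxIm ζ] at hζ h
    rw [baseChange_cpx, cpx_inj] at h
    exact ⟨_, h.1.symm, by rw [← (cpx_mem_EJ hJ).1 hζ]; exact h.2.symm⟩
  · rintro ⟨e, rfl, rfl⟩
    exact ⟨cpx e (J e), (cpx_mem_EJ hJ).2 rfl, baseChange_cpx _ _ _⟩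

theorem cpx_mem_distB {ρ : ∀ x : M, E x →L[ℝ] TangentSpace 𝓘(ℝ, EM) x}
    {nabla : CovariantDerivative 𝓘(ℝ, EM) F E} {p : EndTotal F E} (hp : ∀ v, p.2 (p.2 v) = -v)
    {a b : TangentSpace (endModel EM F) p} :
    cpx a b ∈ distB ρ nabla p ↔ (a ∈ horizontal nabla p ∧ b ∈ horizontal nabla p) ∧
      ∃ e, dproj p a = ρ p.1 e ∧ dproj p b = ρ p.1 (p.2 e) := by
  rw [distB, Submodule.mem_inf, cpx_mem_baseChange, Submodule.mem_comap, baseChange_cpx,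
    cpx_mem_rhoEJ hp]

/-- `verticalLift` is defined pointwise by a derivative, so its linearity is supplied through `vl`,
which the chart provides later. -/
theorem QuaternionicStructure.cpx_mem_distC (𝒬 : QuaternionicStructure (EM := EM) F E)
    {ρ : ∀ x : M, E x →L[ℝ] TangentSpace 𝓘(ℝ, EM) x}
    {nabla : CovariantDerivative 𝓘(ℝ, EM) F E} {p : EndTotal F E} (hp : p ∈ 𝒬.Z)
    (vl : (E p.1 →L[ℝ] E p.1) →ₗ[ℝ] TangentSpace (endModel EM F) p)
    (hvl : ∀ A, verticalLift (EM := EM) p A = vl A) {a b : TangentSpace (endModel EM F) p} :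
    cpx a b ∈ 𝒬.distC ρ nabla p ↔ ∃ A ∈ 𝒬.Q p.1, p.2 ∘L A + A ∘L p.2 = 0 ∧
      ∃ e, ∃ h₁ ∈ horizontal nabla p, ∃ h₂ ∈ horizontal nabla p,
        dproj p h₁ = ρ p.1 e ∧ dproj p h₂ = ρ p.1 (p.2 e) ∧
        a = vl A + h₁ ∧ b = vl (p.2 ∘L A) + h₂ := by
  have hpp : p.2 * p.2 = -1 := hp.2
  have hQ : ∀ A ∈ 𝒬.Q p.1, p.2 * A + A * p.2 = 0 → p.2 * A ∈ 𝒬.Q p.1 := by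
    intro A hA hA'
    obtain ⟨U, -, hU, I, J, K, -, -, -, hfr⟩ := 𝒬.exists_local_frame p.1
    obtain ⟨hII, hJJ, hIJ, hJI, hQ⟩ := hfr _ hU
    have hf : IsQuaternionFrame (I p.1) (J p.1) (K p.1) := ⟨hII, hJJ, hIJ, hJI⟩
    rw [hQ] at hA ⊢
    refine hf.mul_mem_of_anticomm ?_ hA hA'
    rw [← hQ]
    exact hp.1
  have hv : ∀ {a b : TangentSpace (endModel EM F) p}, cpx a b ∈ 𝒬.vertical01 (EM := EM) p ↔
      ∃ A ∈ 𝒬.Q p.1, p.2 ∘L A + A ∘L p.2 = 0 ∧ a = vl A ∧ b = vl (p.2 ∘L A) := by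
    intro a b
    rw [QuaternionicStructure.vertical01]
    simp only [hvl]
    exact cpx_mem_span_iff hpp hQ vl
  have hpv (v : E p.1) : p.2 (p.2 v) = -v := by simpa using DFunLike.congr_fun hpp v
  rw [QuaternionicStructure.distC, Submodule.mem_sup]
  constructor
  · rintro ⟨y, hy, z, hz, h⟩
    rw [← cpx_cpxRe_cpxIm y] at hy h
    rw [← cpx_cpxRe_cpxIm z] at hz h
    rw [cpx_add, cpx_inj] at h
    obtain ⟨A, hA, hA', h1, h2⟩ := hv.1 hy
    obtain ⟨⟨h3, h4⟩, e, h5, h6⟩ := (cpx_mem_distB hpv).1 hz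
    exact ⟨A, hA, hA', e, _, h3, _, h4, h5, h6, by rw [← h1]; exact h.1.symm,
      by rw [← h2]; exact h.2.symm⟩
  · rintro ⟨A, hA, hA', e, h₁, h3, h₂, h4, h5, h6, rfl, rfl⟩
    exact ⟨cpx (vl A) (vl (p.2 ∘L A)), hv.2 ⟨A, hA, hA', rfl, rfl⟩, cpx h₁ h₂,
      (cpx_mem_distB hpv).2 ⟨⟨h3, h4⟩, e, h5, h6⟩, cpx_add _ _ _ _⟩

end Distribution

set_option linter.unusedSectionVars false

/-! ### Charts of $M$ and of the total space of $\mathrm{End}(E)$. -/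

section Coordinates

variable {EM : Type*} [NormedAddCommGroup EM] [NormedSpace ℝ EM]
  {M : Type*} [TopologicalSpace M] [ChartedSpace EM M]
  (F : Type*) [NormedAddCommGroup F] [NormedSpace ℝ F]
  (E : M → Type*) [TopologicalSpace (TotalSpace F E)]
  [∀ x, AddCommGroup (E x)] [∀ x, Module ℝ (E x)] [∀ x, TopologicalSpace (E x)]
  [FiberBundle F E] [VectorBundle ℝ F E] (x₀ : M)

/-- The domain of the coordinates around `x₀`. -/
def coordDomain : Set EM :=
  (extChartAt 𝓘(ℝ, EM) x₀).target ∩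
    (extChartAt 𝓘(ℝ, EM) x₀).symm ⁻¹' (trivializationAt F E x₀).baseSet

/-- The point with given coordinates. -/
abbrev coordPt (m : EM) : M := (extChartAt 𝓘(ℝ, EM) x₀).symm m

/-- The identification of the model fibre with a fibre of `E`. -/
def fromCoord (m : EM) : F →L[ℝ] E (coordPt x₀ m) := (trivializationAt F E x₀).symmL ℝ _

/-- The identification of a fibre of `E` with the model fibre. -/
def toCoord (m : EM) : E (coordPt x₀ m) →L[ℝ] F :=
  (trivializationAt F E x₀).continuousLinearMapAt ℝ _

variable (EM) in
/-- The differential of the inverse chart. -/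
def fromCoordT (m : EM) : EM →L[ℝ] TangentSpace 𝓘(ℝ, EM) (coordPt x₀ m) :=
  mfderiv 𝓘(ℝ, EM) 𝓘(ℝ, EM) (extChartAt 𝓘(ℝ, EM) x₀).symm m

/-- The inverse chart of `End(E)`. -/
def endPt (q : EM × (F →L[ℝ] F)) : EndTotal F E :=
  ⟨coordPt x₀ q.1, fromCoord F E x₀ q.1 ∘L q.2 ∘L toCoord F E x₀ q.1⟩

variable {F E x₀} {m : EM}

theorem isOpen_coordDomain : IsOpen (coordDomain (EM := EM) F E x₀) :=
  (continuousOn_extChartAt_symm x₀).isOpen_inter_preimage (isOpen_extChartAt_target x₀)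
    (trivializationAt F E x₀).open_baseSet

theorem coordPt_extChartAt : coordPt x₀ (extChartAt 𝓘(ℝ, EM) x₀ x₀) = x₀ :=
  extChartAt_to_inv x₀

theorem extChartAt_mem_coordDomain : extChartAt 𝓘(ℝ, EM) x₀ x₀ ∈ coordDomain F E x₀ := by
  refine ⟨mem_extChartAt_target x₀, ?_⟩
  rw [Set.mem_preimage, extChartAt_to_inv]
  exact mem_baseSet_trivializationAt F E x₀

theorem mem_source (hm : m ∈ coordDomain F E x₀) : coordPt x₀ m ∈ (chartAt EM x₀).source := by
  rw [← extChartAt_source 𝓘(ℝ, EM)]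
  exact (extChartAt 𝓘(ℝ, EM) x₀).map_target hm.1

theorem extChartAt_coordPt (hm : m ∈ coordDomain F E x₀) :
    extChartAt 𝓘(ℝ, EM) x₀ (coordPt x₀ m) = m :=
  (extChartAt 𝓘(ℝ, EM) x₀).right_inv hm.1

theorem fromCoord_toCoord (hm : m ∈ coordDomain F E x₀) (v : E (coordPt x₀ m)) :
    fromCoord F E x₀ m (toCoord F E x₀ m v) = v :=
  (trivializationAt F E x₀).symmL_continuousLinearMapAt hm.2 v

theorem toCoord_fromCoord (hm : m ∈ coordDomain F E x₀) (v : F) :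
    toCoord F E x₀ m (fromCoord F E x₀ m v) = v :=
  (trivializationAt F E x₀).continuousLinearMapAt_symmL hm.2 v

theorem fromCoord_injective (hm : m ∈ coordDomain F E x₀) :
    Function.Injective (fromCoord F E x₀ m) :=
  Function.LeftInverse.injective (toCoord_fromCoord hm)

theorem fromCoord_surjective (hm : m ∈ coordDomain F E x₀) :
    Function.Surjective (fromCoord F E x₀ m) :=
  Function.RightInverse.surjective (fromCoord_toCoord hm)

section Smooth

variable [IsManifold 𝓘(ℝ, EM) ∞ M]

theorem contMDiffAt_coordPt (hm : m ∈ coordDomain F E x₀) :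
    ContMDiffAt 𝓘(ℝ, EM) 𝓘(ℝ, EM) ∞ (fun m' : EM ↦ coordPt x₀ m') m :=
  (contMDiffOn_extChartAt_symm x₀).contMDiffAt
    ((isOpen_extChartAt_target x₀).mem_nhds hm.1)

theorem mdifferentiableAt_coordPt (hm : m ∈ coordDomain F E x₀) :
    MDifferentiableAt 𝓘(ℝ, EM) 𝓘(ℝ, EM) (fun m' : EM ↦ coordPt x₀ m') m :=
  (contMDiffAt_coordPt hm).mdifferentiableAt (by simp)

theorem fromCoordT_injective (hm : m ∈ coordDomain F E x₀) :
    Function.Injective (fromCoordT EM x₀ m) := by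
  have := isInvertible_mfderivWithin_extChartAt_symm (I := 𝓘(ℝ, EM)) hm.1
  rw [modelWithCornersSelf_coe, Set.range_id, mfderivWithin_univ] at this
  exact this.injective

theorem fromCoordT_surjective (hm : m ∈ coordDomain F E x₀) :
    Function.Surjective (fromCoordT EM x₀ m) := by
  have := isInvertible_mfderivWithin_extChartAt_symm (I := 𝓘(ℝ, EM)) hm.1
  rw [modelWithCornersSelf_coe, Set.range_id, mfderivWithin_univ] at this
  exact this.surjective

theorem fromCoordT_eq_symmL (hm : m ∈ coordDomain F E x₀) :
    (trivializationAt EM (TangentSpace 𝓘(ℝ, EM) : M → Type _) x₀).symmL ℝ (coordPt x₀ m) =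
      fromCoordT EM x₀ m := by
  rw [TangentBundle.symmL_trivializationAt (mem_source hm), extChartAt_coordPt hm,
    modelWithCornersSelf_coe, Set.range_id, mfderivWithin_univ]
  rfl

end Smooth

variable [∀ x, IsTopologicalAddGroup (E x)] [∀ x, ContinuousSMul ℝ (E x)]

/-- Identifying the explicit parametrisation with an inverse extended chart gives its smoothness and
the invertibility of its differential. -/
theorem endPt_eq : (endPt F E x₀ : EM × (F →L[ℝ] F) → EndTotal F E) =
    (extChartAt (endModel EM F) (⟨x₀, 0⟩ : EndTotal F E)).symm := by
  funext q
  rw [FiberBundle.extChartAt]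
  rfl

theorem extChartAt_target_endPt :
    (extChartAt (endModel EM F) (⟨x₀, 0⟩ : EndTotal F E)).target =
      coordDomain (EM := EM) F E x₀ ×ˢ Set.univ := by
  rw [FiberBundle.extChartAt_target, hom_trivializationAt_baseSet, Set.inter_self]
  rfl

theorem isManifold_endTotal [IsManifold 𝓘(ℝ, EM) ∞ M] [ContMDiffVectorBundle ∞ F E 𝓘(ℝ, EM)] :
    IsManifold (endModel EM F) ∞ (EndTotal F E) := inferInstance

section

variable [IsManifold 𝓘(ℝ, EM) ∞ M] [ContMDiffVectorBundle ∞ F E 𝓘(ℝ, EM)]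
  {q : EM × (F →L[ℝ] F)}

theorem contMDiffAt_endPt (hq : q.1 ∈ coordDomain F E x₀) :
    ContMDiffAt 𝓘(ℝ, EM × (F →L[ℝ] F)) (endModel EM F) ∞ (endPt F E x₀) q := by
  rw [endPt_eq]
  refine (contMDiffOn_extChartAt_symm _).contMDiffAt
    ((isOpen_extChartAt_target _).mem_nhds ?_)
  rw [extChartAt_target_endPt]
  exact ⟨hq, trivial⟩

theorem mdifferentiableAt_endPt (hq : q.1 ∈ coordDomain F E x₀) :
    MDifferentiableAt 𝓘(ℝ, EM × (F →L[ℝ] F)) (endModel EM F) (endPt F E x₀) q :=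
  (contMDiffAt_endPt hq).mdifferentiableAt (by simp)

theorem isInvertible_mfderiv_endPt (hq : q.1 ∈ coordDomain F E x₀) :
    (mfderiv 𝓘(ℝ, EM × (F →L[ℝ] F)) (endModel EM F) (endPt F E x₀) q).IsInvertible := by
  have h : q ∈ (extChartAt (endModel EM F) (⟨x₀, 0⟩ : EndTotal F E)).target := by
    rw [extChartAt_target_endPt]
    exact ⟨hq, trivial⟩
  have := isInvertible_mfderivWithin_extChartAt_symm h
  rw [ModelWithCorners.range_eq_univ, mfderivWithin_univ] at this
  rw [endPt_eq]
  exact this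

variable (F E x₀) in
/-- The differential of the inverse chart of `End(E)`. -/
def dEndPt (q : EM × (F →L[ℝ] F)) :
    EM × (F →L[ℝ] F) →L[ℝ] TangentSpace (endModel EM F) (endPt F E x₀ q) :=
  mfderiv 𝓘(ℝ, EM × (F →L[ℝ] F)) (endModel EM F) (endPt F E x₀) q

theorem dEndPt_injective (hq : q.1 ∈ coordDomain F E x₀) :
    Function.Injective (dEndPt F E x₀ q) := (isInvertible_mfderiv_endPt hq).injective

theorem dEndPt_surjective (hq : q.1 ∈ coordDomain F E x₀) :
    Function.Surjective (dEndPt F E x₀ q) := (isInvertible_mfderiv_endPt hq).surjective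

theorem dproj_dEndPt (hq : q.1 ∈ coordDomain F E x₀) (ξ : EM × (F →L[ℝ] F)) :
    dproj (endPt F E x₀ q) (dEndPt F E x₀ q ξ) = fromCoordT EM x₀ q.1 ξ.1 := by
  have h1 : MDifferentiableAt (endModel EM F) 𝓘(ℝ, EM) (TotalSpace.proj : EndTotal F E → M)
      (endPt F E x₀ q) := mdifferentiableAt_proj _
  have h2 := mfderiv_comp q h1 (mdifferentiableAt_endPt hq)
  have h3 : (TotalSpace.proj : EndTotal F E → M) ∘ endPt F E x₀ =
      (fun m' : EM ↦ coordPt x₀ m') ∘ (Prod.fst : EM × (F →L[ℝ] F) → EM) := rfl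
  have h4 := mfderiv_comp (I := 𝓘(ℝ, EM × (F →L[ℝ] F))) q (mdifferentiableAt_coordPt hq)
    (differentiableAt_fst (𝕜 := ℝ)).mdifferentiableAt
  rw [h3, h4, mfderiv_eq_fderiv, fderiv_fst] at h2
  exact (DFunLike.congr_fun h2 ξ).symm

theorem verticalLift_endPt (hq : q.1 ∈ coordDomain F E x₀) (A : F →L[ℝ] F) :
    verticalLift (EM := EM) (endPt F E x₀ q)
      (fromCoord F E x₀ q.1 ∘L A ∘L toCoord F E x₀ q.1) = dEndPt F E x₀ q (0, A) := by
  have h1 : (fun t : ℝ ↦ (⟨coordPt x₀ q.1,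
      fromCoord F E x₀ q.1 ∘L q.2 ∘L toCoord F E x₀ q.1 +
        t • (fromCoord F E x₀ q.1 ∘L A ∘L toCoord F E x₀ q.1)⟩ : EndTotal F E)) =
      endPt F E x₀ ∘ fun t : ℝ ↦ (q.1, q.2 + t • A) := by
    funext t
    simp only [endPt, Function.comp, ContinuousLinearMap.add_comp, ContinuousLinearMap.comp_add,
      ContinuousLinearMap.smul_comp, ContinuousLinearMap.comp_smul]
  have h2 : HasFDerivAt (fun t : ℝ ↦ (q.1, q.2 + t • A))
      (ContinuousLinearMap.toSpanSingleton ℝ ((0, A) : EM × (F →L[ℝ] F))) 0 := by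
    have : HasDerivAt (fun t : ℝ ↦ (q.1, q.2 + t • A)) ((0, A) : EM × (F →L[ℝ] F)) 0 := by
      refine (hasDerivAt_const _ _).prodMk ?_
      simpa using ((hasDerivAt_id (0 : ℝ)).smul_const A).const_add q.2
    exact this.hasFDerivAt
  have h3 : MDifferentiableAt 𝓘(ℝ, EM × (F →L[ℝ] F)) (endModel EM F) (endPt F E x₀)
      ((fun t : ℝ ↦ (q.1, q.2 + t • A)) 0) := by
    simpa using mdifferentiableAt_endPt hq
  have h4 := mfderiv_comp (I := 𝓘(ℝ, ℝ)) (0 : ℝ) h3 h2.differentiableAt.mdifferentiableAt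
  rw [← h1, mfderiv_eq_fderiv, h2.fderiv] at h4
  -- The curve passes at $t=0$ through $q_2+0\cdot A$, equal to $q_2$ only propositionally; `h5`
  -- transports the differential between the two base points.
  have h5 : ∀ q', q' = q → ∀ η ξ : EM × (F →L[ℝ] F), η = ξ →
      (mfderiv 𝓘(ℝ, EM × (F →L[ℝ] F)) (endModel EM F) (endPt F E x₀) q' :
        EM × (F →L[ℝ] F) →L[ℝ] EM × (F →L[ℝ] F)) η = dEndPt F E x₀ q ξ := by
    rintro _ rfl _ _ rfl
    rfl
  refine (DFunLike.congr_fun h4 (1 : ℝ)).trans (h5 _ (by simp) _ _ ?_)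
  exact one_smul ℝ ((0, A) : EM × (F →L[ℝ] F))

end

end Coordinates

set_option linter.unusedSectionVars false

/-! ### Sections of $E$ and $\mathrm{End}(E)$ in coordinates; the flat connection of a
trivialization. -/

section CoordinateSections

variable {EM : Type*} [NormedAddCommGroup EM] [NormedSpace ℝ EM]
  {M : Type*} [TopologicalSpace M] [ChartedSpace EM M]
  {F : Type*} [NormedAddCommGroup F] [NormedSpace ℝ F]
  {E : M → Type*} [TopologicalSpace (TotalSpace F E)]
  [∀ x, AddCommGroup (E x)] [∀ x, Module ℝ (E x)] [∀ x, TopologicalSpace (E x)]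
  [∀ x, IsTopologicalAddGroup (E x)] [∀ x, ContinuousSMul ℝ (E x)]
  [FiberBundle F E] [VectorBundle ℝ F E] {x₀ : M} {m : EM}

variable (F x₀) in
/-- A section of `E`, read in the trivialization around `x₀`. -/
def trivSec (σ : ∀ y : M, E y) (y : M) : F :=
  (trivializationAt F E x₀).continuousLinearMapAt ℝ y (σ y)

variable (F x₀) in
/-- A section of `End(E)`, read in the trivialization around `x₀`. -/
def trivEnd (A : ∀ y : M, E y →L[ℝ] E y) (y : M) : F →L[ℝ] F :=
  (trivializationAt F E x₀).continuousLinearMapAt ℝ y ∘L A y ∘L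
    (trivializationAt F E x₀).symmL ℝ y

variable (F x₀) in
/-- A section of `E`, in coordinates around `x₀`. -/
def coordSec (σ : ∀ y : M, E y) (m : EM) : F := trivSec F x₀ σ (coordPt x₀ m)

variable (F x₀) in
/-- A section of `End(E)`, in coordinates around `x₀`. -/
def coordEnd (A : ∀ y : M, E y →L[ℝ] E y) (m : EM) : F →L[ℝ] F := trivEnd F x₀ A (coordPt x₀ m)

variable (E x₀) in
/-- The section of `E` with given coordinate expression. -/
def secOf (s : EM → F) (y : M) : E y :=
  (trivializationAt F E x₀).symmL ℝ y (s (extChartAt 𝓘(ℝ, EM) x₀ y))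

variable (E x₀) in
/-- The section of `End(E)` with given coordinate expression. -/
def endOf (A : EM → F →L[ℝ] F) (y : M) : E y →L[ℝ] E y :=
  (trivializationAt F E x₀).symmL ℝ y ∘L A (extChartAt 𝓘(ℝ, EM) x₀ y) ∘L
    (trivializationAt F E x₀).continuousLinearMapAt ℝ y

theorem coordSec_apply (σ : ∀ y : M, E y) (m : EM) :
    coordSec F x₀ σ m = toCoord F E x₀ m (σ (coordPt x₀ m)) := rfl

theorem coordEnd_apply (A : ∀ y : M, E y →L[ℝ] E y) (m : EM) (f : F) :
    coordEnd F x₀ A m f = toCoord F E x₀ m (A (coordPt x₀ m) (fromCoord F E x₀ m f)) := rfl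

theorem fromCoord_coordSec (hm : m ∈ coordDomain F E x₀) (σ : ∀ y : M, E y) :
    fromCoord F E x₀ m (coordSec F x₀ σ m) = σ (coordPt x₀ m) := fromCoord_toCoord hm _

theorem coordSec_secOf (hm : m ∈ coordDomain F E x₀) (s : EM → F) :
    coordSec F x₀ (secOf E x₀ s) m = s m := by
  refine (toCoord_fromCoord hm _).trans ?_
  rw [extChartAt_coordPt hm]

theorem coordEnd_endOf (hm : m ∈ coordDomain F E x₀) (A : EM → F →L[ℝ] F) :
    coordEnd F x₀ (endOf E x₀ A) m = A m := by
  ext f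
  refine (toCoord_fromCoord hm _).trans ?_
  rw [extChartAt_coordPt hm]
  exact congrArg _ (toCoord_fromCoord hm f)

theorem endPt_coordEnd (hm : m ∈ coordDomain F E x₀) (A : ∀ y : M, E y →L[ℝ] E y) :
    endPt F E x₀ (m, coordEnd F x₀ A m) = endSection F E A (coordPt x₀ m) := by
  have h : fromCoord F E x₀ m ∘L coordEnd F x₀ A m ∘L toCoord F E x₀ m = A (coordPt x₀ m) := by
    refine ContinuousLinearMap.ext fun v ↦ ?_
    simp only [ContinuousLinearMap.comp_apply, coordEnd_apply, fromCoord_toCoord hm]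
  simp only [endPt, endSection, h]

theorem coordSec_end_apply (hm : m ∈ coordDomain F E x₀) (A : ∀ y : M, E y →L[ℝ] E y)
    (σ : ∀ y : M, E y) :
    coordSec F x₀ (fun y ↦ A y (σ y)) m = coordEnd F x₀ A m (coordSec F x₀ σ m) := by
  rw [coordEnd_apply, fromCoord_coordSec hm, coordSec_apply]

section Smooth

variable [IsManifold 𝓘(ℝ, EM) ∞ M]

theorem differentiableAt_comp_coordPt_iff {G : Type*} [NormedAddCommGroup G] [NormedSpace ℝ G]
    (hm : m ∈ coordDomain F E x₀) {f : M → G} :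
    DifferentiableAt ℝ (fun m' ↦ f (coordPt x₀ m')) m ↔
      MDifferentiableAt 𝓘(ℝ, EM) 𝓘(ℝ, G) f (coordPt x₀ m) := by
  rw [← mdifferentiableAt_iff_differentiableAt]
  refine ⟨fun h ↦ ?_, fun h ↦ h.comp m (mdifferentiableAt_coordPt hm)⟩
  have h1 : MDifferentiableAt 𝓘(ℝ, EM) 𝓘(ℝ, EM) (extChartAt 𝓘(ℝ, EM) x₀) (coordPt x₀ m) :=
    mdifferentiableAt_extChartAt (mem_source hm)
  rw [← extChartAt_coordPt hm] at h
  refine (h.comp _ h1).congr_of_eventuallyEq ?_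
  filter_upwards [extChartAt_source_mem_nhds' (I := 𝓘(ℝ, EM))
    ((extChartAt 𝓘(ℝ, EM) x₀).map_target hm.1)] with y hy
  simp only [Function.comp, coordPt, (extChartAt 𝓘(ℝ, EM) x₀).left_inv hy]

variable [ContMDiffVectorBundle ∞ F E 𝓘(ℝ, EM)]

theorem mdifferentiableAt_sec_iff_trivSec {x : M} (hx : x ∈ (trivializationAt F E x₀).baseSet)
    {σ : ∀ y : M, E y} :
    MDifferentiableAt 𝓘(ℝ, EM) (𝓘(ℝ, EM).prod 𝓘(ℝ, F)) (bundleSection F E σ) x ↔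
      MDifferentiableAt 𝓘(ℝ, EM) 𝓘(ℝ, F) (trivSec F x₀ σ) x := by
  refine ((trivializationAt F E x₀).mdifferentiableAt_section_iff 𝓘(ℝ, EM) σ hx).trans
    (EventuallyEq.mdifferentiableAt_iff ?_)
  filter_upwards [(trivializationAt F E x₀).open_baseSet.mem_nhds hx] with y hy
  exact (Trivialization.continuousLinearMapAt_apply_of_mem (R := ℝ) _ hy (σ y)).symm

theorem mdifferentiableAt_sec_iff (hm : m ∈ coordDomain F E x₀) {σ : ∀ y : M, E y} :
    MDifferentiableAt 𝓘(ℝ, EM) (𝓘(ℝ, EM).prod 𝓘(ℝ, F)) (bundleSection F E σ) (coordPt x₀ m) ↔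
      DifferentiableAt ℝ (coordSec F x₀ σ) m :=
  (mdifferentiableAt_sec_iff_trivSec hm.2).trans (differentiableAt_comp_coordPt_iff hm).symm

theorem mdifferentiableAt_end_iff (hm : m ∈ coordDomain F E x₀) {A : ∀ y : M, E y →L[ℝ] E y} :
    MDifferentiableAt 𝓘(ℝ, EM) (endModel EM F) (endSection F E A) (coordPt x₀ m) ↔
      DifferentiableAt ℝ (coordEnd F x₀ A) m := by
  refine Iff.trans ?_ (differentiableAt_comp_coordPt_iff hm).symm
  exact (trivializationAt (F →L[ℝ] F) (fun x : M ↦ E x →L[ℝ] E x) x₀).mdifferentiableAt_section_iff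
    𝓘(ℝ, EM) A ⟨hm.2, hm.2⟩

theorem mfderiv_endSection (hm : m ∈ coordDomain F E x₀) {A : ∀ y : M, E y →L[ℝ] E y}
    (hA : DifferentiableAt ℝ (coordEnd F x₀ A) m) (u : EM) :
    (mfderiv 𝓘(ℝ, EM) (endModel EM F) (endSection F E A) (coordPt x₀ m) :
      EM →L[ℝ] EM × (F →L[ℝ] F)) (fromCoordT EM x₀ m u) =
      dEndPt F E x₀ (m, coordEnd F x₀ A m) (u, fderiv ℝ (coordEnd F x₀ A) m u) := by
  have h1 : endSection F E A ∘ (fun m' : EM ↦ coordPt x₀ m') =ᶠ[𝓝 m]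
      endPt F E x₀ ∘ fun m' ↦ (m', coordEnd F x₀ A m') := by
    filter_upwards [isOpen_coordDomain.mem_nhds hm] with m' hm'
    exact (endPt_coordEnd hm' A).symm
  have h2 : HasFDerivAt (fun m' ↦ (m', coordEnd F x₀ A m'))
      ((ContinuousLinearMap.id ℝ EM).prod (fderiv ℝ (coordEnd F x₀ A) m)) m :=
    (hasFDerivAt_id m).prodMk hA.hasFDerivAt
  have h3 := mfderiv_comp (I' := 𝓘(ℝ, EM × (F →L[ℝ] F))) m
    (mdifferentiableAt_endPt (q := (m, coordEnd F x₀ A m)) hm)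
    h2.differentiableAt.mdifferentiableAt
  have h4 := mfderiv_comp m ((mdifferentiableAt_end_iff hm).2 hA) (mdifferentiableAt_coordPt hm)
  rw [mfderiv_eq_fderiv, h2.fderiv, ← h1.mfderiv_eq] at h3
  exact DFunLike.congr_fun (h4.symm.trans h3) u

/-- The flat connection determined by the trivialization. -/
def flatConnection (F : Type*) [NormedAddCommGroup F] [NormedSpace ℝ F]
    {E : M → Type*} [TopologicalSpace (TotalSpace F E)]
    [∀ x, AddCommGroup (E x)] [∀ x, Module ℝ (E x)] [∀ x, TopologicalSpace (E x)]
    [FiberBundle F E] [VectorBundle ℝ F E] (x₀ : M) (σ : ∀ y : M, E y) (x : M) :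
    TangentSpace 𝓘(ℝ, EM) x →L[ℝ] E x :=
  (trivializationAt F E x₀).symmL ℝ x ∘L mvfderiv 𝓘(ℝ, EM) (trivSec F x₀ σ) x

theorem isCovariantDerivativeOn_flatConnection : IsCovariantDerivativeOn (I := 𝓘(ℝ, EM)) F
    (flatConnection F x₀ : (∀ y : M, E y) → _) (trivializationAt F E x₀).baseSet where
  add {σ σ' x} hσ hσ' hx := by
    rw [mdifferentiableAt_sec_iff_trivSec hx] at hσ hσ'
    have h : trivSec F x₀ (σ + σ') = trivSec F x₀ σ + trivSec F x₀ σ' := by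
      funext y
      exact map_add _ _ _
    rw [flatConnection, h, mvfderiv_add hσ hσ', ContinuousLinearMap.comp_add]
    rfl
  leibniz {σ g x} hσ hg hx := by
    rw [mdifferentiableAt_sec_iff_trivSec hx] at hσ
    have h : trivSec F x₀ (g • σ) = g • trivSec F x₀ σ := by
      funext y
      exact map_smul _ _ _
    rw [flatConnection, h, mvfderiv_smul hg hσ]
    refine ContinuousLinearMap.ext fun v ↦ ?_
    simp only [ContinuousLinearMap.comp_apply, add_apply, smul_apply, map_add, map_smul,
      ContinuousLinearMap.smulRight_apply, flatConnection]
    congr 2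
    exact (trivializationAt F E x₀).symmL_continuousLinearMapAt hx _

theorem flatConnection_apply (hm : m ∈ coordDomain F E x₀) {σ : ∀ y : M, E y}
    (hσ : DifferentiableAt ℝ (coordSec F x₀ σ) m) (u : EM) :
    flatConnection F x₀ σ (coordPt x₀ m) (fromCoordT EM x₀ m u) =
      fromCoord F E x₀ m (fderiv ℝ (coordSec F x₀ σ) m u) := by
  have h1 := mfderiv_comp m ((differentiableAt_comp_coordPt_iff hm).1 hσ)
    (mdifferentiableAt_coordPt hm)
  have h2 : trivSec F x₀ σ ∘ (fun m' : EM ↦ coordPt x₀ m') = coordSec F x₀ σ := rfl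
  rw [h2, mfderiv_eq_fderiv] at h1
  rw [h1]
  rfl

end Smooth

end CoordinateSections

/-! ### The connection form and the horizontal subspaces. -/

section ConnectionForm

variable {EM : Type*} [NormedAddCommGroup EM] [NormedSpace ℝ EM] [FiniteDimensional ℝ EM]
  {M : Type*} [TopologicalSpace M] [ChartedSpace EM M]
  {F : Type*} [NormedAddCommGroup F] [NormedSpace ℝ F] [FiniteDimensional ℝ F]
  {E : M → Type*} [TopologicalSpace (TotalSpace F E)]
  [∀ x, AddCommGroup (E x)] [∀ x, Module ℝ (E x)] [∀ x, TopologicalSpace (E x)]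
  [∀ x, IsTopologicalAddGroup (E x)] [∀ x, ContinuousSMul ℝ (E x)]
  [FiberBundle F E] [VectorBundle ℝ F E] {x₀ : M} {m : EM}
  [IsManifold 𝓘(ℝ, EM) ∞ M] [ContMDiffVectorBundle ∞ F E 𝓘(ℝ, EM)]
  (nabla : CovariantDerivative 𝓘(ℝ, EM) F E)

/-- The difference of a connection and of the flat connection of a trivialization. -/
def flatDifference (x₀ x : M) : E x →L[ℝ] TangentSpace 𝓘(ℝ, EM) x →L[ℝ] E x :=
  IsCovariantDerivativeOn.difference (s := (trivializationAt F E x₀).baseSet)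
    nabla.isCovariantDerivativeOn isCovariantDerivativeOn_flatConnection x

/-- The connection form in coordinates. -/
def connForm (x₀ : M) (m : EM) : EM →L[ℝ] F →L[ℝ] F :=
  LinearMap.toContinuousLinearMap (LinearMap.toContinuousLinearMap.toLinearMap ∘ₗ
    LinearMap.mk₂ ℝ (fun (u : EM) (f : F) ↦ toCoord F E x₀ m
      (flatDifference nabla x₀ (coordPt x₀ m) (fromCoord F E x₀ m f) (fromCoordT EM x₀ m u)))
      (fun u u' f ↦ by simp only [map_add]) (fun c u f ↦ by simp only [map_smul])
      (fun u f f' ↦ by simp only [map_add, add_apply])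
      (fun c u f ↦ by simp only [map_smul, smul_apply]))

variable {nabla}

theorem connForm_apply (u : EM) (f : F) : connForm nabla x₀ m u f = toCoord F E x₀ m
    (flatDifference nabla x₀ (coordPt x₀ m) (fromCoord F E x₀ m f) (fromCoordT EM x₀ m u)) := rfl

/-- The difference of $\nabla$ and the flat connection is tensorial, hence depends only on the value
of the section at the point. -/
theorem nabla_eq (hm : m ∈ coordDomain F E x₀) {σ : ∀ y : M, E y}
    (hσ : DifferentiableAt ℝ (coordSec F x₀ σ) m) (u : EM) :
    nabla σ (coordPt x₀ m) (fromCoordT EM x₀ m u) = fromCoord F E x₀ m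
      (fderiv ℝ (coordSec F x₀ σ) m u + connForm nabla x₀ m u (coordSec F x₀ σ m)) := by
  have h1 := IsCovariantDerivativeOn.difference_apply (s := (trivializationAt F E x₀).baseSet)
    nabla.isCovariantDerivativeOn isCovariantDerivativeOn_flatConnection hm.2
    ((mdifferentiableAt_sec_iff hm).2 hσ)
  rw [map_add, connForm_apply, fromCoord_toCoord hm, fromCoord_coordSec hm, flatDifference, h1,
    ← flatConnection_apply hm hσ, sub_apply, add_sub_cancel]

theorem nabla_end_apply (hm : m ∈ coordDomain F E x₀) {A : ∀ y : M, E y →L[ℝ] E y}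
    (hA : DifferentiableAt ℝ (coordEnd F x₀ A) m) {σ : ∀ y : M, E y}
    (hσ : DifferentiableAt ℝ (coordSec F x₀ σ) m) (u : EM) :
    nabla (fun y ↦ A y (σ y)) (coordPt x₀ m) (fromCoordT EM x₀ m u) -
        A (coordPt x₀ m) (nabla σ (coordPt x₀ m) (fromCoordT EM x₀ m u)) =
      fromCoord F E x₀ m ((fderiv ℝ (coordEnd F x₀ A) m u +
        (connForm nabla x₀ m u * coordEnd F x₀ A m - coordEnd F x₀ A m * connForm nabla x₀ m u))
          (coordSec F x₀ σ m)) := by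
  have h1 : coordSec F x₀ (fun y ↦ A y (σ y)) =ᶠ[𝓝 m]
      fun m' ↦ coordEnd F x₀ A m' (coordSec F x₀ σ m') := by
    filter_upwards [isOpen_coordDomain.mem_nhds hm] with m' hm' using coordSec_end_apply hm' A σ
  have h2 := hA.hasFDerivAt.clm_apply hσ.hasFDerivAt
  have h3 (f : F) : A (coordPt x₀ m) (fromCoord F E x₀ m f) =
      fromCoord F E x₀ m (coordEnd F x₀ A m f) := by
    rw [coordEnd_apply, fromCoord_toCoord hm]
  rw [nabla_eq hm (h2.differentiableAt.congr_of_eventuallyEq h1), nabla_eq hm hσ, h1.fderiv_eq,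
    h2.fderiv, coordSec_end_apply hm, h3, ← map_sub]
  congr 1
  have hmul (S T : F →L[ℝ] F) (v : F) : (S * T) v = S (T v) := rfl
  simp only [add_apply, sub_apply, hmul, ContinuousLinearMap.comp_apply,
    ContinuousLinearMap.flip_apply, map_add]
  abel

/-- Testing against sections with constant coordinates turns the condition on all sections into one
equation for endomorphisms. -/
theorem isParallelAt_iff (hm : m ∈ coordDomain F E x₀) {A : ∀ y : M, E y →L[ℝ] E y}
    (hA : DifferentiableAt ℝ (coordEnd F x₀ A) m) (u : EM) :
    IsParallelAt nabla A (coordPt x₀ m) (fromCoordT EM x₀ m u) ↔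
      fderiv ℝ (coordEnd F x₀ A) m u +
        (connForm nabla x₀ m u * coordEnd F x₀ A m - coordEnd F x₀ A m * connForm nabla x₀ m u) =
        0 := by
  constructor
  · intro h
    ext f
    have h1 : coordSec F x₀ (secOf E x₀ fun _ : EM ↦ f) =ᶠ[𝓝 m] fun _ ↦ f := by
      filter_upwards [isOpen_coordDomain.mem_nhds hm] with m' hm' using coordSec_secOf hm' _
    have h2 : DifferentiableAt ℝ (coordSec F x₀ (secOf E x₀ fun _ : EM ↦ f)) m :=
      (differentiableAt_const f).congr_of_eventuallyEq h1
    have h3 := nabla_end_apply (nabla := nabla) hm hA h2 u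
    rw [sub_eq_zero.2 (h _ ((mdifferentiableAt_sec_iff hm).2 h2)), coordSec_secOf hm] at h3
    exact fromCoord_injective hm (h3.symm.trans (map_zero _).symm)
  · intro h σ hσ
    rw [← sub_eq_zero, nabla_end_apply hm hA ((mdifferentiableAt_sec_iff hm).1 hσ), h, zero_apply,
      map_zero]

/-- The equation is linear in $\xi$, so it passes from generators to their span; conversely, every
solution is itself a generator. -/
theorem dEndPt_mem_horizontal_iff {q : EM × (F →L[ℝ] F)} (hq : q.1 ∈ coordDomain F E x₀)
    (ξ : EM × (F →L[ℝ] F)) :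
    dEndPt F E x₀ q ξ ∈ horizontal nabla (endPt F E x₀ q) ↔
      ξ.2 + (connForm nabla x₀ q.1 ξ.1 * q.2 - q.2 * connForm nabla x₀ q.1 ξ.1) = 0 := by
  constructor
  · intro h
    suffices H : ∀ ζ ∈ horizontal nabla (endPt F E x₀ q), ∃ ξ : EM × (F →L[ℝ] F),
        ζ = dEndPt F E x₀ q ξ ∧
        ξ.2 + (connForm nabla x₀ q.1 ξ.1 * q.2 - q.2 * connForm nabla x₀ q.1 ξ.1) = 0 by
      obtain ⟨ξ', h1, h2⟩ := H _ h
      rwa [dEndPt_injective hq h1]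
    intro ζ hζ
    induction hζ using Submodule.span_induction with
    | mem ζ hζ =>
      obtain ⟨A, v, hAq, hA, hp, rfl⟩ := hζ
      obtain ⟨u, rfl⟩ := fromCoordT_surjective hq v
      replace hA := (mdifferentiableAt_end_iff hq).1 hA
      have h1 : coordEnd F x₀ A q.1 = q.2 := by
        ext f
        have h2 : A (coordPt x₀ q.1) = fromCoord F E x₀ q.1 ∘L q.2 ∘L toCoord F E x₀ q.1 := hAq
        rw [coordEnd_apply, h2, ContinuousLinearMap.comp_apply, ContinuousLinearMap.comp_apply,
          toCoord_fromCoord hq, toCoord_fromCoord hq]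
      refine ⟨(u, fderiv ℝ (coordEnd F x₀ A) q.1 u), ?_, ?_⟩
      · have h2 := mfderiv_endSection hq hA u
        rw [h1] at h2
        exact h2
      · rw [← (isParallelAt_iff hq hA u).1 hp, h1]
    | zero => exact ⟨0, (ContinuousLinearMap.map_zero _).symm, by simp⟩
    | add x y _ _ hx hy =>
      obtain ⟨ξ, rfl, h1⟩ := hx
      obtain ⟨η, rfl, h2⟩ := hy
      refine ⟨ξ + η, (ContinuousLinearMap.map_add _ _ _).symm, ?_⟩
      rw [← add_zero (0 : F →L[ℝ] F)]
      nth_rw 1 [← h1, ← h2]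
      simp only [Prod.fst_add, Prod.snd_add, map_add, add_mul, mul_add]
      abel
    | smul c x _ hx =>
      obtain ⟨ξ, rfl, h1⟩ := hx
      refine ⟨c • ξ, (ContinuousLinearMap.map_smul _ _ _).symm, ?_⟩
      rw [← smul_zero c, ← h1]
      simp only [Prod.smul_fst, Prod.smul_snd, map_smul, smul_mul_assoc, mul_smul_comm, smul_add,
        smul_sub]
  · intro h
    -- The affine section $q_2+B(\cdot-q_1)$ passes through $q$ and, by the choice of $B$, has zero
    -- covariant derivative there.
    obtain ⟨B, hB⟩ : ∃ B : EM →L[ℝ] F →L[ℝ] F,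
        ∀ u, B u = q.2 * connForm nabla x₀ q.1 u - connForm nabla x₀ q.1 u * q.2 :=
      ⟨ContinuousLinearMap.mul ℝ (F →L[ℝ] F) q.2 ∘L connForm nabla x₀ q.1 -
        (ContinuousLinearMap.mul ℝ (F →L[ℝ] F)).flip q.2 ∘L connForm nabla x₀ q.1, fun u ↦ rfl⟩
    set Ã : EM → F →L[ℝ] F := fun m' ↦ q.2 + B (m' - q.1)
    have h0 : Ã q.1 = q.2 := by simp [Ã]
    have h1 : HasFDerivAt Ã B q.1 :=
      (B.hasFDerivAt.comp q.1 ((hasFDerivAt_id q.1).sub_const q.1)).const_add q.2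
    have h2 : coordEnd F x₀ (endOf E x₀ Ã) =ᶠ[𝓝 q.1] Ã := by
      filter_upwards [isOpen_coordDomain.mem_nhds hq] with m' hm' using coordEnd_endOf hm' _
    have h3 := h1.congr_of_eventuallyEq h2
    have h4 : coordEnd F x₀ (endOf E x₀ Ã) q.1 = q.2 := by rw [coordEnd_endOf hq, h0]
    have h5 := mfderiv_endSection hq h3.differentiableAt ξ.1
    have h6 : B ξ.1 = ξ.2 := by
      rw [hB, ← sub_eq_zero, ← neg_eq_zero, ← h]
      abel
    rw [h3.fderiv, h4, h6] at h5
    refine Submodule.subset_span ⟨endOf E x₀ Ã, fromCoordT EM x₀ q.1 ξ.1, ?_,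
      (mdifferentiableAt_end_iff hq).2 h3.differentiableAt,
      (isParallelAt_iff hq h3.differentiableAt ξ.1).2 ?_, h5.symm⟩
    · have h7 : Ã (extChartAt 𝓘(ℝ, EM) x₀ (coordPt x₀ q.1)) = q.2 := by
        rw [extChartAt_coordPt hq, h0]
      change (trivializationAt F E x₀).symmL ℝ _ ∘L Ã _ ∘L _ = _
      erw [h7]
      rfl
    · rw [h3.fderiv, h4, hB]
      abel

end ConnectionForm

set_option linter.unusedSectionVars false

/-! ### Smoothness of coordinate expressions. -/

section SmoothCoordinates

/-- A family of continuous linear maps is `C^n` at `x` if all its applications are. -/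
theorem contDiffAt_clm_apply {D V W : Type*} [NormedAddCommGroup D] [NormedSpace ℝ D]
    [NormedAddCommGroup V] [NormedSpace ℝ V] [FiniteDimensional ℝ V] [NormedAddCommGroup W]
    [NormedSpace ℝ W] {n : WithTop ℕ∞} {f : D → V →L[ℝ] W} {x : D}
    (h : ∀ v, ContDiffAt ℝ n (fun y ↦ f y v) x) : ContDiffAt ℝ n f x := by
  let e₁ : V ≃L[ℝ] (Fin (finrank ℝ V) → ℝ) :=
    ContinuousLinearEquiv.ofFinrankEq (finrank_fin_fun ℝ).symm
  let e₂ := (e₁.arrowCongr (1 : W ≃L[ℝ] W)).trans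
    (ContinuousLinearEquiv.piRing (Fin (finrank ℝ V)))
  rw [← Function.id_comp f, ← e₂.symm_comp_self]
  exact e₂.symm.contDiff.contDiffAt.comp x (contDiffAt_pi.mpr fun i ↦ h _)

variable {EM : Type*} [NormedAddCommGroup EM] [NormedSpace ℝ EM]
  {M : Type*} [TopologicalSpace M] [ChartedSpace EM M]
  {F : Type*} [NormedAddCommGroup F] [NormedSpace ℝ F]
  {E : M → Type*} [TopologicalSpace (TotalSpace F E)]
  [∀ x, AddCommGroup (E x)] [∀ x, Module ℝ (E x)] [∀ x, TopologicalSpace (E x)]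
  [∀ x, IsTopologicalAddGroup (E x)] [∀ x, ContinuousSMul ℝ (E x)]
  [FiberBundle F E] [VectorBundle ℝ F E] {x₀ : M} {m : EM}
  [IsManifold 𝓘(ℝ, EM) ∞ M]

omit [IsManifold 𝓘(ℝ, EM) ∞ M] in
theorem eventually_mem_coordDomain :
    ∀ᶠ m in 𝓝 (extChartAt 𝓘(ℝ, EM) x₀ x₀), m ∈ coordDomain F E x₀ :=
  isOpen_coordDomain.mem_nhds extChartAt_mem_coordDomain

theorem contDiffAt_comp_coordPt {G : Type*} [NormedAddCommGroup G] [NormedSpace ℝ G] {f : M → G}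
    (hf : ContMDiffAt 𝓘(ℝ, EM) 𝓘(ℝ, G) ∞ f x₀) :
    ContDiffAt ℝ ∞ (fun m ↦ f (coordPt x₀ m)) (extChartAt 𝓘(ℝ, EM) x₀ x₀) := by
  rw [← contMDiffAt_iff_contDiffAt]
  have h1 : ContMDiffAt 𝓘(ℝ, EM) 𝓘(ℝ, EM) ∞ (fun m' : EM ↦ coordPt x₀ m')
      (extChartAt 𝓘(ℝ, EM) x₀ x₀) :=
    (contMDiffOn_extChartAt_symm x₀).contMDiffAt (extChartAt_target_mem_nhds x₀)
  refine ContMDiffAt.comp _ (I' := 𝓘(ℝ, EM)) ?_ h1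
  rw [coordPt_extChartAt]
  exact hf

theorem contDiffAt_hom {F₁ F₂ : Type*} [NormedAddCommGroup F₁] [NormedSpace ℝ F₁]
    [NormedAddCommGroup F₂] [NormedSpace ℝ F₂] {E₁ E₂ : M → Type*}
    [TopologicalSpace (TotalSpace F₁ E₁)] [∀ x, AddCommGroup (E₁ x)] [∀ x, Module ℝ (E₁ x)]
    [∀ x, TopologicalSpace (E₁ x)] [FiberBundle F₁ E₁] [VectorBundle ℝ F₁ E₁]
    [TopologicalSpace (TotalSpace F₂ E₂)] [∀ x, AddCommGroup (E₂ x)] [∀ x, Module ℝ (E₂ x)]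
    [∀ x, TopologicalSpace (E₂ x)] [FiberBundle F₂ E₂] [VectorBundle ℝ F₂ E₂]
    [∀ x, IsTopologicalAddGroup (E₂ x)] [∀ x, ContinuousSMul ℝ (E₂ x)]
    {ψ : ∀ x : M, E₁ x →L[ℝ] E₂ x}
    (hψ : ContMDiffAt 𝓘(ℝ, EM) (𝓘(ℝ, EM).prod 𝓘(ℝ, F₁ →L[ℝ] F₂)) ∞
      (fun x ↦ (⟨x, ψ x⟩ : TotalSpace (F₁ →L[ℝ] F₂) (fun x : M ↦ E₁ x →L[ℝ] E₂ x))) x₀) :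
    ContDiffAt ℝ ∞ (fun m ↦ (trivializationAt F₂ E₂ x₀).continuousLinearMapAt ℝ (coordPt x₀ m) ∘L
      ψ (coordPt x₀ m) ∘L (trivializationAt F₁ E₁ x₀).symmL ℝ (coordPt x₀ m))
      (extChartAt 𝓘(ℝ, EM) x₀ x₀) :=
  contDiffAt_comp_coordPt ((contMDiffAt_hom_bundle _).1 hψ).2

theorem contDiffAt_coordEnd {A : ∀ x : M, E x →L[ℝ] E x}
    (hA : ContMDiffAt 𝓘(ℝ, EM) (endModel EM F) ∞ (endSection F E A) x₀) :
    ContDiffAt ℝ ∞ (coordEnd F x₀ A) (extChartAt 𝓘(ℝ, EM) x₀ x₀) :=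
  contDiffAt_hom hA

theorem contDiffAt_homT {ψ : ∀ x : M, TangentSpace 𝓘(ℝ, EM) x →L[ℝ] E x}
    (hψ : ContMDiffAt 𝓘(ℝ, EM) (𝓘(ℝ, EM).prod 𝓘(ℝ, EM →L[ℝ] F)) ∞
      (fun x ↦ (⟨x, ψ x⟩ :
        TotalSpace (EM →L[ℝ] F) (fun x : M ↦ TangentSpace 𝓘(ℝ, EM) x →L[ℝ] E x))) x₀) :
    ContDiffAt ℝ ∞ (fun m ↦ toCoord F E x₀ m ∘L ψ (coordPt x₀ m) ∘L fromCoordT EM x₀ m :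
      EM → EM →L[ℝ] F) (extChartAt 𝓘(ℝ, EM) x₀ x₀) := by
  refine (contDiffAt_hom hψ).congr_of_eventuallyEq ?_
  filter_upwards [eventually_mem_coordDomain (F := F) (E := E)] with m hm
  rw [fromCoordT_eq_symmL hm]
  rfl

variable [FiniteDimensional ℝ EM] [T2Space M] [ContMDiffVectorBundle ∞ F E 𝓘(ℝ, EM)]

/-- Global smooth sections which are constant in the trivialization around `x₀`. -/
theorem exists_section_coordSec_eq (x₀ : M) (f : F) : ∃ σ : ∀ y : M, E y,
    ContMDiff 𝓘(ℝ, EM) (𝓘(ℝ, EM).prod 𝓘(ℝ, F)) ∞ (bundleSection F E σ) ∧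
    ∀ᶠ m in 𝓝 (extChartAt 𝓘(ℝ, EM) x₀ x₀), coordSec F x₀ σ m = f := by
  set e := trivializationAt F E x₀
  obtain ⟨ψ, -, hψ⟩ := (SmoothBumpFunction.nhds_basis_tsupport (I := 𝓘(ℝ, EM)) x₀).mem_iff.1
    (e.open_baseSet.mem_nhds (mem_baseSet_trivializationAt F E x₀))
  have h1 : ContMDiffOn 𝓘(ℝ, EM) (𝓘(ℝ, EM).prod 𝓘(ℝ, F)) ∞
      (bundleSection F E fun y ↦ e.symmL ℝ y f) e.baseSet := by
    refine (e.contMDiffOn_section_baseSet_iff).2 ((contMDiffOn_const (c := f)).congr fun y hy ↦ ?_)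
    refine (Trivialization.continuousLinearMapAt_apply_of_mem (R := ℝ) e hy _).symm.trans ?_
    exact e.continuousLinearMapAt_symmL hy f
  refine ⟨(ψ : M → ℝ) • fun y ↦ e.symmL ℝ y f,
    ContMDiffOn.smul_section_of_tsupport ψ.contMDiff.contMDiffOn e.open_baseSet hψ h1, ?_⟩
  have h2 : ∀ᶠ y in 𝓝 x₀, trivSec F x₀ ((ψ : M → ℝ) • fun y ↦ e.symmL ℝ y f) y = f := by
    filter_upwards [ψ.eventuallyEq_one, e.open_baseSet.mem_nhds
      (mem_baseSet_trivializationAt F E x₀)] with y hy hye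
    rw [trivSec, Pi.smul_apply', hy, Pi.one_apply, one_smul]
    exact e.continuousLinearMapAt_symmL hye f
  have h3 := (continuousAt_extChartAt_symm (I := 𝓘(ℝ, EM)) x₀)
  rw [ContinuousAt, extChartAt_to_inv] at h3
  exact h3 h2

/-- Smoothness of `nabla` is applied to a global section, so the constant local section is first
extended by a bump function; near $x_0$ its covariant derivative is $\Gamma(u)f$. -/
theorem contDiffAt_connForm [FiniteDimensional ℝ F] (nabla : CovariantDerivative 𝓘(ℝ, EM) F E)
    [h : CovariantDerivative.ContMDiffCovariantDerivative nabla ∞] (x₀ : M) :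
    ContDiffAt ℝ ∞ (connForm nabla x₀) (extChartAt 𝓘(ℝ, EM) x₀ x₀) := by
  refine contDiffAt_clm_apply fun u ↦ contDiffAt_clm_apply fun f ↦ ?_
  obtain ⟨σ, hσ, hσf⟩ := exists_section_coordSec_eq (EM := EM) (E := E) x₀ f
  have h1 := h.contMDiff.contMDiff (σ := σ) (hσ.of_le (by simp)).contMDiffOn
  have h2 := contDiffAt_homT (h1.contMDiffAt (x := x₀) univ_mem)
  refine (h2.clm_apply (contDiffAt_const (c := u))).congr_of_eventuallyEq ?_
  filter_upwards [eventually_mem_coordDomain (F := F) (E := E), hσf.eventually_nhds] with m hm hσm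
  have h3 : coordSec F x₀ σ =ᶠ[𝓝 m] fun _ ↦ f := hσm
  have h4 : HasFDerivAt (coordSec F x₀ σ) (0 : EM →L[ℝ] F) m :=
    (hasFDerivAt_const f m).congr_of_eventuallyEq h3
  have h5 := nabla_eq (nabla := nabla) hm h4.differentiableAt u
  rw [h4.fderiv, zero_apply, zero_add, h3.self_of_nhds] at h5
  rw [ContinuousLinearMap.comp_apply, ContinuousLinearMap.comp_apply, h5, toCoord_fromCoord hm]

end SmoothCoordinates

set_option linter.unusedSectionVars false

/-! ### Transfer of the $f$-quaternionic structure to coordinates. -/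

section LocalModel

variable {EM : Type*} [NormedAddCommGroup EM] [NormedSpace ℝ EM]
  {M : Type*} [TopologicalSpace M] [ChartedSpace EM M]
  {F : Type*} [NormedAddCommGroup F] [NormedSpace ℝ F]
  {E : M → Type*} [TopologicalSpace (TotalSpace F E)]
  [∀ x, AddCommGroup (E x)] [∀ x, Module ℝ (E x)] [∀ x, TopologicalSpace (E x)]
  [∀ x, IsTopologicalAddGroup (E x)] [∀ x, ContinuousSMul ℝ (E x)]
  [FiberBundle F E] [VectorBundle ℝ F E] {x₀ : M} {m : EM}

variable (F E x₀) in
/-- The identification of the endomorphisms of a fibre with those of the model fibre. -/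
def coordLin (m : EM) :
    (E (coordPt x₀ m) →L[ℝ] E (coordPt x₀ m)) →ₗ[ℝ] F →L[ℝ] F where
  toFun T := toCoord F E x₀ m ∘L T ∘L fromCoord F E x₀ m
  map_add' _ _ := ContinuousLinearMap.ext fun _ ↦ map_add (toCoord F E x₀ m) _ _
  map_smul' _ _ := ContinuousLinearMap.ext fun _ ↦ map_smul (toCoord F E x₀ m) _ _

theorem coordEnd_eq_coordLin (A : ∀ y : M, E y →L[ℝ] E y) (m : EM) :
    coordEnd F x₀ A m = coordLin F E x₀ m (A (coordPt x₀ m)) := rfl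

theorem coordLin_apply (T : E (coordPt x₀ m) →L[ℝ] E (coordPt x₀ m)) (f : F) :
    coordLin F E x₀ m T f = toCoord F E x₀ m (T (fromCoord F E x₀ m f)) := rfl

section

variable (hm : m ∈ coordDomain F E x₀)
include hm

theorem coordLin_mul (S T : E (coordPt x₀ m) →L[ℝ] E (coordPt x₀ m)) :
    coordLin F E x₀ m (S ∘L T) = coordLin F E x₀ m S * coordLin F E x₀ m T := by
  refine ContinuousLinearMap.ext fun f ↦ ?_
  change _ = coordLin F E x₀ m S (coordLin F E x₀ m T f)
  rw [coordLin_apply, coordLin_apply, coordLin_apply, fromCoord_toCoord hm]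
  rfl

theorem coordLin_neg_id :
    coordLin F E x₀ m (-ContinuousLinearMap.id ℝ (E (coordPt x₀ m))) = -1 := by
  rw [map_neg]
  congr 1
  exact ContinuousLinearMap.ext fun f ↦ toCoord_fromCoord hm f

theorem fromCoord_comp_coordLin (T : E (coordPt x₀ m) →L[ℝ] E (coordPt x₀ m)) :
    fromCoord F E x₀ m ∘L coordLin F E x₀ m T ∘L toCoord F E x₀ m = T := by
  refine ContinuousLinearMap.ext fun v ↦ ?_
  rw [ContinuousLinearMap.comp_apply, ContinuousLinearMap.comp_apply, coordLin_apply,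
    fromCoord_toCoord hm, fromCoord_toCoord hm]

theorem coordLin_fromCoord_comp (A : F →L[ℝ] F) :
    coordLin F E x₀ m (fromCoord F E x₀ m ∘L A ∘L toCoord F E x₀ m) = A := by
  refine ContinuousLinearMap.ext fun v ↦ ?_
  rw [coordLin_apply, ContinuousLinearMap.comp_apply, ContinuousLinearMap.comp_apply,
    toCoord_fromCoord hm, toCoord_fromCoord hm]

theorem coordLin_injective : Function.Injective (coordLin F E x₀ m) :=
  Function.LeftInverse.injective (g := fun A ↦ fromCoord F E x₀ m ∘L A ∘L toCoord F E x₀ m)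
    (fromCoord_comp_coordLin hm)

end

theorem coordLin_mem_span_iff (hm : m ∈ coordDomain F E x₀)
    {T I J K : E (coordPt x₀ m) →L[ℝ] E (coordPt x₀ m)} :
    coordLin F E x₀ m T ∈ Submodule.span ℝ
      {coordLin F E x₀ m I, coordLin F E x₀ m J, coordLin F E x₀ m K} ↔
      T ∈ Submodule.span ℝ {I, J, K} := by
  have h : Submodule.span ℝ {coordLin F E x₀ m I, coordLin F E x₀ m J, coordLin F E x₀ m K} =
      (Submodule.span ℝ {I, J, K}).map (coordLin F E x₀ m) := by
    rw [Submodule.map_span, Set.image_insert_eq, Set.image_insert_eq, Set.image_singleton]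
  rw [h]
  refine ⟨fun ⟨T', hT', hT⟩ ↦ ?_, Submodule.mem_map_of_mem⟩
  rwa [← coordLin_injective hm hT]

variable [IsManifold 𝓘(ℝ, EM) ∞ M] [ContMDiffVectorBundle ∞ F E 𝓘(ℝ, EM)]
  [FiniteDimensional ℝ EM] [FiniteDimensional ℝ F] {nabla : CovariantDerivative 𝓘(ℝ, EM) F E}

theorem QuaternionicStructure.IsCompatible.exists_coordLin_eq
    {𝒬 : QuaternionicStructure (EM := EM) F E} (h𝒬 : 𝒬.IsCompatible nabla)
    (hm : m ∈ coordDomain F E x₀) {A : ∀ y : M, E y →L[ℝ] E y}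
    (hA : DifferentiableAt ℝ (coordEnd F x₀ A) m)
    (hAQ : ∀ᶠ y in 𝓝 (coordPt x₀ m), A y ∈ 𝒬.Q y) (u : EM) :
    ∃ B ∈ 𝒬.Q (coordPt x₀ m), fderiv ℝ (coordEnd F x₀ A) m u +
      (connForm nabla x₀ m u * coordEnd F x₀ A m - coordEnd F x₀ A m * connForm nabla x₀ m u) =
        coordLin F E x₀ m B := by
  obtain ⟨B, hB, h⟩ := h𝒬 _ A ((mdifferentiableAt_end_iff hm).2 hA) hAQ (fromCoordT EM x₀ m u)
  refine ⟨B, hB, ContinuousLinearMap.ext fun f ↦ ?_⟩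
  have h1 : coordSec F x₀ (secOf E x₀ fun _ : EM ↦ f) =ᶠ[𝓝 m] fun _ ↦ f := by
    filter_upwards [isOpen_coordDomain.mem_nhds hm] with m' hm' using coordSec_secOf hm' _
  have h2 : DifferentiableAt ℝ (coordSec F x₀ (secOf E x₀ fun _ : EM ↦ f)) m :=
    (differentiableAt_const f).congr_of_eventuallyEq h1
  have h3 := nabla_end_apply (nabla := nabla) hm hA h2 u
  rw [h _ ((mdifferentiableAt_sec_iff hm).2 h2), h1.self_of_nhds,
    ← fromCoord_coordSec hm (secOf E x₀ fun _ : EM ↦ f), h1.self_of_nhds] at h3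
  rw [coordLin_apply, h3, toCoord_fromCoord hm]

namespace AlmostFQuaternionicStructure

variable (S : AlmostFQuaternionicStructure EM F E)

/-- The projection `E → TM`, as an endomorphism of `E`. -/
def proj (x : M) : E x →L[ℝ] E x := S.ι x ∘L S.ρ x

/-- The inclusion `TM → E`, in coordinates. -/
def coordι (x₀ : M) (m : EM) : EM →L[ℝ] F :=
  toCoord F E x₀ m ∘L S.ι (coordPt x₀ m) ∘L fromCoordT EM x₀ m

/-- The projection `E → TM`, in coordinates. -/
def coordρ (x₀ : M) (m : EM) : F →L[ℝ] EM :=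
  (trivializationAt EM (TangentSpace 𝓘(ℝ, EM) : M → Type _) x₀).continuousLinearMapAt ℝ
    (coordPt x₀ m) ∘L S.ρ (coordPt x₀ m) ∘L fromCoord F E x₀ m

variable {S}

theorem fromCoordT_toCoordT (hm : m ∈ coordDomain F E x₀)
    (v : TangentSpace 𝓘(ℝ, EM) (coordPt x₀ m)) :
    fromCoordT EM x₀ m
      ((trivializationAt EM (TangentSpace 𝓘(ℝ, EM) : M → Type _) x₀).continuousLinearMapAt ℝ
        (coordPt x₀ m) v) = v := by
  rw [← fromCoordT_eq_symmL hm]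
  exact (trivializationAt EM (TangentSpace 𝓘(ℝ, EM) : M → Type _) x₀).symmL_continuousLinearMapAt
    (mem_source hm) v

theorem fromCoord_coordι (hm : m ∈ coordDomain F E x₀) (u : EM) :
    fromCoord F E x₀ m (S.coordι x₀ m u) = S.ι (coordPt x₀ m) (fromCoordT EM x₀ m u) :=
  fromCoord_toCoord hm _

theorem fromCoordT_coordρ (hm : m ∈ coordDomain F E x₀) (f : F) :
    fromCoordT EM x₀ m (S.coordρ x₀ m f) = S.ρ (coordPt x₀ m) (fromCoord F E x₀ m f) :=
  fromCoordT_toCoordT hm _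

theorem coordρ_coordι (hm : m ∈ coordDomain F E x₀) (u : EM) :
    S.coordρ x₀ m (S.coordι x₀ m u) = u := by
  refine fromCoordT_injective hm ?_
  rw [fromCoordT_coordρ hm, fromCoord_coordι hm, S.ρ_ι]

theorem coordι_coordρ (hm : m ∈ coordDomain F E x₀) (f : F) :
    S.coordι x₀ m (S.coordρ x₀ m f) = coordEnd F x₀ S.proj m f := by
  refine fromCoord_injective hm ?_
  rw [fromCoord_coordι hm, fromCoordT_coordρ hm, coordEnd_apply, fromCoord_toCoord hm]
  rfl

theorem contDiffAt_coordι :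
    ContDiffAt ℝ ∞ (S.coordι x₀) (extChartAt 𝓘(ℝ, EM) x₀ x₀) :=
  contDiffAt_homT S.contMDiff_ι.contMDiffAt

theorem contDiffAt_coordρ :
    ContDiffAt ℝ ∞ (S.coordρ x₀) (extChartAt 𝓘(ℝ, EM) x₀ x₀) :=
  contDiffAt_hom S.contMDiff_ρ.contMDiffAt

theorem contDiffAt_coordEnd_proj :
    ContDiffAt ℝ ∞ (coordEnd F x₀ S.proj) (extChartAt 𝓘(ℝ, EM) x₀ x₀) := by
  have h1 : ContDiffAt ℝ ∞ (S.coordι x₀) (extChartAt 𝓘(ℝ, EM) x₀ x₀) := contDiffAt_coordι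
  refine (h1.clm_comp (contDiffAt_coordρ (S := S))).congr_of_eventuallyEq ?_
  filter_upwards [eventually_mem_coordDomain (F := F) (E := E)] with m hm
  exact ContinuousLinearMap.ext fun f ↦ (coordι_coordρ (S := S) hm f).symm

/-- Split $\sigma$ into $P\sigma$ and $\sigma-P\sigma$: $\nabla$ keeps the first in $TM$ and the
second in $V$, so $P\nabla\sigma=\nabla(P\sigma)$. -/
theorem IsCompatible.parallel_proj (h : S.IsCompatible nabla) (hm : m ∈ coordDomain F E x₀)
    (hP : DifferentiableAt ℝ (coordEnd F x₀ S.proj) m) (u : EM) :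
    fderiv ℝ (coordEnd F x₀ S.proj) m u +
      (connForm nabla x₀ m u * coordEnd F x₀ S.proj m -
        coordEnd F x₀ S.proj m * connForm nabla x₀ m u) = 0 := by
  refine (isParallelAt_iff hm hP u).1 fun σ hσ ↦ ?_
  have h1 : coordSec F x₀ (fun y ↦ S.proj y (σ y)) =ᶠ[𝓝 m]
      fun m' ↦ coordEnd F x₀ S.proj m' (coordSec F x₀ σ m') := by
    filter_upwards [isOpen_coordDomain.mem_nhds hm] with m' hm' using coordSec_end_apply hm' _ σ
  have hσ' := (mdifferentiableAt_sec_iff hm).1 hσ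
  have h2 : DifferentiableAt ℝ (coordSec F x₀ (fun y ↦ S.proj y (σ y))) m :=
    (hP.clm_apply hσ').congr_of_eventuallyEq h1
  have h3 : (coordSec F x₀ (fun y ↦ σ y - S.proj y (σ y)) : EM → F) =
      coordSec F x₀ σ - coordSec F x₀ (fun y ↦ S.proj y (σ y)) := by
    funext m'
    exact map_sub (toCoord F E x₀ m') _ _
  have h4 : DifferentiableAt ℝ (coordSec F x₀ (fun y ↦ σ y - S.proj y (σ y))) m := by
    rw [h3]
    exact hσ'.sub h2
  have h5 := (mdifferentiableAt_sec_iff hm).2 h2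
  have h6 := (mdifferentiableAt_sec_iff hm).2 h4
  have h7 : nabla σ (coordPt x₀ m) = nabla (fun y ↦ S.proj y (σ y)) (coordPt x₀ m) +
      nabla (fun y ↦ σ y - S.proj y (σ y)) (coordPt x₀ m) := by
    rw [← nabla.isCovariantDerivativeOnUniv.add h5 h6]
    congr 1
    funext y
    exact (add_sub_cancel _ _).symm
  obtain ⟨w, hw⟩ := h.preserves_TM _ _ h5 (Eventually.of_forall fun y ↦ ⟨S.ρ y (σ y), rfl⟩)
    (fromCoordT EM x₀ m u)
  have h8 : S.ρ (coordPt x₀ m)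
      (nabla (fun y ↦ σ y - S.proj y (σ y)) (coordPt x₀ m) (fromCoordT EM x₀ m u)) = 0 :=
    h.preserves_V _ _ h6 (Eventually.of_forall fun y ↦ by
      change S.ρ y (σ y - S.ι y (S.ρ y (σ y))) = 0
      rw [map_sub, S.ρ_ι, sub_self]) _
  have h9 : S.ι (coordPt x₀ m) w =
    nabla (fun y ↦ S.proj y (σ y)) (coordPt x₀ m) (fromCoordT EM x₀ m u) := hw
  rw [h7, add_apply, map_add, proj, ContinuousLinearMap.comp_apply, ContinuousLinearMap.comp_apply,
    h8, map_zero, add_zero, ← h9, S.ρ_ι]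

/-- The coordinate vector fields commute. -/
theorem mlieBracket_symmL (hm : m ∈ coordDomain F E x₀) (u v : EM)
    (hu : MDifferentiableAt 𝓘(ℝ, EM) 𝓘(ℝ, EM).tangent (fun y ↦ (⟨y, (trivializationAt EM
      (TangentSpace 𝓘(ℝ, EM) : M → Type _) x₀).symmL ℝ y u⟩ : TangentBundle 𝓘(ℝ, EM) M))
      (coordPt x₀ m))
    (hv : MDifferentiableAt 𝓘(ℝ, EM) 𝓘(ℝ, EM).tangent (fun y ↦ (⟨y, (trivializationAt EM
      (TangentSpace 𝓘(ℝ, EM) : M → Type _) x₀).symmL ℝ y v⟩ : TangentBundle 𝓘(ℝ, EM) M))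
      (coordPt x₀ m)) :
    mlieBracket 𝓘(ℝ, EM)
      (fun y ↦ (trivializationAt EM (TangentSpace 𝓘(ℝ, EM) : M → Type _) x₀).symmL ℝ y u)
      (fun y ↦ (trivializationAt EM (TangentSpace 𝓘(ℝ, EM) : M → Type _) x₀).symmL ℝ y v)
      (coordPt x₀ m) = 0 := by
  -- Pulled back by the inverse chart, these fields become constant, and the bracket commutes with
  -- pullback.
  have h1 (w : EM) : mpullback 𝓘(ℝ, EM) 𝓘(ℝ, EM) (fun m' : EM ↦ coordPt x₀ m')
      (fun y ↦ (trivializationAt EM (TangentSpace 𝓘(ℝ, EM) : M → Type _) x₀).symmL ℝ y w)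
      =ᶠ[𝓝 m] fun _ ↦ w := by
    filter_upwards [isOpen_coordDomain.mem_nhds hm] with m' hm'
    have h2 := isInvertible_mfderivWithin_extChartAt_symm (I := 𝓘(ℝ, EM)) hm'.1
    rw [modelWithCornersSelf_coe, Set.range_id, mfderivWithin_univ] at h2
    rw [mpullback_apply, fromCoordT_eq_symmL hm']
    exact h2.inverse_apply_eq.2 rfl
  have hmin : minSmoothness ℝ 2 = 2 := minSmoothness_of_isRCLikeNormedField
  have : IsManifold 𝓘(ℝ, EM) (minSmoothness ℝ 2) M := by
    rw [hmin]
    infer_instance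
  have h2 := mpullback_mlieBracket hu hv (contMDiffAt_coordPt hm) (hmin.trans_le ENat.LEInfty.out)
  have h3 : ∀ X Y : EM → EM, X =ᶠ[𝓝 m] (fun _ ↦ u) → Y =ᶠ[𝓝 m] (fun _ ↦ v) →
      lieBracketWithin ℝ X Y Set.univ m = 0 := by
    intro X Y hX hY
    rw [lieBracketWithin_univ, hX.lieBracket_vectorField_eq hY]
    simp [lieBracket_eq]
  rw [← mlieBracketWithin_univ (I := 𝓘(ℝ, EM)) (M := EM),
    mlieBracketWithin_eq_lieBracketWithin] at h2
  have h4 := isInvertible_mfderivWithin_extChartAt_symm (I := 𝓘(ℝ, EM)) hm.1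
  rw [modelWithCornersSelf_coe, Set.range_id, mfderivWithin_univ] at h4
  have h5 := h2.trans (h3 _ _ (h1 u) (h1 v))
  rw [mpullback_apply] at h5
  exact (h4.inverse_apply_eq.1 h5).trans (ContinuousLinearMap.map_zero _)

/-- Evaluate the torsion of $D$ on commuting coordinate fields and apply $\iota$, which carries $D$
to $\nabla$. -/
theorem IsInducedBy.torsion
    {D : CovariantDerivative 𝓘(ℝ, EM) EM (TangentSpace 𝓘(ℝ, EM) : M → Type _)}
    (h : S.IsInducedBy nabla D) (hD : D.torsion = 0) (hm : m ∈ coordDomain F E x₀)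
    (hι : DifferentiableAt ℝ (S.coordι x₀) m) (u v : EM) :
    fderiv ℝ (S.coordι x₀) m u v + connForm nabla x₀ m u (S.coordι x₀ m v) =
      fderiv ℝ (S.coordι x₀) m v u + connForm nabla x₀ m v (S.coordι x₀ m u) := by
  set X : EM → ∀ y : M, TangentSpace 𝓘(ℝ, EM) y := fun w y ↦
    (trivializationAt EM (TangentSpace 𝓘(ℝ, EM) : M → Type _) x₀).symmL ℝ y w with hXdef
  have hX (w : EM) : MDifferentiableAt 𝓘(ℝ, EM) 𝓘(ℝ, EM).tangent
      (fun y ↦ (⟨y, X w y⟩ : TangentBundle 𝓘(ℝ, EM) M)) (coordPt x₀ m) := by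
    have hm' : m ∈ coordDomain EM (TangentSpace 𝓘(ℝ, EM) : M → Type _) x₀ := ⟨hm.1, mem_source hm⟩
    refine (mdifferentiableAt_sec_iff hm').2
      ((differentiableAt_const w).congr_of_eventuallyEq ?_)
    filter_upwards [isOpen_coordDomain.mem_nhds hm'] with m' hm''
    exact toCoord_fromCoord hm'' w
  have hXm (w : EM) : X w (coordPt x₀ m) = fromCoordT EM x₀ m w := by
    simp only [hXdef, fromCoordT_eq_symmL hm]
  have h1 (u v : EM) : fromCoord F E x₀ m (fderiv ℝ (S.coordι x₀) m u v +
      connForm nabla x₀ m u (S.coordι x₀ m v)) =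
      S.ι (coordPt x₀ m) (D (X v) (coordPt x₀ m) (X u (coordPt x₀ m))) := by
    have h2 : coordSec F x₀ (fun y ↦ S.ι y (X v y)) =ᶠ[𝓝 m] fun m' ↦ S.coordι x₀ m' v := by
      filter_upwards [isOpen_coordDomain.mem_nhds hm] with m' hm'
      simp only [coordSec_apply, hXdef, fromCoordT_eq_symmL hm']
      rfl
    have h3 := (hι.hasFDerivAt.clm_apply (hasFDerivAt_const v m)).congr_of_eventuallyEq h2
    rw [← h.restrict_eq _ _ (hX v), hXm, nabla_eq hm h3.differentiableAt, h3.fderiv,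
      h2.self_of_nhds]
    simp
  refine fromCoord_injective hm ?_
  rw [h1, h1]
  congr 1
  rw [← sub_eq_zero, D.torsion_eq_zero_iff.1 hD (hX u) (hX v)]
  exact mlieBracket_symmL hm u v (hX u) (hX v)

theorem finrank_ker_coordEnd_proj (hm : m ∈ coordDomain F E x₀) :
    finrank ℝ (LinearMap.ker (coordEnd F x₀ S.proj m).toLinearMap) =
      finrank ℝ (S.V (coordPt x₀ m)) := by
  let L : F ≃ₗ[ℝ] E (coordPt x₀ m) := LinearEquiv.ofBijective (fromCoord F E x₀ m).toLinearMap
    ⟨fromCoord_injective hm, fromCoord_surjective hm⟩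
  have h : LinearMap.ker (coordEnd F x₀ S.proj m).toLinearMap =
      (S.V (coordPt x₀ m)).comap (L : F →ₗ[ℝ] E (coordPt x₀ m)) := by
    ext f
    change coordEnd F x₀ S.proj m f = 0 ↔ S.ρ (coordPt x₀ m) (fromCoord F E x₀ m f) = 0
    rw [← coordι_coordρ hm, ← fromCoordT_coordρ hm]
    constructor
    · intro h0
      rw [← coordρ_coordι (S := S) hm (S.coordρ x₀ m f), h0, map_zero, map_zero]
    · intro h0
      rw [fromCoordT_injective hm (h0.trans (map_zero _).symm), map_zero]
  rw [h]
  exact (LinearEquiv.ofSubmodule' L (S.V (coordPt x₀ m))).finrank_eq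

/-- `map_V_le` speaks of unit quaternions only; $I,J,K$ are such, and linearity gives the condition
on all of $Q$. -/
theorem isFQuaternionFrame (hm : m ∈ coordDomain F E x₀)
    {I J K : ∀ y : M, E y →L[ℝ] E y}
    (hfr : I (coordPt x₀ m) ∘L I (coordPt x₀ m) = -ContinuousLinearMap.id ℝ (E (coordPt x₀ m)) ∧
        J (coordPt x₀ m) ∘L J (coordPt x₀ m) = -ContinuousLinearMap.id ℝ (E (coordPt x₀ m)) ∧
        I (coordPt x₀ m) ∘L J (coordPt x₀ m) = K (coordPt x₀ m) ∧
        J (coordPt x₀ m) ∘L I (coordPt x₀ m) = -K (coordPt x₀ m) ∧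
        S.Q (coordPt x₀ m) =
          Submodule.span ℝ {I (coordPt x₀ m), J (coordPt x₀ m), K (coordPt x₀ m)}) :
    IsFQuaternionFrame (coordEnd F x₀ I m) (coordEnd F x₀ J m) (coordEnd F x₀ K m)
      (coordEnd F x₀ S.proj m) := by
  obtain ⟨hII, hJJ, hIJ, hJI, hQ⟩ := hfr
  set x := coordPt x₀ m
  have hP (w : TangentSpace 𝓘(ℝ, EM) x) : S.proj x (S.ι x w) = S.ι x w := by
    rw [proj, ContinuousLinearMap.comp_apply, S.ρ_ι]
  refine ⟨⟨?_, ?_, ?_, ?_⟩, ?_, ?_⟩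
  · rw [coordEnd_eq_coordLin, ← coordLin_mul hm, hII, coordLin_neg_id hm]
  · rw [coordEnd_eq_coordLin, ← coordLin_mul hm, hJJ, coordLin_neg_id hm]
  · rw [coordEnd_eq_coordLin, coordEnd_eq_coordLin, ← coordLin_mul hm, hIJ]
    rfl
  · rw [coordEnd_eq_coordLin, coordEnd_eq_coordLin, ← coordLin_mul hm, hJI, map_neg]
    rfl
  · rw [coordEnd_eq_coordLin, ← coordLin_mul hm]
    congr 1
    exact ContinuousLinearMap.ext fun v ↦ hP _
  · intro q hq v hv
    obtain ⟨T, rfl⟩ : ∃ T, coordLin F E x₀ m T = q := ⟨_, coordLin_fromCoord_comp hm q⟩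
    simp only [coordEnd_eq_coordLin] at hq hv ⊢
    rw [coordLin_mem_span_iff hm, ← hQ] at hq
    have h0 : S.ρ x (fromCoord F E x₀ m v) = 0 := by
      have h1 : S.ι x (S.ρ x (fromCoord F E x₀ m v)) = 0 := by
        rw [← fromCoord_toCoord hm (S.ι x (S.ρ x (fromCoord F E x₀ m v)))]
        exact (congrArg _ hv).trans (map_zero _)
      rw [← S.ρ_ι x (S.ρ x (fromCoord F E x₀ m v)), h1, map_zero]
    have hgen : ∀ A ∈ ({I x, J x, K x} : Set (E x →L[ℝ] E x)),
        S.proj x (A (fromCoord F E x₀ m v)) = A (fromCoord F E x₀ m v) := by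
      intro A hA
      have hAA : A ∘L A = -ContinuousLinearMap.id ℝ (E x) := by
        rcases hA with rfl | rfl | rfl
        · exact hII
        · exact hJJ
        · exact IsQuaternionFrame.KK ⟨hII, hJJ, hIJ, hJI⟩
      obtain ⟨w, hw⟩ := S.map_V_le x A ⟨hQ ▸ Submodule.subset_span hA, hAA⟩ _ h0
      rw [hw, hP]
    have hT : S.proj x (T (fromCoord F E x₀ m v)) = T (fromCoord F E x₀ m v) := by
      rw [hQ] at hq
      induction hq using Submodule.span_induction with
      | mem A hA => exact hgen A hA
      | zero => exact map_zero _
      | add A B _ _ hA hB => rw [add_apply, map_add, hA, hB]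
      | smul c A _ hA => rw [smul_apply, map_smul, hA]
    rw [coordLin_apply T, coordLin_apply, fromCoord_toCoord hm, hT]

end AlmostFQuaternionicStructure

end LocalModel

set_option linter.unusedSectionVars false

/-- Being $C^\infty$ at a point gives, for each finite order, a neighbourhood depending on the
order. Order two is fixed, as it suffices for the curvature identities. -/
theorem eventually_contDiffAt_two {V G : Type*} [NormedAddCommGroup V] [NormedSpace ℝ V]
    [NormedAddCommGroup G] [NormedSpace ℝ G] {f : V → G} {x : V} (hf : ContDiffAt ℝ ∞ f x) :
    ∀ᶠ y in 𝓝 x, ContDiffAt ℝ 2 f y :=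
  (hf.of_le ENat.LEInfty.out).eventually (by simp)

/-! ### Existence of the local model and its relation to $Z$ and $\mathcal{C}$. -/

section Integrability

variable {EM : Type*} [NormedAddCommGroup EM] [NormedSpace ℝ EM] [FiniteDimensional ℝ EM]
  {M : Type*} [TopologicalSpace M] [T2Space M] [ChartedSpace EM M] [IsManifold 𝓘(ℝ, EM) ∞ M]
  {F : Type*} [NormedAddCommGroup F] [NormedSpace ℝ F] [FiniteDimensional ℝ F]
  {E : M → Type*} [TopologicalSpace (TotalSpace F E)]
  [∀ x, AddCommGroup (E x)] [∀ x, Module ℝ (E x)] [∀ x, TopologicalSpace (E x)]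
  [∀ x, IsTopologicalAddGroup (E x)] [∀ x, ContinuousSMul ℝ (E x)]
  [FiberBundle F E] [VectorBundle ℝ F E] [ContMDiffVectorBundle ∞ F E 𝓘(ℝ, EM)]
  {S : AlmostFQuaternionicStructure EM F E} {nabla : CovariantDerivative 𝓘(ℝ, EM) F E}

/-- `𝒟` is the coordinate expression of `(S, ∇)` around `x₀`. -/
structure IsCoordExpr (S : AlmostFQuaternionicStructure EM F E)
    (nabla : CovariantDerivative 𝓘(ℝ, EM) F E) (x₀ : M) (𝒟 : LocalFQuaternionic EM F) : Prop where
  mem_U : extChartAt 𝓘(ℝ, EM) x₀ x₀ ∈ 𝒟.U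
  U_subset : 𝒟.U ⊆ coordDomain F E x₀
  ρ_eq : 𝒟.ρ = S.coordρ x₀
  Γ_eq : 𝒟.Γ = connForm nabla x₀
  mem_Q : ∀ m ∈ 𝒟.U, ∀ T, coordLin F E x₀ m T ∈ 𝒟.Q m ↔ T ∈ S.Q (coordPt x₀ m)

theorem exists_isCoordExpr [CovariantDerivative.ContMDiffCovariantDerivative nabla ∞]
    {D : CovariantDerivative 𝓘(ℝ, EM) EM (TangentSpace 𝓘(ℝ, EM) : M → Type _)}
    (hD : D.torsion = 0) (hnabla : S.IsInducedBy nabla D)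
    (hrank : ∀ x, finrank ℝ F = 4 * finrank ℝ (S.V x)) (hrank12 : 12 ≤ finrank ℝ F) (x₀ : M) :
    ∃ 𝒟, IsCoordExpr S nabla x₀ 𝒟 := by
  obtain ⟨W, hWo, hW, I, J, K, hI, hJ, hK, hfr⟩ := S.exists_local_frame x₀
  have hWx := hWo.mem_nhds hW
  have hcont : ∀ᶠ m in 𝓝 (extChartAt 𝓘(ℝ, EM) x₀ x₀), coordPt x₀ m ∈ W := by
    have h := continuousAt_extChartAt_symm (I := 𝓘(ℝ, EM)) x₀
    rw [ContinuousAt, extChartAt_to_inv] at h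
    exact h hWx
  have hall := (((((((eventually_contDiffAt_two (contDiffAt_coordEnd (hI.contMDiffAt hWx))).and
    (eventually_contDiffAt_two (contDiffAt_coordEnd (hJ.contMDiffAt hWx)))).and
    (eventually_contDiffAt_two (contDiffAt_coordEnd (hK.contMDiffAt hWx)))).and
    (eventually_contDiffAt_two (AlmostFQuaternionicStructure.contDiffAt_coordEnd_proj (S := S)))).and
    (eventually_contDiffAt_two (AlmostFQuaternionicStructure.contDiffAt_coordι (S := S)))).and
    (eventually_contDiffAt_two (contDiffAt_connForm nabla x₀))).and hcont).and
    (eventually_mem_coordDomain (F := F) (E := E))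
  obtain ⟨U, hU, hUo, hxU⟩ := eventually_nhds_iff.1 hall
  have hUW {m : EM} (hm : m ∈ U) : coordPt x₀ m ∈ W := (hU m hm).1.2
  have hUD {m : EM} (hm : m ∈ U) : m ∈ coordDomain F E x₀ := (hU m hm).2
  have cI {m : EM} (hm : m ∈ U) : ContDiffAt ℝ 2 (coordEnd F x₀ I) m := (hU m hm).1.1.1.1.1.1.1
  have cJ {m : EM} (hm : m ∈ U) : ContDiffAt ℝ 2 (coordEnd F x₀ J) m := (hU m hm).1.1.1.1.1.1.2
  have cK {m : EM} (hm : m ∈ U) : ContDiffAt ℝ 2 (coordEnd F x₀ K) m := (hU m hm).1.1.1.1.1.2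
  have cP {m : EM} (hm : m ∈ U) : ContDiffAt ℝ 2 (coordEnd F x₀ S.proj) m := (hU m hm).1.1.1.1.2
  have cι {m : EM} (hm : m ∈ U) : ContDiffAt ℝ 2 (S.coordι x₀) m := (hU m hm).1.1.1.2
  have cΓ {m : EM} (hm : m ∈ U) : ContDiffAt ℝ 2 (connForm nabla x₀) m := (hU m hm).1.1.2
  have hQ {m : EM} (hm : m ∈ U) (T : E (coordPt x₀ m) →L[ℝ] E (coordPt x₀ m)) :
      coordLin F E x₀ m T ∈ Submodule.span ℝ
        {coordEnd F x₀ I m, coordEnd F x₀ J m, coordEnd F x₀ K m} ↔ T ∈ S.Q (coordPt x₀ m) := by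
    rw [(hfr _ (hUW hm)).2.2.2.2]
    exact coordLin_mem_span_iff (hUD hm)
  have hpar {A : ∀ y : M, E y →L[ℝ] E y} (hA : ∀ y ∈ W, A y ∈ S.Q y) {m : EM} (hm : m ∈ U)
      (hAd : ContDiffAt ℝ 2 (coordEnd F x₀ A) m) (u : EM) :
      fderiv ℝ (coordEnd F x₀ A) m u + (connForm nabla x₀ m u * coordEnd F x₀ A m -
        coordEnd F x₀ A m * connForm nabla x₀ m u) ∈ Submodule.span ℝ
        {coordEnd F x₀ I m, coordEnd F x₀ J m, coordEnd F x₀ K m} := by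
    obtain ⟨B, hB, h⟩ := hnabla.compatible.quaternionic.exists_coordLin_eq (hUD hm)
      (hAd.differentiableAt two_ne_zero)
      (by filter_upwards [hWo.mem_nhds (hUW hm)] with y hy using hA y hy) u
    rw [h]
    exact (hQ hm B).2 hB
  have hfin {m : EM} (hm : m ∈ U) :
      finrank ℝ F = 4 * finrank ℝ (LinearMap.ker (coordEnd F x₀ S.proj m).toLinearMap) := by
    rw [AlmostFQuaternionicStructure.finrank_ker_coordEnd_proj (hUD hm)]
    exact hrank _
  refine ⟨{
    U := U
    I := coordEnd F x₀ I
    J := coordEnd F x₀ J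
    K := coordEnd F x₀ K
    P := coordEnd F x₀ S.proj
    ι := S.coordι x₀
    ρ := S.coordρ x₀
    Γ := connForm nabla x₀
    isOpen_U := hUo
    contDiffOn_I := fun m hm ↦ (cI hm).contDiffWithinAt
    contDiffOn_J := fun m hm ↦ (cJ hm).contDiffWithinAt
    contDiffOn_K := fun m hm ↦ (cK hm).contDiffWithinAt
    contDiffOn_P := fun m hm ↦ (cP hm).contDiffWithinAt
    contDiffOn_ι := fun m hm ↦ (cι hm).contDiffWithinAt
    contDiffOn_Γ := fun m hm ↦ (cΓ hm).contDiffWithinAt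
    frame := fun m hm ↦
      AlmostFQuaternionicStructure.isFQuaternionFrame (hUD hm) (hfr _ (hUW hm))
    ρ_ι := fun m hm u ↦ AlmostFQuaternionicStructure.coordρ_coordι (hUD hm) u
    ι_ρ := fun m hm f ↦ AlmostFQuaternionicStructure.coordι_coordρ (hUD hm) f
    torsion := fun m hm u v ↦ hnabla.torsion hD (hUD hm)
      ((cι hm).differentiableAt two_ne_zero) u v
    parallel_P := fun m hm u ↦ hnabla.compatible.parallel_proj (hUD hm)
      ((cP hm).differentiableAt two_ne_zero) u
    parallel_I := fun m hm u ↦ hpar (fun y hy ↦ by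
      rw [(hfr y hy).2.2.2.2]
      exact Submodule.subset_span (by simp)) hm (cI hm) u
    parallel_J := fun m hm u ↦ hpar (fun y hy ↦ by
      rw [(hfr y hy).2.2.2.2]
      exact Submodule.subset_span (by simp)) hm (cJ hm) u
    parallel_K := fun m hm u ↦ hpar (fun y hy ↦ by
      rw [(hfr y hy).2.2.2.2]
      exact Submodule.subset_span (by simp)) hm (cK hm) u
    finrank_eq := fun m hm ↦ hfin hm
    -- From $12\le\dim E=4\dim V$.
    le_finrank := fun m hm ↦ by have := hfin hm; omega }, hxU, fun m hm ↦ hUD hm, rfl, rfl,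
    fun m hm T ↦ hQ hm T⟩

namespace IsCoordExpr

variable {x₀ : M} {𝒟 : LocalFQuaternionic EM F} (h : IsCoordExpr S nabla x₀ 𝒟)
  {q : EM × (F →L[ℝ] F)}
include h

theorem endPt_mem_Z_iff (hq : q.1 ∈ 𝒟.U) : endPt F E x₀ q ∈ S.Z ↔ q ∈ 𝒟.Z := by
  have hD := h.U_subset hq
  have h1 : coordLin F E x₀ q.1 (endPt F E x₀ q).2 = q.2 := coordLin_fromCoord_comp hD q.2
  have h2 := h.mem_Q _ hq (endPt F E x₀ q).2
  rw [h1] at h2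
  have h3 : (endPt F E x₀ q).2 ∘L (endPt F E x₀ q).2 =
      -ContinuousLinearMap.id ℝ (E (endPt F E x₀ q).1) ↔ q.2 * q.2 = -1 := by
    have h4 := coordLin_mul hD (endPt F E x₀ q).2 (endPt F E x₀ q).2
    rw [h1] at h4
    have h5 := coordLin_neg_id (F := F) (E := E) hD
    rw [← h4, ← h5]
    exact (coordLin_injective hD).eq_iff.symm
  exact ⟨fun hZ ↦ ⟨hq, h2.2 hZ.1, h3.1 hZ.2⟩, fun hZ ↦ ⟨h2.1 hZ.2.1, h3.2 hZ.2.2⟩⟩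

/-- In the chart, `vert` is the projection along the horizontal space, so the vertical and
horizontal summands of $\mathcal{C}$ become the conditions on `vert` and on the base component. -/
theorem cpx_mem_distC_iff (hq : q ∈ 𝒟.Z) (ξ₁ ξ₂ : EM × (F →L[ℝ] F)) :
    cpx (dEndPt F E x₀ q ξ₁) (dEndPt F E x₀ q ξ₂) ∈
      S.distC S.ρ nabla (endPt F E x₀ q) ↔ 𝒟.IsTypeC q ξ₁ ξ₂ := by
  have hD := h.U_subset hq.1
  have hvl (T : E (endPt F E x₀ q).1 →L[ℝ] E (endPt F E x₀ q).1) :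
      verticalLift (EM := EM) (endPt F E x₀ q) T =
        dEndPt F E x₀ q (0, coordLin F E x₀ q.1 T) := by
    rw [← verticalLift_endPt hD]
    congr 1
    exact (fromCoord_comp_coordLin hD T).symm
  have h1 : coordLin F E x₀ q.1 (endPt F E x₀ q).2 = q.2 := coordLin_fromCoord_comp hD q.2
  rw [QuaternionicStructure.cpx_mem_distC S.toQuaternionicStructure
    ((h.endPt_mem_Z_iff hq.1).2 hq) ((dEndPt F E x₀ q).toLinearMap ∘ₗ
      LinearMap.inr ℝ EM (F →L[ℝ] F) ∘ₗ coordLin F E x₀ q.1) hvl]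
  have hb (e : E (coordPt x₀ q.1)) (u : EM) :
      fromCoordT EM x₀ q.1 u = S.ρ (coordPt x₀ q.1) e ↔ u = 𝒟.ρ q.1 (toCoord F E x₀ q.1 e) := by
    rw [h.ρ_eq, ← (fromCoordT_injective hD).eq_iff,
      AlmostFQuaternionicStructure.fromCoordT_coordρ hD, fromCoord_toCoord hD]
  have hJ (e : E (coordPt x₀ q.1)) :
      toCoord F E x₀ q.1 ((endPt F E x₀ q).2 e) = q.2 (toCoord F E x₀ q.1 e) :=
    toCoord_fromCoord hD _
  have hadd (ξ η : EM × (F →L[ℝ] F)) :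
      dEndPt F E x₀ q ξ + dEndPt F E x₀ q η = dEndPt F E x₀ q (ξ + η) :=
    (ContinuousLinearMap.map_add _ _ _).symm
  have hanti (A : E (endPt F E x₀ q).1 →L[ℝ] E (endPt F E x₀ q).1) :
      (endPt F E x₀ q).2 ∘L A + A ∘L (endPt F E x₀ q).2 = 0 ↔
        q.2 * coordLin F E x₀ q.1 A + coordLin F E x₀ q.1 A * q.2 = 0 := by
    have h2 := coordLin_mul hD (endPt F E x₀ q).2 A
    have h3 := coordLin_mul hD A (endPt F E x₀ q).2
    rw [h1] at h2 h3
    rw [← h2, ← h3, ← map_add]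
    exact ((coordLin_injective hD).eq_iff' (map_zero _)).symm
  constructor
  · rintro ⟨A, hA, hA', e, k₁, hk₁, k₂, hk₂, he₁, he₂, h2, h3⟩
    obtain ⟨η₁, rfl⟩ := dEndPt_surjective hD k₁
    obtain ⟨η₂, rfl⟩ := dEndPt_surjective hD k₂
    rw [dEndPt_mem_horizontal_iff hD, ← h.Γ_eq] at hk₁ hk₂
    rw [dproj_dEndPt hD] at he₁ he₂
    have hη₁ := (hb _ _).1 he₁
    have hη₂ := ((hb _ _).1 he₂).trans (congrArg (𝒟.ρ q.1) (hJ e))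
    have h4 := dEndPt_injective hD (h2.trans (hadd _ _))
    have h5 := dEndPt_injective hD (h3.trans (hadd _ _))
    have h6 : coordLin F E x₀ q.1 ((endPt F E x₀ q).2 ∘L A) =
        q.2 * coordLin F E x₀ q.1 A := by
      rw [← h1]
      exact coordLin_mul hD _ _
    have hv (C : F →L[ℝ] F) {η : EM × (F →L[ℝ] F)}
        (hη : η.2 + (𝒟.Γ q.1 η.1 * q.2 - q.2 * 𝒟.Γ q.1 η.1) = 0) :
        𝒟.vert q ((0, C) + η) = C := by
      rw [LocalFQuaternionic.vert, Prod.fst_add, Prod.snd_add, zero_add, add_assoc, hη, add_zero]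
    have hv₁ : 𝒟.vert q ξ₁ = coordLin F E x₀ q.1 A := by
      rw [h4]
      exact hv _ hk₁
    have hv₂ : 𝒟.vert q ξ₂ = q.2 * coordLin F E x₀ q.1 A := by
      rw [h5, ← h6]
      exact hv _ hk₂
    refine ⟨⟨?_, ?_⟩, ?_, toCoord F E x₀ q.1 e, ?_, ?_⟩
    · rw [hv₁]
      exact (h.mem_Q _ hq.1 A).2 hA
    · rw [hv₁]
      exact (hanti A).1 hA'
    · rw [hv₂, hv₁]
    · rw [h4, ← hη₁]
      exact zero_add _
    · rw [h5, ← hη₂]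
      exact zero_add _
  · rintro ⟨⟨h2, h3⟩, h4, e, h5, h6⟩
    set A := fromCoord F E x₀ q.1 ∘L 𝒟.vert q ξ₁ ∘L toCoord F E x₀ q.1
    have hA : coordLin F E x₀ q.1 A = 𝒟.vert q ξ₁ := coordLin_fromCoord_comp hD _
    have hJA : coordLin F E x₀ q.1 ((endPt F E x₀ q).2 ∘L A) = 𝒟.vert q ξ₂ := by
      rw [h4, ← h1, ← hA]
      exact coordLin_mul hD _ _
    -- The splitting used is $\xi=(0,\mathrm{vert}\,\xi)+(\xi_1,\xi_2-\mathrm{vert}\,\xi)$.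
    have hh (ξ : EM × (F →L[ℝ] F)) : dEndPt F E x₀ q (ξ.1, ξ.2 - 𝒟.vert q ξ) ∈
        horizontal nabla (endPt F E x₀ q) := by
      rw [dEndPt_mem_horizontal_iff hD, ← h.Γ_eq, LocalFQuaternionic.vert]
      simp
    refine ⟨A, ?_, (hanti A).2 (by rwa [hA]), fromCoord F E x₀ q.1 e, _, hh ξ₁, _, hh ξ₂, ?_, ?_,
      ?_, ?_⟩
    · rw [← hA] at h2
      exact (h.mem_Q _ hq.1 A).1 h2
    · rw [dproj_dEndPt hD]
      refine (hb _ _).2 ?_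
      rw [toCoord_fromCoord hD, ← h5]
    · rw [dproj_dEndPt hD]
      refine (hb _ _).2 ?_
      refine (h6.trans (congrArg (𝒟.ρ q.1) ?_))
      exact ((hJ _).trans (congrArg q.2 (toCoord_fromCoord hD e))).symm
    · refine Eq.trans ?_ (hadd (0, coordLin F E x₀ q.1 A) _).symm
      rw [hA]
      simp
    · refine Eq.trans ?_ (hadd (0, coordLin F E x₀ q.1 ((endPt F E x₀ q).2 ∘L A)) _).symm
      rw [hJA]
      simp

end IsCoordExpr

/-- The preferred chart of $\mathrm{End}(E)$ at a point depends only on its base point, so the chart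
at $(x_0,0)$ reaches the whole fibre over $x_0$. -/
theorem exists_endPt_eq (p : EndTotal F E) : ∃ (x₀ : M) (q : EM × (F →L[ℝ] F)),
    q.1 = extChartAt 𝓘(ℝ, EM) x₀ x₀ ∧ endPt F E x₀ q = p := by
  obtain ⟨x₀, A⟩ := p
  have h : extChartAt (endModel EM F) (⟨x₀, 0⟩ : EndTotal F E) =
      extChartAt (endModel EM F) (⟨x₀, A⟩ : EndTotal F E) := by
    rw [FiberBundle.extChartAt, FiberBundle.extChartAt]
  refine ⟨x₀, extChartAt (endModel EM F) (⟨x₀, A⟩ : EndTotal F E) ⟨x₀, A⟩, ?_, ?_⟩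
  · rw [FiberBundle.extChartAt]
    rfl
  · rw [endPt_eq, h]
    exact extChartAt_to_inv _

end Integrability

set_option linter.unusedSectionVars false

/-! ### Vector fields and their brackets in the chart. -/

section Pullback

variable {EM : Type*} [NormedAddCommGroup EM] [NormedSpace ℝ EM] [FiniteDimensional ℝ EM]
  {M : Type*} [TopologicalSpace M] [ChartedSpace EM M] [IsManifold 𝓘(ℝ, EM) ∞ M]
  {F : Type*} [NormedAddCommGroup F] [NormedSpace ℝ F] [FiniteDimensional ℝ F]
  {E : M → Type*} [TopologicalSpace (TotalSpace F E)]
  [∀ x, AddCommGroup (E x)] [∀ x, Module ℝ (E x)] [∀ x, TopologicalSpace (E x)]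
  [∀ x, IsTopologicalAddGroup (E x)] [∀ x, ContinuousSMul ℝ (E x)]
  [FiberBundle F E] [VectorBundle ℝ F E] [ContMDiffVectorBundle ∞ F E 𝓘(ℝ, EM)]
  {x₀ : M} {q : EM × (F →L[ℝ] F)}

variable (x₀) in
/-- The expression of a vector field in the coordinates of `End(E)` around `x₀`. -/
def coordField (X : ∀ p : EndTotal F E, TangentSpace (endModel EM F) p) :
    EM × (F →L[ℝ] F) → EM × (F →L[ℝ] F) :=
  mpullback 𝓘(ℝ, EM × (F →L[ℝ] F)) (endModel EM F) (endPt F E x₀) X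

theorem dEndPt_coordField (hq : q.1 ∈ coordDomain F E x₀)
    (X : ∀ p : EndTotal F E, TangentSpace (endModel EM F) p) :
    dEndPt F E x₀ q (coordField x₀ X q) = X (endPt F E x₀ q) :=
  ((isInvertible_mfderiv_endPt hq).inverse_apply_eq.1 rfl).symm

theorem coordField_eq_iff (hq : q.1 ∈ coordDomain F E x₀)
    (X : ∀ p : EndTotal F E, TangentSpace (endModel EM F) p) (ξ : EM × (F →L[ℝ] F)) :
    coordField x₀ X q = ξ ↔ X (endPt F E x₀ q) = dEndPt F E x₀ q ξ :=
  (isInvertible_mfderiv_endPt hq).inverse_apply_eq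

theorem differentiableAt_coordField (hq : q.1 ∈ coordDomain F E x₀)
    {X : ∀ p : EndTotal F E, TangentSpace (endModel EM F) p}
    (hX : ContMDiffAt (endModel EM F) (endModel EM F).tangent ∞ (fieldSection X)
      (endPt F E x₀ q)) : DifferentiableAt ℝ (coordField x₀ X) q := by
  have : IsManifold (endModel EM F) (∞ + 1) (EndTotal F E) := isManifold_endTotal
  have h := ContMDiffAt.mpullback_vectorField_preimage (m := 1) (hX.of_le ENat.LEInfty.out)
    (contMDiffAt_endPt hq) (isInvertible_mfderiv_endPt hq) (by norm_num; exact ENat.LEInfty.out)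
  exact (contMDiffAt_vectorSpace_iff_contDiffAt.1 h).differentiableAt one_ne_zero

theorem dEndPt_lieBracket_coordField (hq : q.1 ∈ coordDomain F E x₀)
    {X Y : ∀ p : EndTotal F E, TangentSpace (endModel EM F) p}
    (hX : ContMDiffAt (endModel EM F) (endModel EM F).tangent ∞ (fieldSection X)
      (endPt F E x₀ q))
    (hY : ContMDiffAt (endModel EM F) (endModel EM F).tangent ∞ (fieldSection Y)
      (endPt F E x₀ q)) :
    dEndPt F E x₀ q (lieBracket ℝ (coordField x₀ X) (coordField x₀ Y) q) =
      mlieBracket (endModel EM F) X Y (endPt F E x₀ q) := by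
  have hmin : minSmoothness ℝ 2 = 2 := minSmoothness_of_isRCLikeNormedField
  have hman : IsManifold (endModel EM F) ∞ (EndTotal F E) := isManifold_endTotal
  have : IsManifold (endModel EM F) (minSmoothness ℝ 2) (EndTotal F E) := by
    rw [hmin]
    exact IsManifold.of_le (n := ∞) ENat.LEInfty.out
  have h := mpullback_mlieBracket (hX.mdifferentiableAt (by simp))
    (hY.mdifferentiableAt (by simp)) (contMDiffAt_endPt hq) (hmin.trans_le ENat.LEInfty.out)
  rw [← mlieBracketWithin_univ (I := 𝓘(ℝ, EM × (F →L[ℝ] F))) (M := EM × (F →L[ℝ] F)),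
    mlieBracketWithin_eq_lieBracketWithin] at h
  have h' : ∀ X Y : EM × (F →L[ℝ] F) → EM × (F →L[ℝ] F),
      lieBracketWithin ℝ X Y Set.univ q = lieBracket ℝ X Y q := fun X Y ↦ by
    rw [lieBracketWithin_univ]
  exact ((coordField_eq_iff hq _ _).1 (h.trans (h' _ _))).symm

end Pullback

/-- Naturality of the bracket under the chart reduces the claim to `isTypeC_lieBracket`; membership
in $\mathcal{C}$ is needed only at points of $Z$ near $q$. -/
theorem IsCoordExpr.lieBracket_mem_distC
    {EM : Type*} [NormedAddCommGroup EM] [NormedSpace ℝ EM] [FiniteDimensional ℝ EM]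
    {M : Type*} [TopologicalSpace M] [T2Space M] [ChartedSpace EM M] [IsManifold 𝓘(ℝ, EM) ∞ M]
    {F : Type*} [NormedAddCommGroup F] [NormedSpace ℝ F] [FiniteDimensional ℝ F]
    {E : M → Type*} [TopologicalSpace (TotalSpace F E)]
    [∀ x, AddCommGroup (E x)] [∀ x, Module ℝ (E x)] [∀ x, TopologicalSpace (E x)]
    [∀ x, IsTopologicalAddGroup (E x)] [∀ x, ContinuousSMul ℝ (E x)]
    [FiberBundle F E] [VectorBundle ℝ F E] [ContMDiffVectorBundle ∞ F E 𝓘(ℝ, EM)]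
    {S : AlmostFQuaternionicStructure EM F E} {nabla : CovariantDerivative 𝓘(ℝ, EM) F E}
    {x₀ : M} {𝒟 : LocalFQuaternionic EM F} (h : IsCoordExpr S nabla x₀ 𝒟)
    {q : EM × (F →L[ℝ] F)} (hq : q ∈ 𝒟.Z) {O : Set (EndTotal F E)} (hO : IsOpen O)
    (hqO : endPt F E x₀ q ∈ O)
    {X₁ X₂ Y₁ Y₂ : ∀ p : EndTotal F E, TangentSpace (endModel EM F) p}
    (hX₁ : ContMDiffOn (endModel EM F) (endModel EM F).tangent ∞ (fieldSection X₁) O)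
    (hX₂ : ContMDiffOn (endModel EM F) (endModel EM F).tangent ∞ (fieldSection X₂) O)
    (hY₁ : ContMDiffOn (endModel EM F) (endModel EM F).tangent ∞ (fieldSection Y₁) O)
    (hY₂ : ContMDiffOn (endModel EM F) (endModel EM F).tangent ∞ (fieldSection Y₂) O)
    (hX : ∀ p ∈ O ∩ S.Z, cpx (X₁ p) (X₂ p) ∈ S.distC S.ρ nabla p)
    (hY : ∀ p ∈ O ∩ S.Z, cpx (Y₁ p) (Y₂ p) ∈ S.distC S.ρ nabla p) :
    cpx (mlieBracket (endModel EM F) X₁ Y₁ (endPt F E x₀ q) -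
          mlieBracket (endModel EM F) X₂ Y₂ (endPt F E x₀ q))
        (mlieBracket (endModel EM F) X₁ Y₂ (endPt F E x₀ q) +
          mlieBracket (endModel EM F) X₂ Y₁ (endPt F E x₀ q))
      ∈ S.distC S.ρ nabla (endPt F E x₀ q) := by
  have hD := h.U_subset hq.1
  have hnhds := hO.mem_nhds hqO
  have htype {A B : ∀ p : EndTotal F E, TangentSpace (endModel EM F) p}
      (hAB : ∀ p ∈ O ∩ S.Z, cpx (A p) (B p) ∈ S.distC S.ρ nabla p) :
      ∀ᶠ q' in 𝓝[𝒟.Z] q, 𝒟.IsTypeC q' (coordField x₀ A q') (coordField x₀ B q') := by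
    filter_upwards [self_mem_nhdsWithin,
      mem_nhdsWithin_of_mem_nhds ((contMDiffAt_endPt hD).continuousAt hnhds)] with q' hq' hq'O
    have hD' := h.U_subset hq'.1
    rw [← h.cpx_mem_distC_iff hq', dEndPt_coordField hD', dEndPt_coordField hD']
    exact hAB _ ⟨hq'O, (h.endPt_mem_Z_iff hq'.1).2 hq'⟩
  have key := 𝒟.isTypeC_lieBracket hq
    (differentiableAt_coordField hD (hX₁.contMDiffAt hnhds))
    (differentiableAt_coordField hD (hX₂.contMDiffAt hnhds))
    (differentiableAt_coordField hD (hY₁.contMDiffAt hnhds))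
    (differentiableAt_coordField hD (hY₂.contMDiffAt hnhds)) (htype hX) (htype hY)
  rw [← h.cpx_mem_distC_iff hq, ContinuousLinearMap.map_sub, ContinuousLinearMap.map_add,
    dEndPt_lieBracket_coordField hD (hX₁.contMDiffAt hnhds) (hY₁.contMDiffAt hnhds),
    dEndPt_lieBracket_coordField hD (hX₂.contMDiffAt hnhds) (hY₂.contMDiffAt hnhds),
    dEndPt_lieBracket_coordField hD (hX₁.contMDiffAt hnhds) (hY₂.contMDiffAt hnhds),
    dEndPt_lieBracket_coordField hD (hX₂.contMDiffAt hnhds) (hY₁.contMDiffAt hnhds)] at key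
  exact key

end CoCR

end

theorem proposition3p3
    {EM : Type*} [NormedAddCommGroup EM] [NormedSpace ℝ EM] [FiniteDimensional ℝ EM]
    {M : Type*} [TopologicalSpace M] [T2Space M] [SecondCountableTopology M]
    [ChartedSpace EM M] [IsManifold 𝓘(ℝ, EM) ∞ M]
    {F : Type*} [NormedAddCommGroup F] [NormedSpace ℝ F] [FiniteDimensional ℝ F]
    {E : M → Type*} [TopologicalSpace (TotalSpace F E)]
    [∀ x, AddCommGroup (E x)] [∀ x, Module ℝ (E x)] [∀ x, TopologicalSpace (E x)]
    [∀ x, IsTopologicalAddGroup (E x)] [∀ x, ContinuousSMul ℝ (E x)]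
    [FiberBundle F E] [VectorBundle ℝ F E] [ContMDiffVectorBundle ∞ F E 𝓘(ℝ, EM)]
    (S : CoCR.AlmostFQuaternionicStructure EM F E)
    (D : CovariantDerivative 𝓘(ℝ, EM) EM (TangentSpace 𝓘(ℝ, EM) : M → Type _))
    (hD : D.torsion = 0)
    (nabla : CovariantDerivative 𝓘(ℝ, EM) F E)
    [CovariantDerivative.ContMDiffCovariantDerivative nabla ∞]
    (hnabla : S.IsInducedBy nabla D)
    (hrank : ∀ x, Module.finrank ℝ F = 4 * Module.finrank ℝ (S.V x))
    (hrank12 : 12 ≤ Module.finrank ℝ F) :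
    S.toAlmostCoCR.IsIntegrable nabla := by
  intro O hO X₁ X₂ Y₁ Y₂ hX₁ hX₂ hY₁ hY₂ hX hY p hp
  -- The chart is centred at the base point of $p$, so $q_1$ is its centre and lies in the domain of
  -- the local model, however small.
  obtain ⟨x₀, q, hq, rfl⟩ := CoCR.exists_endPt_eq (EM := EM) p
  obtain ⟨𝒟, h⟩ := CoCR.exists_isCoordExpr hD hnabla hrank hrank12 x₀
  exact h.lieBracket_mem_distC ((h.endPt_mem_Z_iff (hq ▸ h.mem_U)).1 hp.2) hO hp.1
    hX₁ hX₂ hY₁ hY₂ hX hY
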